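/- Let $X$ be the double heptagon: the translation surface obtained from a regular heptagon $P$ (of circumradius $1$, centered at the origin, with a vertical side on its right) and its image $-P$ by gluing each side of $P$ to the parallel side of $-P$ by a translation. Its singularities are the images of the vertices, and its central points are the images of the centers of $P$ and $-P$. A separatrix is a geodesic (of constant direction) that emanates from a singularity and has no singularity in its interior; a saddle connection is a separatrix that ends at a singularity. A nonsingular point of $X$ is a connection point if every separatrix that passes through it can be extended to a saddle connection. The Veech group of $X$ is the group of derivatives, in $SL_2(\mathbb R)$, of the affine diffeomorphisms of $X$; an element $A$ is hyperbolic if $|\mathrm{tr}\,A|>2$; the trace field is the subfield of $\mathbb R$ generated by the traces of the elements of the Veech group. Then the two central points of $X$ are nonsingular and are not connection points. More precisely, let $a=2\cos(\pi/7)$ and $$\sigma=\sin(\pi/7)\left(-\tfrac23a^2+2a-\tfrac43\right).$$ 1. Through each of the two central points passes a separatrix of slope $\sigma$ that cannot be extended to a saddle connection. 2. The direction $(1,\sigma)$ is fixed by a hyperbolic element of the Veech group: it is an eigendirection of that element. 3. In the coordinates of the staircase model, that is, in the basis of $\mathbb R^2$ formed by the vectors $(\cos(\pi/7)+1,\,-\sin(\pi/7))$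 and $(\cos(\pi/7)+1,\,\sin(\pi/7))$, the slope of this direction lies in the trace field. -/

import Mathlib

open Set Filter Topology Matrix

namespace DoubleHeptagon

noncomputable section

/-- The Euclidean plane, in coordinates. -/
abbrev Plane : Type := Fin 2 → ℝ

/-- The outward unit normals `exp (2πik/7)` to the sides of the heptagon `P false`. -/
def normal (k : Fin 7) : Plane :=
  ![Real.cos (2 * Real.pi * (k : ℕ) / 7), Real.sin (2 * Real.pi * (k : ℕ) / 7)]

/-- The apothem of a regular heptagon of circumradius one. -/
def apothem : ℝ := Real.cos (Real.pi / 7)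

theorem apothem_pos : 0 < apothem :=
  Real.cos_pos_of_mem_Ioo ⟨by linarith [Real.pi_pos], by linarith [Real.pi_pos]⟩

/-- The sign by which the normals of the first heptagon (`false`) are multiplied in order to get
the normals of the given heptagon: the second heptagon (`true`) is the first one turned by `π`. -/
def sgn (b : Bool) : ℝ := if b then -1 else 1

/-- The two closed regular heptagons of circumradius one with center at the origin of their plane;
`P false` has a vertical side on its right, and `P true = - P false`. -/
def P (b : Bool) : Set Plane := {z | ∀ k, sgn b * (normal k ⬝ᵥ z) ≤ apothem}

/-- The open heptagons. -/
def openP (b : Bool) : Set Plane := {z | ∀ k, sgn b * (normal k ⬝ᵥ z) < apothem}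

/-- The `k`-th side of `P false`, without its end points. -/
def openSide (k : Fin 7) : Set Plane :=
  {z | normal k ⬝ᵥ z = apothem ∧ ∀ j, j ≠ k → normal j ⬝ᵥ z < apothem}

/-- The translation vector that separates the centers of two heptagons
adjacent along the `k`-th side. -/
def shift (k : Fin 7) : Plane := (2 * apothem) • normal k

/-- The disjoint union of the two closed heptagons. -/
abbrev Pieces : Type := {p : Bool × Plane // p.2 ∈ P p.1}

/-- The gluing: each side of `P false` is glued by a translation to the parallel
side of `P true`. -/
def Glued (x y : Pieces) : Prop :=
  ∃ k, x.1.1 = false ∧ y.1.1 = true ∧ normal k ⬝ᵥ x.1.2 = apothem ∧ y.1.2 = x.1.2 - shift k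

/-- The double heptagon, with the quotient topology
(`Quot` divides by the equivalence relation generated by `Glued`). -/
abbrev Surface : Type := Quot Glued

/-- The point of the surface given by a point `z` of the heptagon `P b`. -/
def pt (b : Bool) (z : Plane) (h : z ∈ P b) : Surface := Quot.mk Glued ⟨(b, z), h⟩

theorem zero_mem (b : Bool) : (0 : Plane) ∈ P b := by
  intro k
  simpa using apothem_pos.le

/-- The two central points. -/
def center (b : Bool) : Surface := pt b 0 (zero_mem b)

/-- The singularities: the images of the vertices of the heptagons, a vertex being
a point that lies on two different sides. -/
def singularities : Set Surface :=
  {p | ∃ (b : Bool) (z : Plane) (h : z ∈ P b), p = pt b z h ∧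
    ∃ j k, j ≠ k ∧ sgn b * (normal j ⬝ᵥ z) = apothem ∧ sgn b * (normal k ⬝ᵥ z) = apothem}

/-- The domain of the `k`-th local parametrization: the interior of the union of `P false` with
the copy of `P true` adjacent to it along the `k`-th side. -/
def domain (k : Fin 7) : Set Plane :=
  {w | w ∈ openP false ∨ w - shift k ∈ openP true ∨ w ∈ openSide k}

/-- The translation atlas on the complement of the singularities: `HasCoord k w p` says that
`w` is the coordinate of the point `p` in the chart given by the two heptagons glued along
their `k`-th side. -/
def HasCoord (k : Fin 7) (w : Plane) (p : Surface) : Prop :=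
  w ∈ domain k ∧
    ((∃ h, p = pt false w h) ∨ (∃ h, p = pt true (w - shift k) h))

/-- Near the time `t`, the path `γ` avoids the singularities and is a straight line with
constant velocity `v` in the charts of the translation atlas. -/
def StraightAt (γ : ℝ → Surface) (v : Plane) (t : ℝ) : Prop :=
  ∃ k w, ∀ᶠ s in 𝓝 t, HasCoord k (w + (s - t) • v) (γ s)

/-- `γ`, on the interval `[0, T]`, is a separatrix with velocity `v`: a geodesic (traveled at
constant velocity) that emanates from a singularity and has no singularity in its interior.
An infinite separatrix is represented by its initial segments. -/
def IsSeparatrix (v : Plane) (T : ℝ) (γ : ℝ → Surface) : Prop :=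
  v ≠ 0 ∧ 0 < T ∧ ContinuousOn γ (Icc 0 T) ∧ γ 0 ∈ singularities ∧
    ∀ t ∈ Ioo 0 T, StraightAt γ v t

/-- A saddle connection: a separatrix that ends at a singularity. -/
def IsSaddleConnection (v : Plane) (T : ℝ) (γ : ℝ → Surface) : Prop :=
  IsSeparatrix v T γ ∧ γ T ∈ singularities

/-- The separatrix passes through the point `p`. -/
def PassesThrough (T : ℝ) (γ : ℝ → Surface) (p : Surface) : Prop := ∃ t ∈ Ioc 0 T, γ t = p

/-- The separatrix `γ`, given on `[0, T]`, can be extended to a saddle connection. -/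
def ExtendsToSaddleConnection (v : Plane) (T : ℝ) (γ : ℝ → Surface) : Prop :=
  ∃ T' γ', T ≤ T' ∧ IsSaddleConnection v T' γ' ∧ EqOn γ' γ (Icc 0 T)

/-- A connection point: a nonsingular point such that every separatrix that passes through it
can be extended to a saddle connection. -/
def IsConnectionPoint (p : Surface) : Prop :=
  p ∉ singularities ∧
    ∀ v T γ, IsSeparatrix v T γ → PassesThrough T γ p → ExtendsToSaddleConnection v T γ

/-- `f` is an affine diffeomorphism with derivative `A`: a homeomorphism that preserves the
singularities and is, in charts around each nonsingular point, affine with linear part `A`. -/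
def IsAffine (f : Surface ≃ₜ Surface) (A : Matrix (Fin 2) (Fin 2) ℝ) : Prop :=
  f '' singularities = singularities ∧
    ∀ p ∉ singularities, ∃ k w l w', HasCoord k w p ∧ HasCoord l w' (f p) ∧
      ∀ᶠ x in 𝓝 w, ∀ q, HasCoord k x q → HasCoord l (w' + A *ᵥ (x - w)) (f q)

/-- The Veech group (its set of elements): the derivatives of the affine diffeomorphisms. -/
def veechGroup : Set (Matrix.SpecialLinearGroup (Fin 2) ℝ) :=
  {A | ∃ f : Surface ≃ₜ Surface, IsAffine f A.1}

/-- The trace field: the subfield of `ℝ` generated by the traces of the Veech group. -/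
def traceField : Subfield ℝ := Subfield.closure {x | ∃ A ∈ veechGroup, x = A.1.trace}

/-- The number `2 cos (π/7)`. -/
def a : ℝ := 2 * Real.cos (Real.pi / 7)

/-- The slope of the distinguished separatrix. -/
def slope : ℝ := Real.sin (Real.pi / 7) * (-(2 / 3) * a ^ 2 + 2 * a - 4 / 3)

/-- The change of coordinates from the staircase model of the surface (made of rectangles with
horizontal and vertical sides) to the double heptagon. -/
def fromStaircase : Matrix (Fin 2) (Fin 2) ℝ :=
  !![Real.cos (Real.pi / 7) + 1, Real.cos (Real.pi / 7) + 1;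
     -Real.sin (Real.pi / 7), Real.sin (Real.pi / 7)]

end

end DoubleHeptagon

namespace DoubleHeptagon

noncomputable section

/-! ### Trigonometry of the regular heptagon -/

/-! The direction `![1, slope]` contains no saddle connection, although an explicit separatrix in
that direction reaches a center.

No saddle connection: some element of the Veech group has `![1, slope]` as an eigenvector with
eigenvalue `2 - a` in `(0, 1)` (`exists_contraction`). Affine diffeomorphisms carry saddle
connections to saddle connections, so its iterates would shrink a saddle connection in this
direction to arbitrarily small length (`not_isSaddleConnection`). But lengths are bounded below
(`exists_length_bound`): along a geodesic the distance to the singularities has no positive local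
maximum below a threshold, and it grows at most with the speed.

Veech group: two elements suffice. The rotation by `π / 7` exchanges the heptagons
(`isSwap_rotation`). The vertical direction decomposes into three cylinders, over the strips of the
sides 1, 2 and 3, which all have circumference divided by width equal to `invModulus`; hence the
simultaneous Dehn twist is affine, with derivative `parabolic` (`isAffine_twist`). With `R` the
rotation and `S` the inverse of `parabolic`, `S² R⁵` has trace `a ^ 2 + 2` and eigenvalue `2 - a`,
and a word in `R` and `S` carries `![1, slope]` to its eigenvector. All this is arithmetic modulo
the cubic equation of `a`, once second coordinates are divided by `halfSide`.

The separatrix: unfolding three heptagons across two sides puts a vertex and a center at the ends of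
a segment of slope `slope` that crosses only these two sides (`exists_separatrix_center_false`). The
half turn exchanges the centers and takes care of the other one. -/

theorem dot_eq (u z : Plane) : u ⬝ᵥ z = u 0 * z 0 + u 1 * z 1 := by
  simp [dotProduct, Fin.sum_univ_two]

/-- Half the length of a side. -/
def halfSide : ℝ := Real.sin (Real.pi / 7)

theorem halfSide_pos : 0 < halfSide :=
  Real.sin_pos_of_pos_of_lt_pi (by positivity) (by linarith [Real.pi_pos])

theorem apothem_sq_add_halfSide_sq : apothem ^ 2 + halfSide ^ 2 = 1 :=
  Real.cos_sq_add_sin_sq _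

theorem normal_zero_apply (k : Fin 7) :
    normal k 0 = Real.cos (2 * Real.pi * (k : ℕ) / 7) := rfl

theorem normal_one_apply (k : Fin 7) :
    normal k 1 = Real.sin (2 * Real.pi * (k : ℕ) / 7) := rfl

theorem normal_sq (k : Fin 7) : normal k 0 ^ 2 + normal k 1 ^ 2 = 1 :=
  Real.cos_sq_add_sin_sq _

theorem normal_dot_self (k : Fin 7) : normal k ⬝ᵥ normal k = 1 := by
  rw [dot_eq, ← normal_sq k]; ring

/-- The unit tangent vectors of the sides. -/
def tang (k : Fin 7) : Plane := ![-normal k 1, normal k 0]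

theorem tang_dot (k : Fin 7) (z : Plane) :
    tang k ⬝ᵥ z = -normal k 1 * z 0 + normal k 0 * z 1 := by
  rw [dot_eq]; rfl

theorem sq_norm_eq (k : Fin 7) (z : Plane) :
    z 0 ^ 2 + z 1 ^ 2 = (normal k ⬝ᵥ z) ^ 2 + (tang k ⬝ᵥ z) ^ 2 := by
  rw [tang_dot, dot_eq]
  linear_combination (-(z 0 ^ 2 + z 1 ^ 2)) * normal_sq k

/-- Expansion in the orthonormal frame of the `k`-th side. The angle is kept as twice an integer
multiple of `π / 7`, which is the form that `abs_sin_two_mul_le` needs. -/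
theorem normal_dot (j k : Fin 7) (z : Plane) :
    normal j ⬝ᵥ z = Real.cos (2 * ((((j : ℕ) : ℤ) - ((k : ℕ) : ℤ) : ℤ) * (Real.pi / 7)))
        * (normal k ⬝ᵥ z)
      + Real.sin (2 * ((((j : ℕ) : ℤ) - ((k : ℕ) : ℤ) : ℤ) * (Real.pi / 7)))
        * (tang k ⬝ᵥ z) := by
  have h : 2 * (((((j : ℕ) : ℤ) - ((k : ℕ) : ℤ) : ℤ) : ℝ) * (Real.pi / 7)) =
      2 * Real.pi * (j : ℕ) / 7 - 2 * Real.pi * (k : ℕ) / 7 := by push_cast; ring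
  rw [h, Real.cos_sub, Real.sin_sub, tang_dot, dot_eq, dot_eq]
  simp only [normal_zero_apply, normal_one_apply]
  have := Real.cos_sq_add_sin_sq (2 * Real.pi * (k : ℕ) / 7)
  set c := Real.cos (2 * Real.pi * (k : ℕ) / 7)
  set s := Real.sin (2 * Real.pi * (k : ℕ) / 7)
  linear_combination (-(Real.cos (2 * Real.pi * (j : ℕ) / 7)) * z 0
    - (Real.sin (2 * Real.pi * (j : ℕ) / 7)) * z 1) * this

/-- After division by `2 * sin x` the inequality says that `sin (x - π / 7)` and `sin (x + π / 7)`
are nonnegative. It is the trigonometric core of the fact that a side of the heptagon violates no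
constraint of another side. -/
theorem abs_sin_two_mul_le {x : ℝ} (h1 : Real.pi / 7 ≤ x) (h2 : x ≤ Real.pi - Real.pi / 7) :
    |Real.sin (2 * x)| * halfSide ≤ apothem * (1 - Real.cos (2 * x)) ∧
      0 < 1 - Real.cos (2 * x) := by
  have hp := Real.pi_pos
  have hs : 0 < Real.sin x := Real.sin_pos_of_pos_of_lt_pi (by linarith) (by linarith)
  have h3 : 0 ≤ Real.sin (x - Real.pi / 7) :=
    Real.sin_nonneg_of_nonneg_of_le_pi (by linarith) (by linarith)
  have h4 : 0 ≤ Real.sin (x + Real.pi / 7) :=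
    Real.sin_nonneg_of_nonneg_of_le_pi (by linarith) (by linarith)
  rw [Real.sin_sub] at h3
  rw [Real.sin_add] at h4
  have h5 : 1 - Real.cos (2 * x) = 2 * Real.sin x ^ 2 := by
    rw [Real.cos_two_mul]; linear_combination (-2) * Real.cos_sq_add_sin_sq x
  have h6 : |Real.cos x| * halfSide ≤ Real.sin x * apothem := by
    rw [halfSide, apothem]
    rcases abs_cases (Real.cos x) with ⟨h, _⟩ | ⟨h, _⟩ <;> rw [h] <;> linarith
  rw [h5, Real.sin_two_mul, abs_mul, abs_mul, abs_of_pos hs, abs_of_pos (by norm_num : (0:ℝ) < 2)]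
  exact ⟨by nlinarith, by positivity⟩

theorem abs_sin_sub_le {j k : Fin 7} (h : j ≠ k) :
    |Real.sin (2 * ((((j : ℕ) : ℤ) - ((k : ℕ) : ℤ) : ℤ) * (Real.pi / 7)))| * halfSide ≤
      apothem * (1 - Real.cos (2 * ((((j : ℕ) : ℤ) - ((k : ℕ) : ℤ) : ℤ) * (Real.pi / 7)))) ∧
    0 < 1 - Real.cos (2 * ((((j : ℕ) : ℤ) - ((k : ℕ) : ℤ) : ℤ) * (Real.pi / 7))) := by
  have hp := Real.pi_pos
  have hne : (j : ℕ) ≠ k := fun e => h (Fin.ext e)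
  have hj := j.2
  have hk := k.2
  set d : ℤ := ((j : ℕ) : ℤ) - ((k : ℕ) : ℤ) with hd
  rcases lt_or_gt_of_ne (show d ≠ 0 by omega) with h0 | h0
  · have h1 : (1 : ℝ) ≤ ((-d : ℤ) : ℝ) := by exact_mod_cast (by omega : (1 : ℤ) ≤ -d)
    have h2 : ((-d : ℤ) : ℝ) ≤ 6 := by exact_mod_cast (by omega : -d ≤ (6 : ℤ))
    have := abs_sin_two_mul_le (x := ((-d : ℤ) : ℝ) * (Real.pi / 7)) (by nlinarith) (by nlinarith)
    have e : 2 * ((d : ℝ) * (Real.pi / 7)) = -(2 * (((-d : ℤ) : ℝ) * (Real.pi / 7))) := by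
      push_cast; ring
    rw [e, Real.sin_neg, Real.cos_neg, abs_neg]
    exact this
  · have h1 : (1 : ℝ) ≤ (d : ℝ) := by exact_mod_cast (by omega : (1 : ℤ) ≤ d)
    have h2 : (d : ℝ) ≤ 6 := by exact_mod_cast (by omega : d ≤ (6 : ℤ))
    exact abs_sin_two_mul_le (x := (d : ℝ) * (Real.pi / 7)) (by nlinarith) (by nlinarith)

theorem normal_dot_le_of_side {k : Fin 7} {z : Plane} (h : normal k ⬝ᵥ z = apothem)
    (hu : |tang k ⬝ᵥ z| ≤ halfSide) (j : Fin 7) : normal j ⬝ᵥ z ≤ apothem := by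
  by_cases hjk : j = k
  · rw [hjk, h]
  rw [normal_dot j k, h]
  obtain ⟨h1, h2⟩ := abs_sin_sub_le hjk
  set S := Real.sin (2 * ((((j : ℕ) : ℤ) - ((k : ℕ) : ℤ) : ℤ) * (Real.pi / 7)))
  have h3 : S * (tang k ⬝ᵥ z) ≤ |S| * |tang k ⬝ᵥ z| := by
    rw [← abs_mul]; exact le_abs_self _
  nlinarith [mul_le_mul_of_nonneg_left hu (abs_nonneg S)]

theorem normal_dot_lt_of_side {k : Fin 7} {z : Plane} (h : normal k ⬝ᵥ z = apothem)
    (hu : |tang k ⬝ᵥ z| < halfSide) {j : Fin 7} (hjk : j ≠ k) : normal j ⬝ᵥ z < apothem := by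
  rw [normal_dot j k, h]
  obtain ⟨h1, h2⟩ := abs_sin_sub_le hjk
  set S := Real.sin (2 * ((((j : ℕ) : ℤ) - ((k : ℕ) : ℤ) : ℤ) * (Real.pi / 7)))
  have h3 : S * (tang k ⬝ᵥ z) ≤ |S| * |tang k ⬝ᵥ z| := by
    rw [← abs_mul]; exact le_abs_self _
  rcases eq_or_ne S 0 with h0 | h0
  · rw [h0]; nlinarith [mul_pos apothem_pos h2]
  · nlinarith [mul_lt_mul_of_pos_left hu (abs_pos.2 h0)]

/-- Any natural number may represent the residue, so that index arithmetic in `Fin 7` becomes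
addition of angles. -/
theorem normal_natCast (n : ℕ) (k : Fin 7) (h : n % 7 = k) :
    normal k = ![Real.cos (2 * Real.pi * n / 7), Real.sin (2 * Real.pi * n / 7)] := by
  have e : 2 * Real.pi * n / 7 = 2 * Real.pi * (k : ℕ) / 7 + (n / 7 : ℕ) * (2 * Real.pi) := by
    have : (n : ℝ) = 7 * (n / 7 : ℕ) + (k : ℕ) := by
      rw [← h]; exact_mod_cast (Nat.div_add_mod n 7).symm
    rw [this]; ring_nf
  rw [e, Real.cos_add_nat_mul_two_pi, Real.sin_add_nat_mul_two_pi]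
  rfl

theorem normal_add_one (k : Fin 7) (z : Plane) : normal (k + 1) ⬝ᵥ z =
    Real.cos (2 * (Real.pi / 7)) * (normal k ⬝ᵥ z)
      + Real.sin (2 * (Real.pi / 7)) * (tang k ⬝ᵥ z) := by
  rw [normal_natCast (k + 1) (k + 1) (by fin_cases k <;> rfl), dot_eq]
  have e : 2 * Real.pi * ((k + 1 : ℕ) : ℝ) / 7 =
      2 * Real.pi * (k : ℕ) / 7 + 2 * (Real.pi / 7) := by push_cast; ring
  rw [e, Real.cos_add, Real.sin_add, tang_dot, dot_eq]
  simp only [normal_zero_apply, normal_one_apply, cons_val_zero, cons_val_one]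
  ring

theorem normal_sub_one (k : Fin 7) (z : Plane) : normal (k - 1) ⬝ᵥ z =
    Real.cos (2 * (Real.pi / 7)) * (normal k ⬝ᵥ z)
      - Real.sin (2 * (Real.pi / 7)) * (tang k ⬝ᵥ z) := by
  rw [normal_natCast (k + 6) (k - 1) (by fin_cases k <;> rfl), dot_eq]
  have e : 2 * Real.pi * ((k + 6 : ℕ) : ℝ) / 7 =
      2 * Real.pi * (k : ℕ) / 7 - 2 * (Real.pi / 7) + 2 * Real.pi := by push_cast; ring
  rw [e, Real.cos_add_two_pi, Real.sin_add_two_pi, Real.cos_sub, Real.sin_sub, tang_dot, dot_eq]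
  simp only [normal_zero_apply, normal_one_apply, cons_val_zero, cons_val_one]
  ring

theorem sin_two_mul_pos : 0 < Real.sin (2 * (Real.pi / 7)) :=
  Real.sin_pos_of_pos_of_lt_pi (by positivity) (by linarith [Real.pi_pos])

theorem apothem_sub : apothem - Real.cos (2 * (Real.pi / 7)) * apothem =
    Real.sin (2 * (Real.pi / 7)) * halfSide := by
  rw [Real.cos_two_mul, Real.sin_two_mul, ← apothem, ← halfSide]
  linear_combination (-2 * apothem) * apothem_sq_add_halfSide_sq

/-- The constraints of the two neighboring sides already cut the supporting line down to the side;
`apothem_sub` identifies the cutting points. -/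
theorem abs_tang_le {k : Fin 7} {z : Plane} (h : normal k ⬝ᵥ z = apothem)
    (hz : ∀ j, normal j ⬝ᵥ z ≤ apothem) : |tang k ⬝ᵥ z| ≤ halfSide := by
  have h1 := hz (k + 1)
  have h2 := hz (k - 1)
  rw [normal_add_one, h] at h1
  rw [normal_sub_one, h] at h2
  have h3 := apothem_sub
  have h4 := sin_two_mul_pos
  rw [abs_le]
  constructor
  · by_contra hc
    nlinarith [mul_lt_mul_of_pos_left (not_le.1 hc) h4]
  · by_contra hc
    nlinarith [mul_lt_mul_of_pos_left (not_le.1 hc) h4]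

theorem add_one_ne (k : Fin 7) : k + 1 ≠ k := by fin_cases k <;> decide

theorem sub_one_ne (k : Fin 7) : k - 1 ≠ k := by fin_cases k <;> decide

theorem abs_tang_lt {k : Fin 7} {z : Plane} (h : normal k ⬝ᵥ z = apothem)
    (hz : ∀ j, j ≠ k → normal j ⬝ᵥ z < apothem) : |tang k ⬝ᵥ z| < halfSide := by
  have h1 := hz (k + 1) (add_one_ne k)
  have h2 := hz (k - 1) (sub_one_ne k)
  rw [normal_add_one, h] at h1
  rw [normal_sub_one, h] at h2
  have h3 := apothem_sub
  have h4 := sin_two_mul_pos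
  rw [abs_lt]
  constructor
  · by_contra hc
    nlinarith [mul_le_mul_of_nonneg_left (not_lt.1 hc) h4.le]
  · by_contra hc
    nlinarith [mul_le_mul_of_nonneg_left (not_lt.1 hc) h4.le]

theorem mem_openSide_iff {k : Fin 7} {z : Plane} :
    z ∈ openSide k ↔ normal k ⬝ᵥ z = apothem ∧ |tang k ⬝ᵥ z| < halfSide :=
  ⟨fun h => ⟨h.1, abs_tang_lt h.1 h.2⟩, fun h => ⟨h.1, fun _ hj => normal_dot_lt_of_side h.1 h.2 hj⟩⟩

/-! ### The heptagons -/

theorem sgn_false : sgn false = 1 := rfl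

theorem sgn_true : sgn true = -1 := rfl

theorem mem_P_false {z : Plane} : z ∈ P false ↔ ∀ k, normal k ⬝ᵥ z ≤ apothem := by
  simp [P, sgn]

theorem mem_openP_false {z : Plane} : z ∈ openP false ↔ ∀ k, normal k ⬝ᵥ z < apothem := by
  simp [openP, sgn]

theorem mem_P_true {z : Plane} : z ∈ P true ↔ -z ∈ P false := by
  simp only [P, mem_ofPred_eq, sgn_true, sgn_false, dotProduct_neg, neg_mul, mul_neg]

theorem mem_openP_true {z : Plane} : z ∈ openP true ↔ -z ∈ openP false := by
  simp only [openP, mem_ofPred_eq, sgn_true, sgn_false, dotProduct_neg, neg_mul, mul_neg]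

theorem mem_P_of_side {k : Fin 7} {z : Plane} (h : normal k ⬝ᵥ z = apothem)
    (hu : |tang k ⬝ᵥ z| ≤ halfSide) : z ∈ P false :=
  mem_P_false.2 (normal_dot_le_of_side h hu)

theorem openP_subset (b : Bool) : openP b ⊆ P b := fun _ h k => (h k).le

theorem openSide_subset (k : Fin 7) : openSide k ⊆ P false := fun _ h =>
  mem_P_of_side (mem_openSide_iff.1 h).1 (mem_openSide_iff.1 h).2.le

theorem isOpen_openP (b : Bool) : IsOpen (openP b) := by
  have : openP b = ⋂ k, {z : Plane | sgn b * (normal k ⬝ᵥ z) < apothem} := by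
    ext z; simp [openP]
  rw [this]
  refine isOpen_iInter_of_finite fun k => isOpen_lt ?_ continuous_const
  simp only [dot_eq]; fun_prop

theorem isClosed_P (b : Bool) : IsClosed (P b) := by
  have : P b = ⋂ k, {z : Plane | sgn b * (normal k ⬝ᵥ z) ≤ apothem} := by
    ext z; simp [P]
  rw [this]
  refine isClosed_iInter fun k => isClosed_le ?_ continuous_const
  simp only [dot_eq]; fun_prop

theorem normal_dot_shift (k : Fin 7) : normal k ⬝ᵥ shift k = 2 * apothem := by
  rw [shift, dotProduct_smul, normal_dot_self]; simp

theorem tang_dot_shift (k : Fin 7) : tang k ⬝ᵥ shift k = 0 := by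
  rw [tang_dot, shift]; simp; ring

theorem normal_dot_shift_sub (k : Fin 7) (z : Plane) :
    normal k ⬝ᵥ (shift k - z) = 2 * apothem - normal k ⬝ᵥ z := by
  rw [dotProduct_sub, normal_dot_shift]

theorem tang_dot_shift_sub (k : Fin 7) (z : Plane) :
    tang k ⬝ᵥ (shift k - z) = -(tang k ⬝ᵥ z) := by
  rw [dotProduct_sub, tang_dot_shift, zero_sub]

theorem shift_sub_mem_openSide {k : Fin 7} {z : Plane} (h : z ∈ openSide k) :
    shift k - z ∈ openSide k := by
  rw [mem_openSide_iff] at *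
  rw [normal_dot_shift_sub, tang_dot_shift_sub, abs_neg, h.1]
  exact ⟨by ring, h.2⟩

theorem shift_sub_mem_P {k : Fin 7} {z : Plane} (h : z ∈ P false)
    (hk : normal k ⬝ᵥ z = apothem) : shift k - z ∈ P false := by
  apply mem_P_of_side (k := k)
  · rw [normal_dot_shift_sub, hk]; ring
  · rw [tang_dot_shift_sub, abs_neg]; exact abs_tang_le hk (mem_P_false.1 h)

theorem sub_shift_mem_P {k : Fin 7} {z : Plane} (h : z ∈ P false)
    (hk : normal k ⬝ᵥ z = apothem) : z - shift k ∈ P true := by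
  rw [mem_P_true, neg_sub]; exact shift_sub_mem_P h hk

/-- The condition that `z` is a vertex of `P b`. -/
def IsVertex (b : Bool) (z : Plane) : Prop :=
  ∃ j k, j ≠ k ∧ sgn b * (normal j ⬝ᵥ z) = apothem ∧ sgn b * (normal k ⬝ᵥ z) = apothem

theorem isVertex_true {z : Plane} : IsVertex true z ↔ IsVertex false (-z) := by
  simp [IsVertex, sgn]

/-- A second active constraint forces the tangential coordinate to be exactly `± halfSide`. The
radius then distinguishes vertices from interior points of sides, and it survives the gluing. -/
theorem sq_norm_of_isVertex_false {z : Plane} (h : z ∈ P false) (hv : IsVertex false z) :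
    z 0 ^ 2 + z 1 ^ 2 = 1 := by
  obtain ⟨j, k, hjk, hj, hk⟩ := hv
  simp only [sgn, Bool.false_eq_true, if_false, one_mul] at hj hk
  have h1 := abs_tang_le hk (mem_P_false.1 h)
  have h2 : ¬ |tang k ⬝ᵥ z| < halfSide := fun hlt => (normal_dot_lt_of_side hk hlt hjk).ne hj
  have h3 : |tang k ⬝ᵥ z| = halfSide := le_antisymm h1 (not_lt.1 h2)
  rw [sq_norm_eq k, hk, ← sq_abs (tang k ⬝ᵥ z), h3, apothem_sq_add_halfSide_sq]

theorem sq_norm_of_isVertex {b : Bool} {z : Plane} (h : z ∈ P b) (hv : IsVertex b z) :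
    z 0 ^ 2 + z 1 ^ 2 = 1 := by
  cases b
  · exact sq_norm_of_isVertex_false h hv
  · simpa using sq_norm_of_isVertex_false (mem_P_true.1 h) (isVertex_true.1 hv)

theorem sq_norm_of_mem_openSide {k : Fin 7} {z : Plane} (h : z ∈ openSide k) :
    z 0 ^ 2 + z 1 ^ 2 < 1 := by
  obtain ⟨h1, h2⟩ := mem_openSide_iff.1 h
  rw [sq_norm_eq k, h1, ← sq_abs (tang k ⬝ᵥ z), ← apothem_sq_add_halfSide_sq]
  have := abs_nonneg (tang k ⬝ᵥ z)
  nlinarith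

theorem cases_of_not_isVertex {z : Plane} (h : z ∈ P false) (hv : ¬ IsVertex false z) :
    z ∈ openP false ∨ ∃ k, z ∈ openSide k := by
  rw [mem_P_false] at h
  by_cases h1 : ∃ k, normal k ⬝ᵥ z = apothem
  · obtain ⟨k, hk⟩ := h1
    refine Or.inr ⟨k, hk, fun j hj => lt_of_le_of_ne (h j) fun e => hv ⟨j, k, hj, ?_, ?_⟩⟩ <;>
      rwa [sgn_false, one_mul]
  · exact Or.inl (mem_openP_false.2 fun k => lt_of_le_of_ne (h k) fun e => h1 ⟨k, e⟩)

/-! ### Points of the surface -/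

/-- The point `p` is represented by the point `z` of `P b`. -/
def IsPt (b : Bool) (z : Plane) (p : Surface) : Prop := ∃ h, p = pt b z h

theorem IsPt.unique {b : Bool} {z : Plane} {p q : Surface} (hp : IsPt b z p) (hq : IsPt b z q) :
    p = q := by
  obtain ⟨_, rfl⟩ := hp
  obtain ⟨_, rfl⟩ := hq
  rfl

theorem exists_isPt (p : Surface) : ∃ b z, IsPt b z p := by
  induction p using Quot.ind with
  | mk x => exact ⟨x.1.1, x.1.2, x.2, rfl⟩

theorem IsPt.glue {k : Fin 7} {z : Plane} {p : Surface} (hp : IsPt false z p)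
    (hk : normal k ⬝ᵥ z = apothem) : IsPt true (z - shift k) p := by
  obtain ⟨h, rfl⟩ := hp
  exact ⟨sub_shift_mem_P h hk, Quot.sound ⟨k, rfl, rfl, hk, rfl⟩⟩

theorem IsPt.unglue {k : Fin 7} {z : Plane} {p : Surface} (hp : IsPt true z p)
    (hk : normal k ⬝ᵥ z = -apothem) : IsPt false (z + shift k) p := by
  obtain ⟨h, rfl⟩ := hp
  have h1 : z + shift k ∈ P false := by
    have := shift_sub_mem_P (k := k) (mem_P_true.1 h) (by rw [dotProduct_neg, hk, neg_neg])
    rwa [sub_neg_eq_add, add_comm] at this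
  refine ⟨h1, (Quot.sound ⟨k, rfl, rfl, ?_, ?_⟩).symm⟩
  · change normal k ⬝ᵥ (z + shift k) = apothem
    rw [dotProduct_add, normal_dot_shift, hk]; ring
  · simp

/-- A predicate that is compatible with the gluing descends to the surface. -/
theorem IsPt.transfer {Q : Bool → Plane → Prop}
    (hQ : ∀ k z, z ∈ P false → normal k ⬝ᵥ z = apothem → (Q false z ↔ Q true (z - shift k)))
    {b b' : Bool} {z z' : Plane} {p : Surface} (h : IsPt b z p) (h' : IsPt b' z' p) :
    Q b z → Q b' z' := by
  obtain ⟨hz, rfl⟩ := h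
  obtain ⟨hz', e⟩ := h'
  have key : ∀ x y : Pieces, Glued x y → Q x.1.1 x.1.2 = Q y.1.1 y.1.2 := by
    rintro ⟨⟨b1, z1⟩, h1⟩ ⟨⟨b2, z2⟩, h2⟩ ⟨k, e1, e2, e3, e4⟩
    simp only at e1 e2 e3 e4
    subst e1 e2 e4
    exact propext (hQ k z1 h1 e3)
  have := congrArg (Quot.lift (fun x : Pieces => Q x.1.1 x.1.2) key) e
  change Q b z = Q b' z' at this
  exact fun hq => this ▸ hq

/-- Gluing only involves boundary points, so being equal to a given interior point is a predicate
compatible with it, and `IsPt.transfer` applies. -/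
theorem IsPt.eq_of_openP {b b' : Bool} {z z' : Plane} {p : Surface} (h : IsPt b z p)
    (h' : IsPt b' z' p) (hz : z ∈ openP b) : b' = b ∧ z' = z := by
  refine IsPt.transfer (Q := fun c w => c = b ∧ w = z) ?_ h h' ⟨rfl, rfl⟩
  intro k w hw hk
  constructor
  · rintro ⟨rfl, rfl⟩
    exact absurd hk (mem_openP_false.1 hz k).ne
  · rintro ⟨rfl, rfl⟩
    have := mem_openP_false.1 (mem_openP_true.1 hz) k
    rw [neg_sub, normal_dot_shift_sub, hk] at this
    linarith

/-- Only one side passes through `z`, and only one through its partner, so the gluing class stops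
after these two points. -/
theorem IsPt.eq_of_openSide {b : Bool} {k : Fin 7} {z z' : Plane} {p : Surface}
    (h : IsPt false z p) (h' : IsPt b z' p) (hz : z ∈ openSide k) :
    (b = false ∧ z' = z) ∨ (b = true ∧ z' = z - shift k) := by
  refine IsPt.transfer (Q := fun c w => (c = false ∧ w = z) ∨ (c = true ∧ w = z - shift k)) ?_ h h'
    (Or.inl ⟨rfl, rfl⟩)
  intro j w hw hj
  have hz' := shift_sub_mem_openSide hz
  constructor
  · rintro (⟨-, rfl⟩ | ⟨h, -⟩)
    · have : j = k := by
        by_contra hjk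
        exact (hz.2 j hjk).ne hj
      subst this
      exact Or.inr ⟨rfl, rfl⟩
    · simp at h
  · rintro (⟨h, -⟩ | ⟨-, hw'⟩)
    · simp at h
    · have h1 : normal j ⬝ᵥ (shift k - z) = apothem := by
        rw [← neg_sub, ← hw', dotProduct_neg, dotProduct_sub, normal_dot_shift, hj]; ring
      have : j = k := by
        by_contra hjk
        exact (hz'.2 j hjk).ne h1
      subst this
      exact Or.inl ⟨rfl, by simpa using hw'⟩

/-- The squared distance to the center of the heptagon is well defined on the surface. -/
theorem IsPt.sq_norm_eq {b b' : Bool} {z z' : Plane} {p : Surface} (h : IsPt b z p)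
    (h' : IsPt b' z' p) : z' 0 ^ 2 + z' 1 ^ 2 = z 0 ^ 2 + z 1 ^ 2 := by
  refine IsPt.transfer (Q := fun _ w => w 0 ^ 2 + w 1 ^ 2 = z 0 ^ 2 + z 1 ^ 2) ?_ h h' rfl
  intro k w hw hk
  have : (w - shift k) 0 ^ 2 + (w - shift k) 1 ^ 2 = w 0 ^ 2 + w 1 ^ 2 := by
    have h1 := normal_dot_shift_sub k w
    have h2 := tang_dot_shift_sub k w
    have h3 := DoubleHeptagon.sq_norm_eq k (shift k - w)
    rw [DoubleHeptagon.sq_norm_eq k w, ← neg_sub (shift k)]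
    simp only [Pi.neg_apply, neg_sq]
    rw [h3, h1, h2, hk]; ring
  rw [this]

theorem mem_singularities_iff {p : Surface} :
    p ∈ singularities ↔ ∃ b z, IsPt b z p ∧ IsVertex b z :=
  ⟨fun ⟨b, z, h, e, hv⟩ => ⟨b, z, ⟨h, e⟩, hv⟩, fun ⟨b, z, ⟨h, e⟩, hv⟩ => ⟨b, z, h, e, hv⟩⟩

theorem IsPt.sq_norm_of_mem {b : Bool} {z : Plane} {p : Surface} (h : IsPt b z p)
    (hp : p ∈ singularities) : z 0 ^ 2 + z 1 ^ 2 = 1 := by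
  obtain ⟨b', z', h', hv⟩ := mem_singularities_iff.1 hp
  rw [h'.sq_norm_eq h]
  exact sq_norm_of_isVertex h'.1 hv

theorem center_notMem (b : Bool) : center b ∉ singularities := by
  intro h
  have := IsPt.sq_norm_of_mem (b := b) (z := 0) ⟨zero_mem b, rfl⟩ h
  norm_num at this

/-! ### Charts -/

/-- The side inequality for `k` decides which heptagon can represent the point; on the common side
the representative in `P false` is chosen. -/
theorem domain_cases {k : Fin 7} {w : Plane} {p : Surface} (h : HasCoord k w p) :
    (w ∈ openP false ∧ IsPt false w p) ∨ (w - shift k ∈ openP true ∧ IsPt true (w - shift k) p) ∨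
      (w ∈ openSide k ∧ IsPt false w p) := by
  obtain ⟨hd, hp⟩ := h
  have key : w - shift k ∈ P true → apothem ≤ normal k ⬝ᵥ w := by
    intro h
    have := mem_P_false.1 (mem_P_true.1 h) k
    rw [neg_sub, normal_dot_shift_sub] at this
    linarith
  rcases hd with hd | hd | hd
  · rcases hp with hp | ⟨h, -⟩
    · exact Or.inl ⟨hd, hp⟩
    · exact absurd (key h) (not_le.2 (mem_openP_false.1 hd k))
  · rcases hp with ⟨h, -⟩ | hp
    · have := mem_openP_false.1 (mem_openP_true.1 hd) k
      rw [neg_sub, normal_dot_shift_sub] at this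
      linarith [mem_P_false.1 h k]
    · exact Or.inr (Or.inl ⟨hd, hp⟩)
  · rcases hp with hp | hp
    · exact Or.inr (Or.inr ⟨hd, hp⟩)
    · refine Or.inr (Or.inr ⟨hd, ?_⟩)
      have := IsPt.unglue (k := k) hp (by
        rw [dotProduct_sub, normal_dot_shift, hd.1]; ring)
      simpa using this

/-- The two heptagons of a chart overlap at most along the common side, where their points are
glued. -/
theorem HasCoord.unique {k : Fin 7} {w : Plane} {p q : Surface} (hp : HasCoord k w p)
    (hq : HasCoord k w q) : p = q := by
  rcases hp.2 with h1 | h1 <;> rcases hq.2 with h2 | h2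
  · exact IsPt.unique h1 h2
  · rcases domain_cases hp with ⟨h, h'⟩ | ⟨h, h'⟩ | ⟨h, h'⟩
    · have := mem_P_false.1 (mem_P_true.1 h2.1) k
      rw [neg_sub, normal_dot_shift_sub] at this
      linarith [mem_openP_false.1 h k]
    · exact IsPt.unique h' h2
    · exact IsPt.unique (h'.glue h.1) h2
  · rcases domain_cases hq with ⟨h, h'⟩ | ⟨h, h'⟩ | ⟨h, h'⟩
    · have := mem_P_false.1 (mem_P_true.1 h1.1) k
      rw [neg_sub, normal_dot_shift_sub] at this
      linarith [mem_openP_false.1 h k]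
    · exact IsPt.unique h1 h'
    · exact IsPt.unique h1 (h'.glue h.1)
  · exact IsPt.unique h1 h2

theorem IsPt.hasCoord_false {z : Plane} {p : Surface} (h : IsPt false z p) (hz : z ∈ openP false)
    (k : Fin 7) : HasCoord k z p :=
  ⟨Or.inl hz, Or.inl h⟩

theorem IsPt.hasCoord_true {z : Plane} {p : Surface} (h : IsPt true z p) (hz : z ∈ openP true)
    (k : Fin 7) : HasCoord k (z + shift k) p :=
  ⟨Or.inr (Or.inl (by simpa using hz)), Or.inr (by rw [add_sub_cancel_right]; exact h)⟩

theorem exists_hasCoord {k : Fin 7} {w : Plane} (h : w ∈ domain k) : ∃ p, HasCoord k w p := by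
  rcases id h with h1 | h1 | h1
  · exact ⟨_, h, Or.inl ⟨openP_subset _ h1, rfl⟩⟩
  · exact ⟨_, h, Or.inr ⟨openP_subset _ h1, rfl⟩⟩
  · exact ⟨_, h, Or.inl ⟨openSide_subset _ h1, rfl⟩⟩

theorem HasCoord.notMem {k : Fin 7} {w : Plane} {p : Surface} (h : HasCoord k w p) :
    p ∉ singularities := by
  intro hp
  rcases domain_cases h with ⟨h1, h2⟩ | ⟨h1, h2⟩ | ⟨h1, h2⟩
  · obtain ⟨b, z, h', j, l, hjl, hj, hl⟩ := mem_singularities_iff.1 hp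
    obtain ⟨rfl, rfl⟩ := h2.eq_of_openP h' h1
    exact (h1 j).ne hj
  · obtain ⟨b, z, h', j, l, hjl, hj, hl⟩ := mem_singularities_iff.1 hp
    obtain ⟨rfl, rfl⟩ := h2.eq_of_openP h' h1
    exact (h1 j).ne hj
  · exact (sq_norm_of_mem_openSide h1).ne (h2.sq_norm_of_mem hp)

theorem cases_of_notMem {p : Surface} (hp : p ∉ singularities) :
    (∃ b z, IsPt b z p ∧ z ∈ openP b) ∨ ∃ k z, IsPt false z p ∧ z ∈ openSide k := by
  obtain ⟨b, z, h⟩ := exists_isPt p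
  have hv : ¬ IsVertex b z := fun hv => hp (mem_singularities_iff.2 ⟨b, z, h, hv⟩)
  cases b
  · rcases cases_of_not_isVertex h.1 hv with h1 | ⟨k, hk⟩
    · exact Or.inl ⟨_, _, h, h1⟩
    · exact Or.inr ⟨_, _, h, hk⟩
  · rcases cases_of_not_isVertex (mem_P_true.1 h.1) (fun h => hv (isVertex_true.2 h)) with
      h1 | ⟨k, hk⟩
    · exact Or.inl ⟨_, _, h, mem_openP_true.2 h1⟩
    · refine Or.inr ⟨k, z + shift k, h.unglue (by
        have := hk.1; rw [dotProduct_neg] at this; linarith), ?_⟩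
      have := shift_sub_mem_openSide hk
      rwa [sub_neg_eq_add, add_comm] at this

theorem exists_hasCoord_of_notMem {p : Surface} (hp : p ∉ singularities) :
    ∃ k w, HasCoord k w p := by
  rcases cases_of_notMem hp with ⟨b, z, h, hz⟩ | ⟨k, z, h, hz⟩
  · cases b
    · exact ⟨0, z, h.hasCoord_false hz 0⟩
    · exact ⟨0, _, h.hasCoord_true hz 0⟩
  · exact ⟨k, z, Or.inr (Or.inr hz), Or.inl h⟩

/-- Near an interior point of the common side the other six constraints of both heptagons persist,
and the sign of the remaining one selects the piece of the domain. -/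
theorem isOpen_domain (k : Fin 7) : IsOpen (domain k) := by
  rw [isOpen_iff_mem_nhds]
  have hcont : ∀ j, Continuous fun z : Plane => normal j ⬝ᵥ z := fun j => by
    simp only [dot_eq]; fun_prop
  intro w hw
  have hsub : Continuous fun z : Plane => z - shift k := by fun_prop
  rcases hw with hw | hw | hw
  · exact mem_of_superset ((isOpen_openP false).mem_nhds hw) fun x hx => Or.inl hx
  · exact mem_of_superset (((isOpen_openP true).preimage hsub).mem_nhds hw)
      fun x hx => Or.inr (Or.inl hx)
  · have hw' := shift_sub_mem_openSide hw
    have e1 : ∀ᶠ x in 𝓝 w, ∀ j, j ≠ k → normal j ⬝ᵥ x < apothem :=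
      eventually_all.2 fun j => by
        by_cases hj : j = k
        · simp [hj]
        · filter_upwards [(hcont j).continuousAt.eventually_lt continuousAt_const (hw.2 j hj)]
            with x hx _ using hx
    have e2 : ∀ᶠ x in 𝓝 w, ∀ j, j ≠ k → normal j ⬝ᵥ (shift k - x) < apothem :=
      eventually_all.2 fun j => by
        by_cases hj : j = k
        · simp [hj]
        · have : Continuous fun x : Plane => normal j ⬝ᵥ (shift k - x) :=
            (hcont j).comp (by fun_prop)
          filter_upwards [this.continuousAt.eventually_lt continuousAt_const (hw'.2 j hj)]
            with x hx _ using hx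
    filter_upwards [e1, e2] with x h1 h2
    rcases lt_trichotomy (normal k ⬝ᵥ x) apothem with h | h | h
    · refine Or.inl (mem_openP_false.2 fun j => ?_)
      by_cases hj : j = k
      · rwa [hj]
      · exact h1 j hj
    · exact Or.inr (Or.inr ⟨h, h1⟩)
    · refine Or.inr (Or.inl (mem_openP_true.2 (mem_openP_false.2 fun j => ?_)))
      rw [neg_sub]
      by_cases hj : j = k
      · rw [hj, normal_dot_shift_sub]; linarith
      · exact h2 j hj

/-- The coordinate changes are translations. -/
theorem HasCoord.transition {k l : Fin 7} {w w' : Plane} {p : Surface} (h : HasCoord k w p)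
    (h' : HasCoord l w' p) :
    ∀ᶠ x in 𝓝 w, ∀ q, HasCoord k x q → HasCoord l (w' + (x - w)) q := by
  rcases domain_cases h with ⟨h1, h2⟩ | ⟨h1, h2⟩ | ⟨h1, h2⟩
  · have e : w' = w := by
      rcases h'.2 with h3 | h3
      · exact (h2.eq_of_openP h3 h1).2
      · exact absurd (h2.eq_of_openP h3 h1).1 (by simp)
    filter_upwards [(isOpen_openP false).mem_nhds h1] with x hx q hq
    rw [e, add_sub_cancel]
    rcases hq.2 with hq' | ⟨hq', -⟩
    · exact IsPt.hasCoord_false hq' hx l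
    · have := mem_P_false.1 (mem_P_true.1 hq') k
      rw [neg_sub, normal_dot_shift_sub] at this
      linarith [mem_openP_false.1 hx k]
  · have e : w' = w - shift k + shift l := by
      rcases h'.2 with h3 | h3
      · exact absurd (h2.eq_of_openP h3 h1).1 (by simp)
      · rw [← (h2.eq_of_openP h3 h1).2, sub_add_cancel]
    have hsub : Continuous fun z : Plane => z - shift k := by fun_prop
    filter_upwards [((isOpen_openP true).preimage hsub).mem_nhds h1] with x hx q hq
    have e2 : w' + (x - w) = x - shift k + shift l := by rw [e]; abel
    rw [e2]
    rcases hq.2 with ⟨hq', -⟩ | hq'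
    · have := mem_openP_false.1 (mem_openP_true.1 hx) k
      rw [neg_sub, normal_dot_shift_sub] at this
      linarith [mem_P_false.1 hq' k]
    · exact IsPt.hasCoord_true hq' hx l
  · have e : l = k ∧ w' = w := by
      rcases domain_cases h' with ⟨h3, h4⟩ | ⟨h3, h4⟩ | ⟨h3, h4⟩
      · obtain ⟨-, e⟩ := h4.eq_of_openP h2 h3
        rw [e] at h1
        exact absurd h1.1 (mem_openP_false.1 h3 k).ne
      · exact absurd (h4.eq_of_openP h2 h3).1 (by simp)
      · rcases h2.eq_of_openSide h4 h1 with ⟨-, e⟩ | ⟨e, -⟩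
        · refine ⟨?_, e⟩
          by_contra hlk
          rw [e] at h3
          exact (h1.2 l hlk).ne h3.1
        · simp at e
    rw [e.1, e.2]
    filter_upwards with x q hq
    rwa [add_sub_cancel]

end

noncomputable section

/-! ### Affine diffeomorphisms -/

theorem tendsto_chart (A : Matrix (Fin 2) (Fin 2) ℝ) (w w' : Plane) :
    Tendsto (fun x : Plane => w' + A *ᵥ (x - w)) (𝓝 w) (𝓝 w') := by
  have : Continuous fun x : Plane => w' + A *ᵥ (x - w) :=
    continuous_const.add (Continuous.matrix_mulVec continuous_const (by fun_prop))
  simpa using this.tendsto w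

theorem tendsto_translation (w w' : Plane) :
    Tendsto (fun x : Plane => w' + (x - w)) (𝓝 w) (𝓝 w') := by
  have : Continuous fun x : Plane => w' + (x - w) := by fun_prop
  simpa using this.tendsto w

/-- `IsAffine` grants only one chart at each regular point; since the coordinate changes are
translations, any source chart serves with the same derivative. -/
theorem IsAffine.exists_chart {f : Surface ≃ₜ Surface} {A : Matrix (Fin 2) (Fin 2) ℝ}
    (hf : IsAffine f A) {k : Fin 7} {w : Plane} {p : Surface} (h : HasCoord k w p) :
    ∃ l w', HasCoord l w' (f p) ∧
      ∀ᶠ x in 𝓝 w, ∀ q, HasCoord k x q → HasCoord l (w' + A *ᵥ (x - w)) (f q) := by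
  obtain ⟨k₀, w₀, l, w', h1, h2, h3⟩ := hf.2 p h.notMem
  refine ⟨l, w', h2, ?_⟩
  filter_upwards [h.transition h1, (tendsto_translation w w₀).eventually h3] with x h4 h5 q hq
  simpa using h5 q (h4 q hq)

theorem IsAffine.map_mem {f : Surface ≃ₜ Surface} {A : Matrix (Fin 2) (Fin 2) ℝ}
    (hf : IsAffine f A) {p : Surface} (hp : p ∈ singularities) : f p ∈ singularities :=
  hf.1 ▸ mem_image_of_mem f hp

theorem IsAffine.trans {f g : Surface ≃ₜ Surface} {A B : Matrix (Fin 2) (Fin 2) ℝ}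
    (hf : IsAffine f A) (hg : IsAffine g B) : IsAffine (f.trans g) (B * A) := by
  refine ⟨?_, fun p hp => ?_⟩
  · rw [show ⇑(f.trans g) = g ∘ f from rfl, image_comp, hf.1, hg.1]
  · obtain ⟨k, w, l, w', h1, h2, h3⟩ := hf.2 p hp
    obtain ⟨m, w'', h4, h5⟩ := hg.exists_chart h2
    refine ⟨k, w, m, w'', h1, h4, ?_⟩
    filter_upwards [h3, (tendsto_chart A w w').eventually h5] with x h6 h7 q hq
    have := h7 _ (h6 q hq)
    rwa [add_sub_cancel_left, mulVec_mulVec] at this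

theorem IsAffine.symm {f : Surface ≃ₜ Surface} {A B : Matrix (Fin 2) (Fin 2) ℝ}
    (hf : IsAffine f A) (hAB : A * B = 1) : IsAffine f.symm B := by
  have hs : f.symm '' singularities = singularities := by
    conv_lhs => rw [← hf.1]
    rw [← image_comp]
    simp
  refine ⟨hs, fun p hp => ?_⟩
  have hq : f.symm p ∉ singularities := by
    intro h
    apply hp
    have := hf.map_mem h
    simpa using this
  obtain ⟨k, w, l, w', h1, h2, h3⟩ := hf.2 _ hq
  rw [Homeomorph.apply_symm_apply] at h2
  refine ⟨l, w', k, w, h2, h1, ?_⟩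
  have ht := tendsto_chart B w' w
  filter_upwards [ht.eventually h3, ht.eventually ((isOpen_domain k).mem_nhds h1.1)]
    with x h4 h5 q hq
  -- The point with the back-transformed coordinate is mapped by `f` to a point with coordinate `x`,
  -- hence to `q`.
  obtain ⟨q', hq'⟩ := exists_hasCoord h5
  have h6 := h4 q' hq'
  rw [add_sub_cancel_left, mulVec_mulVec, hAB, one_mulVec, add_sub_cancel] at h6
  rw [hq.unique h6, Homeomorph.symm_apply_apply]
  exact hq'

theorem mul_mem_veechGroup {A B : Matrix.SpecialLinearGroup (Fin 2) ℝ} (hA : A ∈ veechGroup)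
    (hB : B ∈ veechGroup) : A * B ∈ veechGroup := by
  obtain ⟨f, hf⟩ := hA
  obtain ⟨g, hg⟩ := hB
  exact ⟨g.trans f, hg.trans hf⟩

theorem inv_mem_veechGroup {A : Matrix.SpecialLinearGroup (Fin 2) ℝ} (hA : A ∈ veechGroup) :
    A⁻¹ ∈ veechGroup := by
  obtain ⟨f, hf⟩ := hA
  refine ⟨f.symm, hf.symm ?_⟩
  rw [← Matrix.SpecialLinearGroup.coe_mul, mul_inv_cancel, Matrix.SpecialLinearGroup.coe_one]

/-! ### Images of separatrices -/

theorem StraightAt.map {f : Surface ≃ₜ Surface} {A : Matrix (Fin 2) (Fin 2) ℝ}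
    (hf : IsAffine f A) {γ : ℝ → Surface} {v : Plane} {t : ℝ} (h : StraightAt γ v t) :
    StraightAt (f ∘ γ) (A *ᵥ v) t := by
  obtain ⟨k, w, h⟩ := h
  have h0 : HasCoord k w (γ t) := by simpa using h.self_of_nhds
  obtain ⟨l, w', h1, h2⟩ := hf.exists_chart h0
  refine ⟨l, w', ?_⟩
  have ht : Tendsto (fun s : ℝ => w + (s - t) • v) (𝓝 t) (𝓝 w) := by
    have : Continuous fun s : ℝ => w + (s - t) • v := by fun_prop
    simpa using this.tendsto t
  filter_upwards [h, ht.eventually h2] with s h3 h4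
  have := h4 _ h3
  rwa [add_sub_cancel_left, mulVec_smul] at this

theorem IsSeparatrix.map {f : Surface ≃ₜ Surface} {A : Matrix (Fin 2) (Fin 2) ℝ}
    (hf : IsAffine f A) {γ : ℝ → Surface} {v : Plane} {T : ℝ} (h : IsSeparatrix v T γ)
    (hv : A *ᵥ v ≠ 0) : IsSeparatrix (A *ᵥ v) T (f ∘ γ) :=
  ⟨hv, h.2.1, f.continuous.comp_continuousOn h.2.2.1, hf.map_mem h.2.2.2.1,
    fun t ht => (h.2.2.2.2 t ht).map hf⟩

theorem IsSaddleConnection.map {f : Surface ≃ₜ Surface} {A : Matrix (Fin 2) (Fin 2) ℝ}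
    (hf : IsAffine f A) {γ : ℝ → Surface} {v : Plane} {T : ℝ} (h : IsSaddleConnection v T γ)
    (hv : A *ᵥ v ≠ 0) : IsSaddleConnection (A *ᵥ v) T (f ∘ γ) :=
  ⟨h.1.map hf hv, hf.map_mem h.2⟩

theorem StraightAt.notMem {γ : ℝ → Surface} {v : Plane} {t : ℝ} (h : StraightAt γ v t) :
    γ t ∉ singularities := by
  obtain ⟨k, w, h⟩ := h
  exact h.self_of_nhds.notMem

end

noncomputable section

/-! ### The distance to the singularities -/

/-- The vertices of `P false`. -/
def vertex (j : Fin 7) : Plane :=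
  ![Real.cos ((2 * (j : ℕ) + 1) * (Real.pi / 7)), Real.sin ((2 * (j : ℕ) + 1) * (Real.pi / 7))]

/-- The squared Euclidean norm. -/
def sqNorm (z : Plane) : ℝ := z 0 ^ 2 + z 1 ^ 2

theorem continuous_sqNorm : Continuous sqNorm := by unfold sqNorm; fun_prop

theorem sqNorm_vertex (j : Fin 7) : sqNorm (vertex j) = 1 :=
  Real.cos_sq_add_sin_sq _

/-- The greatest scalar product with a vertex of `P false`. -/
def support (z : Plane) : ℝ :=
  Finset.univ.sup' Finset.univ_nonempty fun j => vertex j ⬝ᵥ z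

theorem continuous_support : Continuous support := by
  refine Continuous.finset_sup'_apply _ fun j _ => ?_
  exact continuous_const.dotProduct continuous_id

theorem exists_support (z : Plane) : ∃ j, support z = vertex j ⬝ᵥ z := by
  obtain ⟨j, -, h⟩ := Finset.exists_mem_eq_sup' Finset.univ_nonempty fun j => vertex j ⬝ᵥ z
  exact ⟨j, h⟩

theorem le_support (z : Plane) (j : Fin 7) : vertex j ⬝ᵥ z ≤ support z :=
  Finset.le_sup' (fun j => vertex j ⬝ᵥ z) (Finset.mem_univ j)

theorem vertex_dot (j k : Fin 7) (z : Plane) : vertex j ⬝ᵥ z =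
    Real.cos ((2 * (j : ℕ) + 1) * (Real.pi / 7) - 2 * Real.pi * (k : ℕ) / 7) * (normal k ⬝ᵥ z)
    + Real.sin ((2 * (j : ℕ) + 1) * (Real.pi / 7) - 2 * Real.pi * (k : ℕ) / 7)
        * (tang k ⬝ᵥ z) := by
  rw [Real.cos_sub, Real.sin_sub, tang_dot, dot_eq, dot_eq]
  simp only [normal_zero_apply, normal_one_apply, vertex, cons_val_zero, cons_val_one]
  have := Real.cos_sq_add_sin_sq (2 * Real.pi * (k : ℕ) / 7)
  set c := Real.cos (2 * Real.pi * (k : ℕ) / 7)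
  set s := Real.sin (2 * Real.pi * (k : ℕ) / 7)
  linear_combination (-(Real.cos ((2 * (j : ℕ) + 1) * (Real.pi / 7))) * z 0
    - (Real.sin ((2 * (j : ℕ) + 1) * (Real.pi / 7))) * z 1) * this

theorem vertex_dot_self (k : Fin 7) (z : Plane) : vertex k ⬝ᵥ z =
    apothem * (normal k ⬝ᵥ z) + halfSide * (tang k ⬝ᵥ z) := by
  rw [vertex_dot k k]
  have : (2 * ((k : ℕ) : ℝ) + 1) * (Real.pi / 7) - 2 * Real.pi * (k : ℕ) / 7 = Real.pi / 7 := by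
    ring
  rw [this]; rfl

theorem vertex_sub_one_dot (k : Fin 7) (z : Plane) : vertex (k - 1) ⬝ᵥ z =
    apothem * (normal k ⬝ᵥ z) - halfSide * (tang k ⬝ᵥ z) := by
  rw [vertex_dot (k - 1) k]
  -- The integer absorbs the wrap-around at `k = 0`, where `k - 1` is 6.
  have : ∃ n : ℤ, (2 * (((k - 1 : Fin 7) : ℕ) : ℝ) + 1) * (Real.pi / 7)
      - 2 * Real.pi * (k : ℕ) / 7 = -(Real.pi / 7) + n * (2 * Real.pi) := by
    by_cases hk : k = 0
    · refine ⟨1, ?_⟩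
      subst hk
      have : (((0 - 1 : Fin 7) : ℕ) : ℝ) = 6 := by norm_num [show ((0 - 1 : Fin 7) : ℕ) = 6 from rfl]
      rw [this]; simp; ring
    · refine ⟨0, ?_⟩
      have : ((k : ℕ) : ℝ) = ((k - 1 : Fin 7) : ℕ) + 1 := by
        have : (k : ℕ) = ((k - 1 : Fin 7) : ℕ) + 1 := by
          fin_cases k <;> first | rfl | exact absurd rfl hk
        exact_mod_cast this
      rw [this]; push_cast; ring
  obtain ⟨n, hn⟩ := this
  rw [hn, Real.cos_add_int_mul_two_pi, Real.sin_add_int_mul_two_pi, Real.cos_neg, Real.sin_neg]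
  rw [apothem, halfSide]; ring

/-- On a side the support function is attained at an end point of the side. -/
theorem support_of_side {k : Fin 7} {z : Plane} (h : normal k ⬝ᵥ z = apothem)
    (hu : |tang k ⬝ᵥ z| ≤ halfSide) :
    support z = apothem ^ 2 + halfSide * |tang k ⬝ᵥ z| := by
  apply le_antisymm
  · obtain ⟨j, hj⟩ := exists_support z
    rw [hj, vertex_dot j k, h]
    set x := (2 * ((j : ℕ) : ℝ) + 1) * (Real.pi / 7) - 2 * Real.pi * (k : ℕ) / 7 with hx
    set u := tang k ⬝ᵥ z
    have h1 : Real.cos x ≤ apothem := by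
      have e : x = 2 * ((((j : ℕ) : ℤ) - ((k : ℕ) : ℤ) : ℤ) * (Real.pi / 7)) + Real.pi / 7 := by
        rw [hx]; push_cast; ring
      by_cases hjk : j = k
      · rw [e, hjk]; simp [apothem]
      · rw [e, Real.cos_add, ← apothem, ← halfSide]
        have h1 := (abs_sin_sub_le hjk).1
        have h2 := mul_le_mul_of_nonneg_right (neg_le_abs (Real.sin
          (2 * ((((j : ℕ) : ℤ) - ((k : ℕ) : ℤ) : ℤ) * (Real.pi / 7))))) halfSide_pos.le
        linarith
    -- Cauchy–Schwarz for two unit vectors.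
    have h2 : Real.cos x * apothem + |Real.sin x| * halfSide ≤ 1 := by
      nlinarith [Real.cos_sq_add_sin_sq x, apothem_sq_add_halfSide_sq,
        sq_nonneg (Real.cos x - apothem), sq_nonneg (|Real.sin x| - halfSide),
        sq_abs (Real.sin x)]
    have h3 : Real.sin x * u ≤ |Real.sin x| * |u| := by
      rw [← abs_mul]; exact le_abs_self _
    have hs := halfSide_pos
    have ha := apothem_pos
    have e := apothem_sq_add_halfSide_sq
    have hu0 := abs_nonneg u
    set U := |u|
    set S := |Real.sin x|
    have e1 := mul_nonneg (mul_nonneg ha.le (sub_nonneg.2 hu)) (sub_nonneg.2 h1)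
    have e2 := mul_le_mul_of_nonneg_left h2 hu0
    -- Both sides are affine in `U`, which runs from 0 to `halfSide`: `h1` settles the left end,
    -- `h2` the right end, and the weights are `halfSide - U` and `U`.
    have h4 : halfSide * (Real.cos x * apothem + S * U) ≤
        halfSide * (apothem ^ 2 + halfSide * U) := by
      have e3 : halfSide * (apothem ^ 2 + halfSide * U)
          = apothem ^ 2 * (halfSide - U) + U := by
        linear_combination U * e
      rw [e3]
      linarith
    have := le_of_mul_le_mul_left h4 hs
    linarith
  · rcases abs_cases (tang k ⬝ᵥ z) with ⟨e, _⟩ | ⟨e, _⟩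
    · have := le_support z k
      rw [vertex_dot_self, h] at this
      rw [e]; linarith
    · have := le_support z (k - 1)
      rw [vertex_sub_one_dot, h] at this
      rw [e]; linarith

/-- The vertices of `P b`. -/
def vertexOf (b : Bool) (j : Fin 7) : Plane := sgn b • vertex j

/-- The squared distance from a point of `P b` to the set of vertices. -/
def vertexDist (b : Bool) (z : Plane) : ℝ := sqNorm z + 1 - 2 * support (sgn b • z)

theorem continuous_vertexDist (b : Bool) : Continuous (vertexDist b) := by
  have h : Continuous fun z => support (sgn b • z) :=
    continuous_support.comp (continuous_const_smul _)
  exact (continuous_sqNorm.add continuous_const).sub (continuous_const.mul h)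

theorem sqNorm_sub_vertexOf (b : Bool) (j : Fin 7) (z : Plane) :
    sqNorm (z - vertexOf b j) = sqNorm z + 1 - 2 * (vertex j ⬝ᵥ (sgn b • z)) := by
  have h := sqNorm_vertex j
  rw [dot_eq]
  simp only [sqNorm, vertexOf, Pi.sub_apply, Pi.smul_apply, smul_eq_mul] at *
  have h2 : sgn b ^ 2 = 1 := by cases b <;> simp [sgn]
  linear_combination h + (vertex j 0 ^ 2 + vertex j 1 ^ 2) * h2

theorem exists_vertexDist (b : Bool) (z : Plane) :
    ∃ j, vertexDist b z = sqNorm (z - vertexOf b j) := by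
  obtain ⟨j, hj⟩ := exists_support (sgn b • z)
  exact ⟨j, by rw [sqNorm_sub_vertexOf, vertexDist, hj]⟩

/-- Up to the sign that turns `P true` into `P false`, the gluing reflects the side in its midpoint.
This preserves the norm and the absolute tangential coordinate, on which alone the support function
depends along a side. -/
theorem vertexDist_glued {k : Fin 7} {z : Plane} (hz : z ∈ P false)
    (h : normal k ⬝ᵥ z = apothem) : vertexDist false z = vertexDist true (z - shift k) := by
  have hu := abs_tang_le h (mem_P_false.1 hz)
  have h1 := normal_dot_shift_sub k z
  have h2 := tang_dot_shift_sub k z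
  have h3 : normal k ⬝ᵥ (shift k - z) = apothem := by rw [h1, h]; ring
  simp only [vertexDist, sgn_false, sgn_true, one_smul, neg_smul, neg_sub]
  rw [support_of_side h hu, support_of_side h3 (by rwa [h2, abs_neg]), h2, abs_neg]
  congr 2
  have e1 := sq_norm_eq k z
  have e2 := sq_norm_eq k (shift k - z)
  rw [h2, h3] at e2
  rw [h] at e1
  have e3 : sqNorm (z - shift k) = (shift k - z) 0 ^ 2 + (shift k - z) 1 ^ 2 := by
    simp only [sqNorm, Pi.sub_apply]; ring
  rw [e3, e2, sqNorm, e1]; ring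

/-- The squared distance to the singularities, for points near to a singularity. -/
def singDist : Surface → ℝ :=
  Quot.lift (fun x => vertexDist x.1.1 x.1.2) (by
    rintro ⟨⟨b1, z1⟩, h1⟩ ⟨⟨b2, z2⟩, h2⟩ ⟨k, e1, e2, e3, e4⟩
    simp only at e1 e2 e3 e4
    subst e1 e2 e4
    exact vertexDist_glued h1 e3)

theorem continuous_singDist : Continuous singDist := by
  refine continuous_quot_lift _ ?_
  have h : Continuous fun x : Bool × Plane => vertexDist x.1 x.2 := by
    rw [continuous_prod_of_discrete_left]
    exact fun b => continuous_vertexDist b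
  exact h.comp continuous_subtype_val

theorem IsPt.singDist_eq {b : Bool} {z : Plane} {p : Surface} (h : IsPt b z p) :
    singDist p = vertexDist b z := by
  obtain ⟨_, rfl⟩ := h
  rfl

theorem sqNorm_eq_zero {z : Plane} : sqNorm z = 0 ↔ z = 0 := by
  constructor
  · intro h
    have h0 : z 0 ^ 2 = 0 := by unfold sqNorm at h; nlinarith [sq_nonneg (z 0), sq_nonneg (z 1)]
    have h1 : z 1 ^ 2 = 0 := by unfold sqNorm at h; nlinarith [sq_nonneg (z 0), sq_nonneg (z 1)]
    ext i
    fin_cases i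
    · simpa using h0
    · simpa using h1
  · rintro rfl
    simp [sqNorm]

theorem sqNorm_nonneg (z : Plane) : 0 ≤ sqNorm z := by unfold sqNorm; positivity

theorem singDist_nonneg (p : Surface) : 0 ≤ singDist p := by
  obtain ⟨b, z, h⟩ := exists_isPt p
  obtain ⟨j, hj⟩ := exists_vertexDist b z
  rw [h.singDist_eq, hj]
  exact sqNorm_nonneg _

theorem singDist_eq_zero {p : Surface} (hp : p ∈ singularities) : singDist p = 0 := by
  apply le_antisymm _ (singDist_nonneg p)
  obtain ⟨b, z, h, j, k, hjk, -, hk⟩ := mem_singularities_iff.1 hp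
  have h1 := h.sq_norm_of_mem hp
  have hz : sgn b • z ∈ P false := by
    cases b
    · simpa [sgn] using h.1
    · simpa [sgn] using mem_P_true.1 h.1
  have hk' : normal k ⬝ᵥ (sgn b • z) = apothem := by rwa [dotProduct_smul]
  have h2 := abs_tang_le hk' (mem_P_false.1 hz)
  have h3 := sq_norm_eq k (sgn b • z)
  have h4 : (sgn b • z) 0 ^ 2 + (sgn b • z) 1 ^ 2 = 1 := by
    rw [← h1]; cases b <;> simp [sgn]
  have h5 : |tang k ⬝ᵥ (sgn b • z)| = halfSide := by
    rw [h4, hk', ← apothem_sq_add_halfSide_sq, ← sq_abs (tang k ⬝ᵥ _)] at h3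
    have := halfSide_pos
    nlinarith [abs_nonneg (tang k ⬝ᵥ (sgn b • z))]
  have h6 := support_of_side hk' h2
  rw [h5] at h6
  rw [h.singDist_eq, vertexDist, h6, sqNorm, h1]
  nlinarith [apothem_sq_add_halfSide_sq]

theorem vertex_isVertex (j : Fin 7) : IsVertex false (vertex j) := by
  have ht : tang j ⬝ᵥ vertex j = halfSide ∧ normal j ⬝ᵥ vertex j = apothem := by
    have e : (2 * ((j : ℕ) : ℝ) + 1) * (Real.pi / 7) =
        2 * Real.pi * (j : ℕ) / 7 + Real.pi / 7 := by ring
    have := Real.cos_sq_add_sin_sq (2 * Real.pi * (j : ℕ) / 7)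
    rw [tang_dot, dot_eq]
    simp only [normal_zero_apply, normal_one_apply, vertex, cons_val_zero, cons_val_one]
    rw [e, Real.cos_add, Real.sin_add, apothem, halfSide]
    constructor
    · linear_combination Real.sin (Real.pi / 7) * this
    · linear_combination Real.cos (Real.pi / 7) * this
  refine ⟨j + 1, j, add_one_ne j, ?_, ?_⟩
  · rw [sgn_false, one_mul, normal_add_one, ht.1, ht.2, ← apothem_sub]; ring
  · rw [sgn_false, one_mul, ht.2]

theorem singDist_pos {p : Surface} (hp : p ∉ singularities) : 0 < singDist p := by
  refine lt_of_le_of_ne (singDist_nonneg p) fun h0 => hp ?_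
  obtain ⟨b, z, h⟩ := exists_isPt p
  obtain ⟨j, hj⟩ := exists_vertexDist b z
  rw [h.singDist_eq, hj] at h0
  have e := sub_eq_zero.1 (sqNorm_eq_zero.1 h0.symm)
  refine mem_singularities_iff.2 ⟨b, z, h, ?_⟩
  have := vertex_isVertex j
  cases b
  · rw [e, vertexOf, sgn_false, one_smul]; exact this
  · rw [e, vertexOf, sgn_true, isVertex_true, neg_smul, one_smul, neg_neg]; exact this

/-! ### A lower bound for the length of saddle connections -/

/-- The vertices in the `k`-th chart. -/
def chartVertices (k : Fin 7) : Set Plane :=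
  range (vertexOf false) ∪ range fun j => vertexOf true j + shift k

theorem finite_chartVertices (k : Fin 7) : (chartVertices k).Finite :=
  (finite_range _).union (finite_range _)

/-- The vertex may depend on the point; `exists_separation` later shows that it is locally constant
close to a singularity. -/
theorem HasCoord.exists_vertex {k : Fin 7} {w : Plane} {p : Surface} (h : HasCoord k w p) :
    ∃ V ∈ chartVertices k, singDist p = sqNorm (w - V) := by
  rcases h.2 with h1 | h1
  · obtain ⟨j, hj⟩ := exists_vertexDist false w
    exact ⟨_, Or.inl ⟨j, rfl⟩, (IsPt.singDist_eq h1).trans hj⟩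
  · obtain ⟨j, hj⟩ := exists_vertexDist true (w - shift k)
    refine ⟨_, Or.inr ⟨j, rfl⟩, (IsPt.singDist_eq h1).trans (hj.trans ?_)⟩
    rw [sub_sub, add_comm]

theorem exists_separation : ∃ δ : ℝ, 0 < δ ∧ ∀ k, ∀ V ∈ chartVertices k, ∀ W ∈ chartVertices k,
    V ≠ W → 4 * δ ≤ sqNorm (V - W) := by
  have h : (⋃ k, (chartVertices k ×ˢ chartVertices k)).Finite :=
    finite_iUnion fun k => (finite_chartVertices k).prod (finite_chartVertices k)
  have h2 := (h.image fun x : Plane × Plane => sqNorm (x.1 - x.2)).subset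
    (inter_subset_left (t := Ioi 0))
  have h3 : ∃ δ : ℝ, 0 < δ ∧ ∀ x ∈ (fun x : Plane × Plane => sqNorm (x.1 - x.2)) ''
      (⋃ k, (chartVertices k ×ˢ chartVertices k)) ∩ Ioi 0, δ ≤ x := by
    rcases eq_empty_or_nonempty ((fun x : Plane × Plane => sqNorm (x.1 - x.2)) ''
      (⋃ k, (chartVertices k ×ˢ chartVertices k)) ∩ Ioi 0) with h4 | h4
    · exact ⟨1, one_pos, by simp [h4]⟩
    · obtain ⟨m, hm, hm'⟩ := exists_min_image _ id h2 h4
      exact ⟨m, hm.2, hm'⟩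
  obtain ⟨δ, hδ, h4⟩ := h3
  refine ⟨δ / 4, by positivity, fun k V hV W hW hVW => ?_⟩
  have h5 : 0 < sqNorm (V - W) := lt_of_le_of_ne (sqNorm_nonneg _) fun e =>
    hVW (sub_eq_zero.1 (sqNorm_eq_zero.1 e.symm))
  have := h4 (sqNorm (V - W)) ⟨⟨(V, W), mem_iUnion.2 ⟨k, hV, hW⟩, rfl⟩, h5⟩
  linarith

/-- The parallelogram identity, with the square of `2x - V - W` dropped. -/
theorem sqNorm_sub_lt {x V W : Plane} {δ : ℝ} (h1 : sqNorm (x - V) < δ)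
    (h2 : sqNorm (x - W) < δ) : sqNorm (V - W) < 4 * δ := by
  simp only [sqNorm, Pi.sub_apply] at *
  nlinarith [sq_nonneg (2 * x 0 - V 0 - W 0), sq_nonneg (2 * x 1 - V 1 - W 1)]

theorem continuousAt_of_straightAt {γ : ℝ → Surface} {v : Plane} {T : ℝ}
    (h : IsSeparatrix v T γ) {t : ℝ} (ht : t ∈ Ioo 0 T) : ContinuousAt γ t :=
  h.2.2.1.continuousAt (Icc_mem_nhds ht.1 ht.2)

/-- Close to the singularities, the squared distance to them is quadratic along a geodesic. -/
theorem singDist_quadratic {δ : ℝ} (hδ : ∀ k, ∀ V ∈ chartVertices k, ∀ W ∈ chartVertices k,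
    V ≠ W → 4 * δ ≤ sqNorm (V - W)) {γ : ℝ → Surface} {v : Plane} {T : ℝ}
    (h : IsSeparatrix v T γ) {t : ℝ} (ht : t ∈ Ioo 0 T) (hlt : singDist (γ t) < δ) :
    ∃ u : Plane, ∀ᶠ s in 𝓝 t, singDist (γ s) = sqNorm (u + (s - t) • v) := by
  obtain ⟨k, w, h1⟩ := h.2.2.2.2 t ht
  obtain ⟨V, hV, h2⟩ := h1.self_of_nhds.exists_vertex
  simp only [sub_self, zero_smul, add_zero] at h2
  refine ⟨w - V, ?_⟩
  have c1 : ContinuousAt (fun s => singDist (γ s)) t :=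
    continuous_singDist.continuousAt.comp (continuousAt_of_straightAt h ht)
  have c2 : Continuous fun s : ℝ => sqNorm (w + (s - t) • v - V) :=
    continuous_sqNorm.comp (by fun_prop)
  have e2 : ∀ᶠ s in 𝓝 t, sqNorm (w + (s - t) • v - V) < δ :=
    c2.continuousAt.eventually_lt continuousAt_const (by simpa [← h2] using hlt)
  filter_upwards [h1, c1.eventually_lt continuousAt_const hlt, e2] with s h3 h4 h5
  obtain ⟨W, hW, h6⟩ := h3.exists_vertex
  -- Both vertices lie within the separation radius of the same point.
  have : V = W := by
    by_contra hVW
    exact absurd (sqNorm_sub_lt h5 (h6 ▸ h4)) (not_lt.2 (hδ k V hV W hW hVW))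
  rw [h6, ← this]
  congr 1
  abel

theorem sqNorm_pos {v : Plane} (hv : v ≠ 0) : 0 < sqNorm v :=
  lt_of_le_of_ne (sqNorm_nonneg _) fun e => hv (sqNorm_eq_zero.1 e.symm)

/-- Strict convexity: the sum of the values at `t + ε / 2` and `t - ε / 2` exceeds twice the value
at `t`. -/
theorem not_isLocalMax_sqNorm {u v : Plane} (hv : v ≠ 0) (t : ℝ) :
    ¬ ∀ᶠ s in 𝓝 t, sqNorm (u + (s - t) • v) ≤ sqNorm u := by
  intro h
  obtain ⟨ε, hε, h⟩ := Metric.eventually_nhds_iff.1 h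
  have h1 := h (y := t + ε / 2) (by
    rw [Real.dist_eq]; simp only [add_sub_cancel_left]; rw [abs_of_pos] <;> linarith)
  have h2 := h (y := t - ε / 2) (by
    rw [Real.dist_eq, show t - ε / 2 - t = -(ε / 2) by ring, abs_neg, abs_of_pos] <;> linarith)
  have h3 := sqNorm_pos hv
  simp only [sqNorm, Pi.add_apply, Pi.smul_apply, smul_eq_mul, add_sub_cancel_left] at h1 h2 h3
  have : 0 < (ε / 2) ^ 2 * (v 0 ^ 2 + v 1 ^ 2) := by positivity
  nlinarith

theorem hasDerivAt_sqNorm (u v : Plane) (t : ℝ) :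
    HasDerivAt (fun s : ℝ => sqNorm (u + (s - t) • v)) (2 * (u 0 * v 0 + u 1 * v 1)) t := by
  have h : ∀ i, HasDerivAt (fun s : ℝ => (u i + (s - t) * v i) ^ 2) (2 * (u i * v i)) t := by
    intro i
    have h1 : HasDerivAt (fun s : ℝ => u i + (s - t) * v i) (v i) t := by
      simpa using (((hasDerivAt_id t).sub_const t).mul_const (v i)).const_add (u i)
    have := h1.pow 2
    refine this.congr_deriv ?_
    push_cast; ring
  have := (h 0).add (h 1)
  exact this.congr_deriv (by ring)

/-- The length of saddle connections is bounded from below. -/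
theorem exists_length_bound : ∃ δ : ℝ, 0 < δ ∧ ∀ v T γ, IsSaddleConnection v T γ →
    δ ≤ T ^ 2 * sqNorm v := by
  obtain ⟨δ, hδ, hsep⟩ := exists_separation
  refine ⟨δ, hδ, fun v T γ ⟨h, hT⟩ => ?_⟩
  obtain ⟨hv, hT0, hcont, h0, hst⟩ := id h
  set g : ℝ → ℝ := fun s => singDist (γ s) with hg
  have hgc : ContinuousOn g (Icc 0 T) := continuous_singDist.comp_continuousOn hcont
  have hg0 : g 0 = 0 := singDist_eq_zero h0
  have hgT : g T = 0 := singDist_eq_zero hT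
  have hpos : ∀ t ∈ Ioo 0 T, 0 < g t := fun t ht => singDist_pos (hst t ht).notMem
  obtain ⟨m, hm, hmax⟩ := isCompact_Icc.exists_isMaxOn (nonempty_Icc.2 hT0.le) hgc
  have hgm : 0 < g m := by
    have : T / 2 ∈ Ioo 0 T := ⟨by positivity, by linarith⟩
    exact (hpos _ this).trans_le (hmax (Ioo_subset_Icc_self this))
  have hm' : m ∈ Ioo 0 T := by
    refine ⟨lt_of_le_of_ne hm.1 fun e => ?_, lt_of_le_of_ne hm.2 fun e => ?_⟩
    · rw [← e, hg0] at hgm; exact hgm.false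
    · rw [e, hgT] at hgm; exact hgm.false
  -- Otherwise `g` is near `m` the squared norm of a moving point, which has no local maximum.
  have hbig : δ ≤ g m := by
    by_contra hlt
    obtain ⟨u, hu⟩ := singDist_quadratic hsep h hm' (not_le.1 hlt)
    have e0 : singDist (γ m) = sqNorm u := by simpa using hu.self_of_nhds
    refine not_isLocalMax_sqNorm (u := u) hv m ?_
    filter_upwards [hu, Icc_mem_nhds hm'.1 hm'.2] with s h1 h2
    rw [← h1, ← e0]
    exact hmax h2
  -- the first time at which the distance reaches the bound
  have hcl : IsCompact (Icc 0 T ∩ g ⁻¹' Ici δ) :=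
    isCompact_Icc.of_isClosed_subset (hgc.preimage_isClosed_of_isClosed isClosed_Icc isClosed_Ici)
      inter_subset_left
  obtain ⟨t, ⟨ht, htδ⟩, hmin⟩ := hcl.exists_isLeast ⟨m, hm, hbig⟩
  have htδ' : δ ≤ g t := htδ
  have ht0 : 0 < t := lt_of_le_of_ne ht.1 fun e => by
    rw [← e, hg0] at htδ'; exact absurd htδ' (not_le.2 hδ)
  have hsub : Icc 0 t ⊆ Icc 0 T := Icc_subset_Icc_right ht.2
  -- Before time `t` the distance `√g` is that of a point moving with velocity `v` to a fixed
  -- vertex; by Cauchy–Schwarz its rate of change is at most the speed.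
  have hder : ∀ s ∈ Ioo 0 t, ∃ d, HasDerivAt (fun x => √(g x)) d s ∧ d ^ 2 ≤ sqNorm v := by
    intro s hs
    have hs' : s ∈ Ioo 0 T := ⟨hs.1, hs.2.trans_le ht.2⟩
    have hlt : g s < δ := by
      by_contra hge
      exact absurd (hmin ⟨Ioo_subset_Icc_self hs', not_lt.1 hge⟩) (not_le.2 hs.2)
    obtain ⟨u, hu⟩ := singDist_quadratic hsep h hs' hlt
    have e0 : g s = sqNorm u := by simpa using hu.self_of_nhds
    have h1 : HasDerivAt g (2 * (u 0 * v 0 + u 1 * v 1)) s :=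
      (hasDerivAt_sqNorm u v s).congr_of_eventuallyEq hu
    have hp := hpos s hs'
    refine ⟨_, h1.sqrt hp.ne', ?_⟩
    rw [div_pow, mul_pow, mul_pow, Real.sq_sqrt hp.le, div_le_iff₀ (by positivity), e0]
    simp only [sqNorm]
    nlinarith [sq_nonneg (u 0 * v 1 - u 1 * v 0)]
  choose! d hd using hder
  -- The mean value theorem, on an interval over which `√g` rises from 0 to at least `√δ`.
  obtain ⟨s, hs, he⟩ := exists_hasDerivAt_eq_slope (fun x => √(g x)) d ht0
    (Real.continuous_sqrt.comp_continuousOn (hgc.mono hsub)) fun s hs => (hd s hs).1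
  simp only [hg0, Real.sqrt_zero, sub_zero] at he
  have h1 := (hd s hs).2
  rw [he, div_pow, Real.sq_sqrt (hδ.le.trans htδ'), div_le_iff₀ (by positivity)] at h1
  have h2 := mul_le_mul_of_nonneg_left (pow_le_pow_left₀ ht0.le ht.2 2) (sqNorm_nonneg v)
  linarith

/-- A direction that is contracted by an element of the Veech group contains
no saddle connection. -/
theorem not_isSaddleConnection {A : Matrix.SpecialLinearGroup (Fin 2) ℝ} (hA : A ∈ veechGroup)
    {v : Plane} {μ : ℝ} (hv : A.1 *ᵥ v = μ • v) (h0 : μ ≠ 0) (h1 : |μ| < 1) (T : ℝ)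
    (γ : ℝ → Surface) : ¬ IsSaddleConnection v T γ := by
  intro h
  obtain ⟨f, hf⟩ := hA
  obtain ⟨δ, hδ, hb⟩ := exists_length_bound
  -- The parameter interval `[0, T]` stays the same and the velocity is multiplied by `μ` each time,
  -- so the length tends to zero.
  have key : ∀ n : ℕ, ∃ γ', IsSaddleConnection (μ ^ n • v) T γ' := by
    intro n
    induction n with
    | zero => exact ⟨γ, by simpa using h⟩
    | succ n ih =>
      obtain ⟨γ', h'⟩ := ih
      have e : A.1 *ᵥ (μ ^ n • v) = μ ^ (n + 1) • v := by
        rw [mulVec_smul, hv, smul_smul, pow_succ]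
      have := h'.map hf (by
        rw [e]; exact smul_ne_zero (pow_ne_zero _ h0) h.1.1)
      rw [e] at this
      exact ⟨_, this⟩
  have hlim : Tendsto (fun n : ℕ => T ^ 2 * sqNorm (μ ^ n • v)) atTop (𝓝 0) := by
    have c : Continuous fun x : ℝ => T ^ 2 * sqNorm (x • v) :=
      continuous_const.mul (continuous_sqNorm.comp (by fun_prop))
    have := (c.tendsto 0).comp (tendsto_pow_atTop_nhds_zero_of_abs_lt_one h1)
    simpa [sqNorm, Function.comp_def] using this
  have := ge_of_tendsto' hlim fun n => (key n).elim fun γ' h' => hb _ _ _ h'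
  exact absurd this (not_le.2 hδ)

end

noncomputable section

/-! ### Symmetries that exchange the heptagons -/

/-- `O` is a symmetry of the double heptagon that exchanges the two heptagons and maps
the `k`-th side to the side opposite to the `e k`-th one. -/
structure IsSwap (O : Matrix (Fin 2) (Fin 2) ℝ) (e : Equiv.Perm (Fin 7)) : Prop where
  normal_dot : ∀ k z, normal (e k) ⬝ᵥ (O *ᵥ z) = -(normal k ⬝ᵥ z)
  map_shift : ∀ k, O *ᵥ shift k = -shift (e k)

namespace IsSwap

variable {O : Matrix (Fin 2) (Fin 2) ℝ} {e : Equiv.Perm (Fin 7)}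

theorem sgn_not (b : Bool) : sgn (!b) = -sgn b := by cases b <;> simp [sgn]

theorem sgn_dot (h : IsSwap O e) (b : Bool) (k : Fin 7) (z : Plane) :
    sgn (!b) * (normal (e k) ⬝ᵥ (O *ᵥ z)) = sgn b * (normal k ⬝ᵥ z) := by
  rw [h.normal_dot, sgn_not, neg_mul_neg]

theorem mem_P (h : IsSwap O e) {b : Bool} {z : Plane} (hz : z ∈ P b) : O *ᵥ z ∈ P (!b) := by
  intro j
  obtain ⟨k, rfl⟩ := e.surjective j
  rw [h.sgn_dot]
  exact hz k

theorem mem_openP (h : IsSwap O e) {b : Bool} {z : Plane} (hz : z ∈ openP b) :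
    O *ᵥ z ∈ openP (!b) := by
  intro j
  obtain ⟨k, rfl⟩ := e.surjective j
  rw [h.sgn_dot]
  exact hz k

/-- The map induced on the surface. -/
def map (h : IsSwap O e) : Surface → Surface :=
  Quot.lift (fun x => pt (!x.1.1) (O *ᵥ x.1.2) (h.mem_P x.2)) (by
    rintro ⟨⟨b1, z1⟩, h1⟩ ⟨⟨b2, z2⟩, h2⟩ ⟨k, e1, e2, e3, e4⟩
    simp only at e1 e2 e3 e4
    subst e1 e2 e4
    refine (Quot.sound ⟨e k, rfl, rfl, ?_, ?_⟩).symm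
    · change normal (e k) ⬝ᵥ (O *ᵥ (z1 - shift k)) = apothem
      rw [h.normal_dot, dotProduct_sub, normal_dot_shift, e3]; ring
    · change O *ᵥ z1 = O *ᵥ (z1 - shift k) - shift (e k)
      rw [mulVec_sub, h.map_shift]; abel)

theorem continuous_map (h : IsSwap O e) : Continuous h.map := by
  refine continuous_quot_lift _ (continuous_quot_mk.comp (Continuous.subtype_mk ?_ _))
  have h1 : Continuous fun x : Pieces => x.1.1 := by fun_prop
  have h2 : Continuous fun x : Pieces => x.1.2 := by fun_prop
  exact ((continuous_of_discreteTopology (f := Bool.not)).comp h1).prodMk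
    (Continuous.matrix_mulVec continuous_const h2)

theorem isPt (h : IsSwap O e) {b : Bool} {z : Plane} {p : Surface} (hp : IsPt b z p) :
    IsPt (!b) (O *ᵥ z) (h.map p) := by
  obtain ⟨hz, rfl⟩ := hp
  exact ⟨h.mem_P hz, rfl⟩

theorem map_map {O' : Matrix (Fin 2) (Fin 2) ℝ} {e' : Equiv.Perm (Fin 7)} (h : IsSwap O e)
    (h' : IsSwap O' e') (hO : O' * O = 1) (p : Surface) : h'.map (h.map p) = p := by
  obtain ⟨b, z, hp⟩ := exists_isPt p
  have := h'.isPt (h.isPt hp)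
  rw [mulVec_mulVec, hO, one_mulVec, Bool.not_not] at this
  exact this.unique hp

/-- The homeomorphism induced on the surface. -/
def homeomorph {O' : Matrix (Fin 2) (Fin 2) ℝ} {e' : Equiv.Perm (Fin 7)} (h : IsSwap O e)
    (h' : IsSwap O' e') (hO : O' * O = 1) (hO' : O * O' = 1) : Surface ≃ₜ Surface where
  toFun := h.map
  invFun := h'.map
  left_inv := h.map_map h' hO
  right_inv := h'.map_map h hO'
  continuous_toFun := h.continuous_map
  continuous_invFun := h'.continuous_map

theorem map_mem (h : IsSwap O e) {p : Surface} (hp : p ∈ singularities) :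
    h.map p ∈ singularities := by
  obtain ⟨b, z, hz, j, k, hjk, hj, hk⟩ := mem_singularities_iff.1 hp
  exact mem_singularities_iff.2 ⟨!b, O *ᵥ z, h.isPt hz, e j, e k, e.injective.ne hjk,
    (h.sgn_dot b j z).trans hj, (h.sgn_dot b k z).trans hk⟩

theorem hasCoord (h : IsSwap O e) {k : Fin 7} {w : Plane} {p : Surface} (hp : HasCoord k w p) :
    HasCoord (e k) (O *ᵥ w + shift (e k)) (h.map p) := by
  have e0 : O *ᵥ w + shift (e k) = O *ᵥ (w - shift k) := by
    rw [mulVec_sub, h.map_shift, sub_neg_eq_add]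
  rcases domain_cases hp with ⟨h1, h2⟩ | ⟨h1, h2⟩ | ⟨h1, h2⟩
  · exact (h.isPt h2).hasCoord_true (h.mem_openP h1) (e k)
  · rw [e0]
    exact (h.isPt h2).hasCoord_false (h.mem_openP h1) (e k)
  · rw [e0]
    have h3 := shift_sub_mem_openSide h1
    refine ⟨Or.inr (Or.inr ⟨?_, ?_⟩), Or.inl (h.isPt (h2.glue h1.1))⟩
    · rw [h.normal_dot, ← dotProduct_neg, neg_sub]; exact h3.1
    · intro j hj
      obtain ⟨l, rfl⟩ := e.surjective j
      rw [h.normal_dot, ← dotProduct_neg, neg_sub]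
      exact h3.2 l fun hl => hj (hl ▸ rfl)

theorem isAffine {O' : Matrix (Fin 2) (Fin 2) ℝ} {e' : Equiv.Perm (Fin 7)} (h : IsSwap O e)
    (h' : IsSwap O' e') (hO : O' * O = 1) (hO' : O * O' = 1) :
    IsAffine (h.homeomorph h' hO hO') O := by
  refine ⟨Subset.antisymm ?_ ?_, fun p hp => ?_⟩
  · rintro _ ⟨p, hp, rfl⟩
    exact h.map_mem hp
  · intro p hp
    exact ⟨h'.map p, h'.map_mem hp, h'.map_map h hO' p⟩
  · obtain ⟨k, w, hw⟩ := exists_hasCoord_of_notMem hp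
    refine ⟨k, w, e k, _, hw, h.hasCoord hw, ?_⟩
    filter_upwards with x q hq
    have := h.hasCoord hq
    have e1 : O *ᵥ w + shift (e k) + O *ᵥ (x - w) = O *ᵥ x + shift (e k) := by
      rw [mulVec_sub]; abel
    rw [e1]
    exact this

end IsSwap

/-! ### The rotation by π/7 and the half turn -/

/-- The rotation by `π / 7`. -/
def rotation : Matrix.SpecialLinearGroup (Fin 2) ℝ :=
  ⟨!![apothem, -halfSide; halfSide, apothem], by
    rw [det_fin_two_of, ← apothem_sq_add_halfSide_sq]; ring⟩

theorem mulVec_eq (A : Matrix (Fin 2) (Fin 2) ℝ) (z : Plane) :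
    A *ᵥ z = ![A 0 0 * z 0 + A 0 1 * z 1, A 1 0 * z 0 + A 1 1 * z 1] := by
  ext i
  fin_cases i <;> exact dot_eq _ z

theorem rotation_mulVec (z : Plane) :
    rotation.1 *ᵥ z = ![apothem * z 0 - halfSide * z 1, halfSide * z 0 + apothem * z 1] := by
  rw [mulVec_eq, sub_eq_add_neg, ← neg_mul]
  rfl

theorem rotation_inv_mulVec (z : Plane) :
    rotation⁻¹.1 *ᵥ z = ![apothem * z 0 + halfSide * z 1, -halfSide * z 0 + apothem * z 1] := by
  have h : rotation⁻¹.1 = !![apothem, halfSide; -halfSide, apothem] := by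
    rw [Matrix.SpecialLinearGroup.coe_inv, rotation, adjugate_fin_two_of, neg_neg]
  rw [h, mulVec_eq]
  rfl

/-- In units of `π / 7`, the normal of index `k + 4` has angle `2k + 8 = (2k + 1) + 7`: the rotated
normal, reversed. -/
theorem normal_add_four (k : Fin 7) : normal (k + 4) 0 = -(rotation.1 *ᵥ normal k) 0 ∧
    normal (k + 4) 1 = -(rotation.1 *ᵥ normal k) 1 := by
  rw [normal_natCast (k + 4) (k + 4) (by fin_cases k <;> rfl), rotation_mulVec]
  have e : 2 * Real.pi * ((k + 4 : ℕ) : ℝ) / 7 =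
      2 * Real.pi * (k : ℕ) / 7 + Real.pi / 7 + Real.pi := by push_cast; ring
  rw [e, Real.cos_add_pi, Real.sin_add_pi, Real.cos_add, Real.sin_add]
  simp only [normal_zero_apply, normal_one_apply, cons_val_zero, cons_val_one, apothem, halfSide]
  constructor <;> ring

theorem normal_eq (k : Fin 7) :
    normal k 0 = -(rotation⁻¹.1 *ᵥ normal (k + 4)) 0 ∧
      normal k 1 = -(rotation⁻¹.1 *ᵥ normal (k + 4)) 1 := by
  obtain ⟨h1, h2⟩ := normal_add_four k
  rw [rotation_mulVec] at h1 h2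
  have := apothem_sq_add_halfSide_sq
  rw [rotation_inv_mulVec, h1, h2]
  simp only [cons_val_zero, cons_val_one]
  constructor
  · linear_combination (-normal k 0) * this
  · linear_combination (-normal k 1) * this

theorem isSwap_rotation : IsSwap rotation.1 (Equiv.addRight 4) where
  normal_dot k z := by
    obtain ⟨h1, h2⟩ := normal_add_four k
    rw [rotation_mulVec] at h1 h2
    rw [Equiv.coe_addRight, dot_eq, h1, h2, rotation_mulVec, dot_eq]
    simp only [cons_val_zero, cons_val_one]
    linear_combination (-(normal k 0 * z 0 + normal k 1 * z 1)) * apothem_sq_add_halfSide_sq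
  map_shift k := by
    obtain ⟨h1, h2⟩ := normal_add_four k
    rw [shift, mulVec_smul, Equiv.coe_addRight, shift, ← smul_neg]
    congr 1
    ext i
    fin_cases i
    · simp only [Fin.zero_eta, Pi.neg_apply, h1, neg_neg]
    · simp only [Fin.mk_one, Pi.neg_apply, h2, neg_neg]

theorem isSwap_rotation_inv : IsSwap rotation⁻¹.1 (Equiv.addRight 3) where
  normal_dot k z := by
    obtain ⟨h1, h2⟩ := normal_add_four (k + 3)
    rw [add_assoc, show (3 : Fin 7) + 4 = 0 from rfl, add_zero, rotation_mulVec] at h1 h2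
    rw [Equiv.coe_addRight, dot_eq, rotation_inv_mulVec, dot_eq, h1, h2]
    simp only [cons_val_zero, cons_val_one]
    ring
  map_shift k := by
    obtain ⟨h1, h2⟩ := normal_eq (k + 3)
    rw [add_assoc, show (3 : Fin 7) + 4 = 0 from rfl, add_zero] at h1 h2
    rw [shift, mulVec_smul, Equiv.coe_addRight, shift, ← smul_neg]
    congr 1
    ext i
    fin_cases i
    · simp only [Fin.zero_eta, Pi.neg_apply, h1, neg_neg]
    · simp only [Fin.mk_one, Pi.neg_apply, h2, neg_neg]

theorem rotation_inv_mul : rotation⁻¹.1 * rotation.1 = 1 := by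
  rw [← Matrix.SpecialLinearGroup.coe_mul, inv_mul_cancel, Matrix.SpecialLinearGroup.coe_one]

theorem rotation_mul_inv : rotation.1 * rotation⁻¹.1 = 1 := by
  rw [← Matrix.SpecialLinearGroup.coe_mul, mul_inv_cancel, Matrix.SpecialLinearGroup.coe_one]

/-- The affine diffeomorphism with derivative `rotation`. -/
def rotationHomeomorph : Surface ≃ₜ Surface :=
  isSwap_rotation.homeomorph isSwap_rotation_inv rotation_inv_mul rotation_mul_inv

theorem isAffine_rotation : IsAffine rotationHomeomorph rotation.1 :=
  isSwap_rotation.isAffine isSwap_rotation_inv rotation_inv_mul rotation_mul_inv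

theorem rotation_mem_veechGroup : rotation ∈ veechGroup := ⟨_, isAffine_rotation⟩

/-- The rotation by `π`. -/
theorem isSwap_neg_one : IsSwap (-1) (Equiv.refl _) where
  normal_dot k z := by simp only [Equiv.refl_apply, neg_mulVec, one_mulVec, dotProduct_neg]
  map_shift k := by simp only [Equiv.refl_apply, neg_mulVec, one_mulVec]

/-- The affine diffeomorphism with derivative `-1`. -/
def halfTurn : Surface ≃ₜ Surface :=
  isSwap_neg_one.homeomorph isSwap_neg_one (by simp) (by simp)

theorem isAffine_halfTurn : IsAffine halfTurn (-1) := isSwap_neg_one.isAffine _ _ _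

theorem halfTurn_center (b : Bool) : halfTurn (center b) = center (!b) := by
  have h : IsPt b 0 (center b) := ⟨zero_mem b, rfl⟩
  have h2 := isSwap_neg_one.isPt h
  rw [mulVec_zero] at h2
  exact h2.unique ⟨zero_mem _, rfl⟩

end

noncomputable section

/-! ### Vertical strips -/

theorem normal_neg (k : Fin 7) : normal (-k) 0 = normal k 0 ∧ normal (-k) 1 = -normal k 1 := by
  rw [normal_natCast (6 * k) (-k) (by fin_cases k <;> rfl)]
  have e : 2 * Real.pi * ((6 * k : ℕ) : ℝ) / 7 =
      ((k : ℕ) : ℝ) * (2 * Real.pi) - 2 * Real.pi * (k : ℕ) / 7 := by push_cast; ring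
  simp only [cons_val_zero, cons_val_one, e, normal_zero_apply, normal_one_apply]
  rw [Real.cos_nat_mul_two_pi_sub, Real.sin_nat_mul_two_pi_sub]
  exact ⟨rfl, rfl⟩

/-- The abscissas of the points of the `k`-th side. -/
def strip (k : Fin 7) : Set ℝ := {x | |x - apothem * normal k 0| ≤ halfSide * normal k 1}

/-- The abscissas of the interior points of the `k`-th side. -/
def openStrip (k : Fin 7) : Set ℝ := {x | |x - apothem * normal k 0| < halfSide * normal k 1}

theorem isClosed_strip (k : Fin 7) : IsClosed (strip k) :=
  isClosed_le (by fun_prop) continuous_const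

theorem isOpen_openStrip (k : Fin 7) : IsOpen (openStrip k) :=
  isOpen_lt (by fun_prop) continuous_const

theorem openStrip_subset (k : Fin 7) : openStrip k ⊆ strip k := fun _ h =>
  (mem_ofPred_eq ▸ h : |_ - _| < _).le

theorem shift_zero (k : Fin 7) : shift k 0 = 2 * apothem * normal k 0 := rfl

theorem shift_one (k : Fin 7) : shift k 1 = 2 * apothem * normal k 1 := rfl

/-- `apothem * normal k 0`, the center of the strip, is half of `shift k 0`. This central symmetry
lets statements about `P false` serve for `P true`. -/
theorem shift_sub_mem_strip {k : Fin 7} {x : ℝ} : shift k 0 - x ∈ strip k ↔ x ∈ strip k := by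
  rw [strip, mem_ofPred_eq, mem_ofPred_eq, shift_zero, ← abs_neg]
  ring_nf

theorem shift_sub_mem_openStrip {k : Fin 7} {x : ℝ} :
    shift k 0 - x ∈ openStrip k ↔ x ∈ openStrip k := by
  rw [openStrip, mem_ofPred_eq, mem_ofPred_eq, shift_zero, ← abs_neg]
  ring_nf

theorem tang_mul_normal {k : Fin 7} {z : Plane} (h : normal k ⬝ᵥ z = apothem) :
    (tang k ⬝ᵥ z) * normal k 1 = apothem * normal k 0 - z 0 := by
  rw [dot_eq] at h
  rw [tang_dot]
  linear_combination normal k 0 * h - z 0 * normal_sq k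

theorem abs_tang_mul_normal {k : Fin 7} {z : Plane} (h : normal k ⬝ᵥ z = apothem) :
    |tang k ⬝ᵥ z| * |normal k 1| = |z 0 - apothem * normal k 0| := by
  rw [← abs_mul, tang_mul_normal h, abs_sub_comm]

variable {k : Fin 7}

theorem top_mem_P (hk : 0 < normal k 1) {z : Plane} (h : normal k ⬝ᵥ z = apothem)
    (hz : z 0 ∈ strip k) : z ∈ P false := by
  refine mem_P_of_side h ?_
  have := abs_tang_mul_normal h
  rw [abs_of_pos hk] at this
  exact le_of_mul_le_mul_right (this.trans_le hz) hk

theorem bottom_mem_P (hk : 0 < normal k 1) {z : Plane} (h : normal (-k) ⬝ᵥ z = apothem)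
    (hz : z 0 ∈ strip k) : z ∈ P false := by
  refine mem_P_of_side h ?_
  have := abs_tang_mul_normal h
  rw [(normal_neg k).1, (normal_neg k).2, abs_neg, abs_of_pos hk] at this
  exact le_of_mul_le_mul_right (this.trans_le hz) hk

theorem top_mem_openSide (hk : 0 < normal k 1) {z : Plane} (h : normal k ⬝ᵥ z = apothem)
    (hz : z 0 ∈ openStrip k) : z ∈ openSide k := by
  refine mem_openSide_iff.2 ⟨h, ?_⟩
  have := abs_tang_mul_normal h
  rw [abs_of_pos hk] at this
  exact lt_of_mul_lt_mul_right (this.trans_lt hz) hk.le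

theorem bottom_mem_openSide (hk : 0 < normal k 1) {z : Plane} (h : normal (-k) ⬝ᵥ z = apothem)
    (hz : z 0 ∈ openStrip k) : z ∈ openSide (-k) := by
  refine mem_openSide_iff.2 ⟨h, ?_⟩
  have := abs_tang_mul_normal h
  rw [(normal_neg k).1, (normal_neg k).2, abs_neg, abs_of_pos hk] at this
  exact lt_of_mul_lt_mul_right (this.trans_lt hz) hk.le

/-- The ordinate of the point of the `k`-th side with a given abscissa, multiplied
by `normal k 1`. -/
def height (k : Fin 7) (x : ℝ) : ℝ := apothem - normal k 0 * x

theorem top_dot (hk : 0 < normal k 1) (x : ℝ) :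
    normal k ⬝ᵥ ![x, height k x / normal k 1] = apothem := by
  rw [dot_eq]
  simp only [cons_val_zero, cons_val_one, height]
  field_simp
  ring

theorem bottom_dot (hk : 0 < normal k 1) (x : ℝ) :
    normal (-k) ⬝ᵥ ![x, -(height k x / normal k 1)] = apothem := by
  rw [dot_eq, (normal_neg k).1, (normal_neg k).2]
  simp only [cons_val_zero, cons_val_one, height]
  field_simp
  ring

theorem height_nonneg (hk : 0 < normal k 1) {x : ℝ} (hx : x ∈ strip k) : 0 ≤ height k x := by
  have h := mem_P_false.1 (top_mem_P hk (top_dot hk x) hx) (-k)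
  rw [dot_eq, (normal_neg k).1, (normal_neg k).2] at h
  simp only [cons_val_zero, cons_val_one] at h
  rw [neg_mul, mul_div_cancel₀ _ hk.ne'] at h
  unfold height at *
  linarith

/-- Over a given abscissa of the strip, the half-chords of the two heptagons add up to `shift k 1`;
thus the circumference of the cylinder is `2 * shift k 1`. -/
theorem height_shift_sub (k : Fin 7) (x : ℝ) :
    height k (shift k 0 - x) = shift k 1 * normal k 1 - height k x := by
  rw [height, height, shift_zero, shift_one]
  linear_combination (-2 * apothem) * normal_sq k

theorem abs_le_of_mem_P {z : Plane} (h : z ∈ P false) : |z 1| * normal k 1 ≤ height k (z 0) := by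
  have h1 := mem_P_false.1 h k
  have h2 := mem_P_false.1 h (-k)
  rw [dot_eq] at h1
  rw [dot_eq, (normal_neg k).1, (normal_neg k).2] at h2
  unfold height
  rcases abs_cases (z 1) with ⟨e, _⟩ | ⟨e, _⟩ <;> rw [e] <;> linarith

/-- Over the strip of `k` the vertical chord ends on the sides `k` and `-k`; every other constraint
is affine along the chord and holds at both ends. -/
theorem mem_P_of_abs_le (hk : 0 < normal k 1) {z : Plane} (hz : z 0 ∈ strip k)
    (h : |z 1| * normal k 1 ≤ height k (z 0)) : z ∈ P false := by
  rw [← le_div_iff₀ hk, abs_le] at h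
  refine mem_P_false.2 fun j => ?_
  have h1 := mem_P_false.1 (top_mem_P hk (top_dot hk (z 0)) hz) j
  have h2 := mem_P_false.1 (bottom_mem_P hk (bottom_dot hk (z 0)) hz) j
  rw [dot_eq] at *
  simp only [cons_val_zero, cons_val_one] at h1 h2
  rcases le_total 0 (normal j 1) with hj | hj <;> nlinarith

/-- The points of a heptagon with abscissas in an open strip. -/
theorem mem_P_cases (hk : 0 < normal k 1) {z : Plane} (h : z ∈ P false)
    (hz : z 0 ∈ openStrip k) : z ∈ openP false ∨ z ∈ openSide k ∨ z ∈ openSide (-k) := by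
  by_cases e1 : normal k ⬝ᵥ z = apothem
  · exact Or.inr (Or.inl (top_mem_openSide hk e1 hz))
  by_cases e2 : normal (-k) ⬝ᵥ z = apothem
  · exact Or.inr (Or.inr (bottom_mem_openSide hk e2 hz))
  refine Or.inl (mem_openP_false.2 fun j => ?_)
  by_cases h1 : j = k
  · rw [h1]; exact lt_of_le_of_ne (mem_P_false.1 h k) e1
  by_cases h2 : j = -k
  · rw [h2]; exact lt_of_le_of_ne (mem_P_false.1 h (-k)) e2
  have h3 := abs_le_of_mem_P (k := k) h
  rw [← le_div_iff₀ hk, abs_le] at h3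
  have h4 := (top_mem_openSide hk (top_dot hk (z 0)) hz).2 j h1
  have h5 := (bottom_mem_openSide hk (bottom_dot hk (z 0)) hz).2 j h2
  rw [dot_eq] at *
  simp only [cons_val_zero, cons_val_one] at h4 h5
  rcases le_total 0 (normal j 1) with hj | hj <;> nlinarith

theorem notMem_openStrip (hk : 0 < normal k 1) {b : Bool} {z : Plane} (h : z ∈ P b)
    (hv : IsVertex b z) : sgn b * z 0 ∉ openStrip k := by
  have key : ∀ z : Plane, z ∈ P false → IsVertex false z → z 0 ∉ openStrip k := by
    intro z h hv hz
    have h1 := sq_norm_of_isVertex h hv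
    rcases mem_P_cases hk h hz with h2 | h2 | h2
    · obtain ⟨j, l, -, hj, -⟩ := hv
      exact (h2 j).ne hj
    · exact (sq_norm_of_mem_openSide h2).ne h1
    · exact (sq_norm_of_mem_openSide h2).ne h1
  cases b
  · rw [sgn_false, one_mul]; exact key z h hv
  · rw [sgn_true, neg_one_mul]; exact key (-z) (mem_P_true.1 h) (isVertex_true.1 hv)

/-! ### Decomposition of the range of abscissas into three strips -/

theorem mem_strip_iff {k : Fin 7} {x : ℝ} : x ∈ strip k ↔
    Real.cos ((2 * (k : ℕ) + 1) * (Real.pi / 7)) ≤ x ∧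
      x ≤ Real.cos ((2 * (k : ℕ) - 1) * (Real.pi / 7)) := by
  have e1 : (2 * ((k : ℕ) : ℝ) + 1) * (Real.pi / 7) =
    2 * Real.pi * (k : ℕ) / 7 + Real.pi / 7 := by ring
  have e2 : (2 * ((k : ℕ) : ℝ) - 1) * (Real.pi / 7) =
    2 * Real.pi * (k : ℕ) / 7 - Real.pi / 7 := by ring
  rw [e1, e2, Real.cos_add, Real.cos_sub, strip, mem_ofPred_eq, abs_le, normal_zero_apply,
    normal_one_apply, apothem, halfSide]
  constructor <;> rintro ⟨h1, h2⟩ <;> constructor <;> linarith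

theorem mem_openStrip_iff {k : Fin 7} {x : ℝ} : x ∈ openStrip k ↔
    Real.cos ((2 * (k : ℕ) + 1) * (Real.pi / 7)) < x ∧
      x < Real.cos ((2 * (k : ℕ) - 1) * (Real.pi / 7)) := by
  have e1 : (2 * ((k : ℕ) : ℝ) + 1) * (Real.pi / 7) =
    2 * Real.pi * (k : ℕ) / 7 + Real.pi / 7 := by ring
  have e2 : (2 * ((k : ℕ) : ℝ) - 1) * (Real.pi / 7) =
    2 * Real.pi * (k : ℕ) / 7 - Real.pi / 7 := by ring
  rw [e1, e2, Real.cos_add, Real.cos_sub, openStrip, mem_ofPred_eq, abs_lt, normal_zero_apply,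
    normal_one_apply, apothem, halfSide]
  constructor <;> rintro ⟨h1, h2⟩ <;> constructor <;> linarith

/-- The indices of the upper sides of `P false`. -/
def upper : Finset (Fin 7) := {1, 2, 3}

theorem mem_upper : k ∈ upper ↔ k = 1 ∨ k = 2 ∨ k = 3 := by simp [upper]

theorem normal_one_pos (h : k ∈ upper) : 0 < normal k 1 := by
  have hp := Real.pi_pos
  rw [normal_one_apply]
  rcases mem_upper.1 h with rfl | rfl | rfl <;>
    exact Real.sin_pos_of_pos_of_lt_pi (by norm_num; positivity) (by norm_num; linarith)

theorem cos_three_le : Real.cos (3 * (Real.pi / 7)) ≤ Real.cos (1 * (Real.pi / 7)) :=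
  Real.cos_le_cos_of_nonneg_of_le_pi (by positivity) (by linarith [Real.pi_pos])
    (by linarith [Real.pi_pos])

theorem cos_five_lt : Real.cos (5 * (Real.pi / 7)) < Real.cos (3 * (Real.pi / 7)) :=
  Real.cos_lt_cos_of_nonneg_of_le_pi (by positivity) (by linarith [Real.pi_pos])
    (by linarith [Real.pi_pos])

theorem mem_Icc_of_mem_P {z : Plane} (h : z ∈ P false) : z 0 ∈ Icc (-1) apothem := by
  rw [mem_P_false] at h
  have h0 := h 0
  have h3 := h 3
  have h4 := h (-3)
  rw [dot_eq] at h0 h3 h4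
  rw [(normal_neg 3).1, (normal_neg 3).2] at h4
  have e0 : normal 0 0 = 1 := by simp [normal]
  have e1 : normal 0 1 = 0 := by simp [normal]
  have e3 : normal 3 0 = -apothem := by
    rw [apothem, ← Real.cos_pi_sub, normal_zero_apply]
    congr 1
    norm_num
    ring
  rw [e0, e1] at h0
  have := apothem_pos
  constructor
  · rw [e3] at h3 h4; nlinarith
  · linarith

theorem exists_strip {z : Plane} (h : z ∈ P false) : ∃ k ∈ upper, z 0 ∈ strip k := by
  obtain ⟨h1, h2⟩ := mem_Icc_of_mem_P h
  rcases le_total (Real.cos (3 * (Real.pi / 7))) (z 0) with h3 | h3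
  · refine ⟨1, by simp [upper], mem_strip_iff.2 ⟨?_, ?_⟩⟩
    · norm_num; exact h3
    · norm_num; exact h2
  rcases le_total (Real.cos (5 * (Real.pi / 7))) (z 0) with h4 | h4
  · refine ⟨2, by simp [upper], mem_strip_iff.2 ⟨?_, ?_⟩⟩
    · norm_num; exact h4
    · norm_num; exact h3
  · refine ⟨3, by simp [upper], mem_strip_iff.2 ⟨?_, ?_⟩⟩
    · norm_num
      rw [show 7 * (Real.pi / 7) = Real.pi by ring, Real.cos_pi]; exact h1
    · norm_num; exact h4

theorem exists_strip_sgn {b : Bool} {z : Plane} (h : z ∈ P b) :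
    ∃ k ∈ upper, sgn b * z 0 ∈ strip k := by
  cases b
  · rw [sgn_false, one_mul]; exact exists_strip h
  · rw [sgn_true, neg_one_mul]; exact exists_strip (mem_P_true.1 h)

/-- The ends of the three strips are the cosines of `π / 7`, `3π / 7`, `5π / 7` and `π`, in
decreasing order, so different strips share at most an end. -/
theorem notMem_openStrip_of_ne {j k : Fin 7} (hj : j ∈ upper) (hk : k ∈ upper) (hjk : j ≠ k)
    {x : ℝ} (h : x ∈ strip j) : x ∉ openStrip k := by
  rw [mem_openStrip_iff]
  rw [mem_strip_iff] at h
  rintro ⟨h1, h2⟩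
  obtain ⟨h3, h4⟩ := h
  have c1 := cos_three_le
  have c2 := cos_five_lt
  rcases mem_upper.1 hj with rfl | rfl | rfl <;> rcases mem_upper.1 hk with rfl | rfl | rfl <;>
    first
    | exact absurd rfl hjk
    | norm_num at h1 h2 h3 h4 c1
      linarith

end

noncomputable section

variable {k : Fin 7}

/-! ### Vertical cylinders -/

/-- The vertical vectors. -/
def vert (t : ℝ) : Plane := ![0, t]

@[simp] theorem vert_zero_apply (t : ℝ) : vert t 0 = 0 := rfl

@[simp] theorem vert_one_apply (t : ℝ) : vert t 1 = t := rfl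

theorem vert_add (s t : ℝ) : vert (s + t) = vert s + vert t := by
  ext i; fin_cases i <;> simp [vert]

theorem vert_zero : vert 0 = 0 := by
  ext i; fin_cases i <;> simp [vert]

theorem continuous_vert : Continuous vert := by unfold vert; fun_prop

/-- Half the circumference of the `k`-th vertical cylinder is `shift k 1`. -/
theorem shift_neg (k : Fin 7) : shift (-k) = shift k - vert (2 * shift k 1) := by
  ext i
  fin_cases i
  · simp [shift, normal_neg]
  · simp [shift, normal_neg]; ring

/-- The position of `P b` with respect to the `k`-th strip. -/
def base (k : Fin 7) (b : Bool) : Plane := if b then shift k else 0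

theorem base_false : base k false = 0 := rfl

theorem base_true : base k true = shift k := rfl

/-- The positions of the translates of `P b` which unroll the `k`-th cylinder. -/
def tilePos (k : Fin 7) (n : ℤ) (b : Bool) : Plane := base k b + vert (n * (2 * shift k 1))

theorem tilePos_zero (k : Fin 7) (b : Bool) : tilePos k 0 b = base k b := by
  rw [tilePos, Int.cast_zero, zero_mul, vert_zero, add_zero]

theorem tilePos_true (k : Fin 7) (n : ℤ) : tilePos k n true = tilePos k n false + shift k := by
  rw [tilePos, tilePos, base_false, base_true]; abel

theorem tilePos_true' (k : Fin 7) (n : ℤ) :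
    tilePos k n true = tilePos k (n + 1) false + shift (-k) := by
  rw [tilePos, tilePos, base_false, base_true, shift_neg, Int.cast_add, add_mul, vert_add]
  simp only [Int.cast_one, one_mul]; abel

theorem tilePos_add (k : Fin 7) (n m : ℤ) (b : Bool) :
    tilePos k (n + m) b = tilePos k n b + vert (m * (2 * shift k 1)) := by
  rw [tilePos, tilePos, Int.cast_add, add_mul, vert_add, add_assoc]

theorem glue_top {n : ℤ} {z : Plane} {p q : Surface}
    (hp : IsPt false (z - tilePos k n false) p) (hq : IsPt true (z - tilePos k n true) q) :
    p = q := by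
  rw [tilePos_true, ← sub_sub] at hq
  have h1 := mem_P_false.1 hp.1 k
  have h2 := mem_P_false.1 (mem_P_true.1 hq.1) k
  rw [neg_sub, normal_dot_shift_sub] at h2
  exact (hp.glue (k := k) (by linarith)).unique hq

theorem glue_bottom {n : ℤ} {z : Plane} {p q : Surface}
    (hp : IsPt true (z - tilePos k n true) p)
    (hq : IsPt false (z - tilePos k (n + 1) false) q) : p = q := by
  rw [tilePos_true', ← sub_sub] at hp
  have h1 := mem_P_false.1 hq.1 (-k)
  have h2 := mem_P_false.1 (mem_P_true.1 hp.1) (-k)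
  rw [neg_sub, normal_dot_shift_sub] at h2
  exact hp.unique (hq.glue (k := -k) (by linarith))

theorem shift_one_pos (hk : 0 < normal k 1) : 0 < shift k 1 := by
  rw [shift_one]; have := apothem_pos; positivity

theorem mem_tile_false (hk : 0 < normal k 1) {z : Plane} (hz : z 0 ∈ strip k) (n : ℤ) :
    z - tilePos k n false ∈ P false ↔
      |z 1 - n * (2 * shift k 1)| * normal k 1 ≤ height k (z 0) := by
  have e0 : (z - tilePos k n false) 0 = z 0 := by simp [tilePos, base]
  have e1 : (z - tilePos k n false) 1 = z 1 - n * (2 * shift k 1) := by simp [tilePos, base]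
  rw [← e0, ← e1]
  exact ⟨abs_le_of_mem_P, mem_P_of_abs_le hk (by rwa [e0])⟩

theorem mem_tile_true (hk : 0 < normal k 1) {z : Plane} (hz : z 0 ∈ strip k) (n : ℤ) :
    z - tilePos k n true ∈ P true ↔
      |z 1 - n * (2 * shift k 1) - shift k 1| * normal k 1 ≤
        shift k 1 * normal k 1 - height k (z 0) := by
  have e0 : (-(z - tilePos k n true)) 0 = shift k 0 - z 0 := by simp [tilePos, base]
  have e1 : (-(z - tilePos k n true)) 1 = -(z 1 - n * (2 * shift k 1) - shift k 1) := by
    simp [tilePos, base]; ring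
  rw [← height_shift_sub, ← e0, ← abs_neg, ← e1, mem_P_true]
  exact ⟨abs_le_of_mem_P, mem_P_of_abs_le hk (by rwa [e0, shift_sub_mem_strip])⟩

theorem height_le (hk : 0 < normal k 1) {x : ℝ} (hx : x ∈ strip k) :
    height k x ≤ shift k 1 * normal k 1 := by
  have := height_nonneg hk (shift_sub_mem_strip.2 hx)
  rw [height_shift_sub] at this
  linarith

/-- Two different tiles of this kind can meet only if they are consecutive and the chord has its
full height. The tile of `P true` in between is then reduced to a point over this abscissa, and the
identification passes through it. -/
theorem tile_unique_false (hk : 0 < normal k 1) {z : Plane} (hz : z 0 ∈ strip k) {n m : ℤ}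
    (hnm : n ≤ m) {p q : Surface} (hp : IsPt false (z - tilePos k n false) p)
    (hq : IsPt false (z - tilePos k m false) q) : p = q := by
  have h1 := (mem_tile_false hk hz n).1 hp.1
  have h2 := (mem_tile_false hk hz m).1 hq.1
  have h3 := height_le hk hz
  have hc := shift_one_pos hk
  rw [← le_div_iff₀ hk, abs_le] at h1 h2
  have h4 : height k (z 0) / normal k 1 ≤ shift k 1 := by rwa [div_le_iff₀ hk]
  rcases eq_or_lt_of_le hnm with rfl | hlt
  · exact hp.unique hq
  rcases eq_or_lt_of_le (Int.add_one_le_of_lt hlt) with rfl | hlt2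
  · push_cast at h2
    have e1 : z 1 - n * (2 * shift k 1) - shift k 1 = 0 := by linarith
    have e2 : height k (z 0) / normal k 1 = shift k 1 := by linarith
    have h5 : z - tilePos k n true ∈ P true := by
      rw [mem_tile_true hk hz, e1]
      rw [div_eq_iff hk.ne'] at e2
      simp [e2]
    exact (glue_top hp ⟨h5, rfl⟩).trans (glue_bottom ⟨h5, rfl⟩ hq)
  · exfalso
    have : (n : ℝ) + 2 ≤ m := by exact_mod_cast (by omega : n + 2 ≤ m)
    have := mul_le_mul_of_nonneg_right this (by positivity : 0 ≤ 2 * shift k 1)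
    linarith

/-- The mirror case: consecutive tiles meet where the chord of the intermediate tile of `P false`
has height zero. -/
theorem tile_unique_true (hk : 0 < normal k 1) {z : Plane} (hz : z 0 ∈ strip k) {n m : ℤ}
    (hnm : n ≤ m) {p q : Surface} (hp : IsPt true (z - tilePos k n true) p)
    (hq : IsPt true (z - tilePos k m true) q) : p = q := by
  have h1 := (mem_tile_true hk hz n).1 hp.1
  have h2 := (mem_tile_true hk hz m).1 hq.1
  have h3 := height_nonneg hk hz
  have hc := shift_one_pos hk
  rw [← le_div_iff₀ hk, abs_le, sub_div, mul_div_cancel_right₀ _ hk.ne'] at h1 h2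
  have h4 : 0 ≤ height k (z 0) / normal k 1 := by positivity
  rcases eq_or_lt_of_le hnm with rfl | hlt
  · exact hp.unique hq
  rcases eq_or_lt_of_le (Int.add_one_le_of_lt hlt) with rfl | hlt2
  · push_cast at h2
    have e1 : z 1 - (n + 1) * (2 * shift k 1) = 0 := by linarith
    have h5 : z - tilePos k (n + 1) false ∈ P false := by
      rw [mem_tile_false hk hz]
      push_cast
      rw [e1]
      simpa using h3
    exact (glue_bottom hp ⟨h5, rfl⟩).trans (glue_top ⟨h5, rfl⟩ hq)
  · exfalso
    have : (n : ℝ) + 2 ≤ m := by exact_mod_cast (by omega : n + 2 ≤ m)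
    have := mul_le_mul_of_nonneg_right this (by positivity : 0 ≤ 2 * shift k 1)
    linarith

theorem tile_unique_mixed (hk : 0 < normal k 1) {z : Plane} (hz : z 0 ∈ strip k) {n m : ℤ}
    {p q : Surface} (hp : IsPt false (z - tilePos k n false) p)
    (hq : IsPt true (z - tilePos k m true) q) : p = q := by
  have h1 := (mem_tile_false hk hz n).1 hp.1
  have h2 := (mem_tile_true hk hz m).1 hq.1
  have hc := shift_one_pos hk
  rw [← le_div_iff₀ hk, abs_le] at h1 h2
  rw [sub_div, mul_div_cancel_right₀ _ hk.ne'] at h2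
  rcases lt_trichotomy n m with h | rfl | h
  · exfalso
    have : (n : ℝ) + 1 ≤ m := by exact_mod_cast h
    have := mul_le_mul_of_nonneg_right this (by positivity : 0 ≤ 2 * shift k 1)
    linarith
  · exact glue_top hp hq
  rcases eq_or_lt_of_le (Int.add_one_le_of_lt h) with rfl | hlt2
  · exact (glue_bottom hq hp).symm
  · exfalso
    have : (m : ℝ) + 2 ≤ n := by exact_mod_cast (by omega : m + 2 ≤ n)
    have := mul_le_mul_of_nonneg_right this (by positivity : 0 ≤ 2 * shift k 1)
    linarith

theorem tile_unique (hk : 0 < normal k 1) {z : Plane} (hz : z 0 ∈ strip k) {n m : ℤ}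
    {b c : Bool} {p q : Surface} (hp : IsPt b (z - tilePos k n b) p)
    (hq : IsPt c (z - tilePos k m c) q) : p = q := by
  cases b <;> cases c
  · rcases le_total n m with h | h
    · exact tile_unique_false hk hz h hp hq
    · exact (tile_unique_false hk hz h hq hp).symm
  · exact tile_unique_mixed hk hz hp hq
  · exact (tile_unique_mixed hk hz hq hp).symm
  · rcases le_total n m with h | h
    · exact tile_unique_true hk hz h hp hq
    · exact (tile_unique_true hk hz h hq hp).symm

/-- Rounding to the nearest copy of `P false` leaves a distance of at most half the period. A point
beyond that copy's chord lies on the chord of the copy of `P true` just above (index `n`) or just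
below (index `n - 1`). -/
theorem exists_mem_tile (hk : 0 < normal k 1) {z : Plane} (hz : z 0 ∈ strip k) :
    ∃ n b, z - tilePos k n b ∈ P b := by
  have hc := shift_one_pos hk
  set n : ℤ := round (z 1 / (2 * shift k 1)) with hn
  have h1 := abs_sub_round (z 1 / (2 * shift k 1))
  have h2 : |z 1 - n * (2 * shift k 1)| ≤ shift k 1 := by
    have e : z 1 - n * (2 * shift k 1) = (z 1 / (2 * shift k 1) - n) * (2 * shift k 1) := by
      field_simp
    rw [e, abs_mul, abs_of_pos (by positivity : 0 < 2 * shift k 1)]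
    nlinarith
  by_cases h3 : |z 1 - n * (2 * shift k 1)| * normal k 1 ≤ height k (z 0)
  · exact ⟨n, false, (mem_tile_false hk hz n).2 h3⟩
  rw [not_le] at h3
  rw [abs_le] at h2
  rcases le_total 0 (z 1 - n * (2 * shift k 1)) with h4 | h4
  · refine ⟨n, true, (mem_tile_true hk hz n).2 ?_⟩
    rw [abs_of_nonneg h4] at h3
    rw [abs_of_nonpos (by linarith)]
    linarith
  · refine ⟨n - 1, true, (mem_tile_true hk hz _).2 ?_⟩
    rw [abs_of_nonpos h4] at h3
    push_cast
    rw [abs_of_nonneg (by linarith)]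
    linarith

open Classical in
/-- The parametrization of the `k`-th vertical cylinder by a vertical strip. -/
def cyl (k : Fin 7) (z : Plane) : Surface :=
  -- The default value is never taken over the strip, by `exists_mem_tile`.
  if h : ∃ p, ∃ n b, IsPt b (z - tilePos k n b) p then h.choose else center false

theorem exists_cyl (hk : 0 < normal k 1) {z : Plane} (hz : z 0 ∈ strip k) :
    ∃ n b, IsPt b (z - tilePos k n b) (cyl k z) := by
  obtain ⟨n, b, h⟩ := exists_mem_tile hk hz
  have h' : ∃ p, ∃ n b, IsPt b (z - tilePos k n b) p := ⟨_, n, b, h, rfl⟩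
  rw [cyl, dif_pos h']
  exact h'.choose_spec

theorem cyl_eq (hk : 0 < normal k 1) {z : Plane} (hz : z 0 ∈ strip k) {n : ℤ} {b : Bool}
    {p : Surface} (hp : IsPt b (z - tilePos k n b) p) : cyl k z = p := by
  obtain ⟨m, c, h⟩ := exists_cyl hk hz
  exact tile_unique hk hz h hp

theorem isPt_cyl (hk : 0 < normal k 1) {z : Plane} (hz : z 0 ∈ strip k) {n : ℤ} {b : Bool}
    (h : z - tilePos k n b ∈ P b) : IsPt b (z - tilePos k n b) (cyl k z) :=
  ⟨h, cyl_eq hk hz ⟨h, rfl⟩⟩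

theorem cyl_add_period (hk : 0 < normal k 1) {z : Plane} (hz : z 0 ∈ strip k) (m : ℤ) :
    cyl k (z + vert (m * (2 * shift k 1))) = cyl k z := by
  obtain ⟨n, b, h⟩ := exists_cyl hk hz
  refine cyl_eq hk (n := n + m) (b := b) (by simpa using hz) ?_
  rwa [tilePos_add, add_sub_add_right_eq_sub]

theorem cyl_base (hk : 0 < normal k 1) {b : Bool} {z : Plane} (hz : (z + base k b) 0 ∈ strip k)
    {p : Surface} (hp : IsPt b z p) : cyl k (z + base k b) = p :=
  cyl_eq hk hz (n := 0) (b := b) (by rwa [tilePos_zero, add_sub_cancel_right])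

theorem base_mem_strip {b : Bool} {z : Plane} :
    (z + base k b) 0 ∈ strip k ↔ sgn b * z 0 ∈ strip k := by
  cases b
  · rw [base_false, add_zero, sgn_false, one_mul]
  · rw [base_true, sgn_true, neg_one_mul, ← shift_sub_mem_strip]
    rw [show shift k 0 - (z + shift k) 0 = -z 0 by simp]

theorem base_mem_openStrip {b : Bool} {z : Plane} :
    (z + base k b) 0 ∈ openStrip k ↔ sgn b * z 0 ∈ openStrip k := by
  cases b
  · rw [base_false, add_zero, sgn_false, one_mul]
  · rw [base_true, sgn_true, neg_one_mul, ← shift_sub_mem_openStrip]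
    rw [show shift k 0 - (z + shift k) 0 = -z 0 by simp]

/-- The closed tiles form a locally finite cover of the strip, and on each of them the map is a
translation followed by the quotient map. -/
theorem continuousOn_cyl (hk : 0 < normal k 1) : ContinuousOn (cyl k) {z | z 0 ∈ strip k} := by
  set tile : ℤ × Bool → Set Plane := fun i =>
    {z | z 0 ∈ strip k} ∩ {z | z - tilePos k i.1 i.2 ∈ P i.2} with htile
  have hcov : {z : Plane | z 0 ∈ strip k} = ⋃ i, tile i := by
    ext z
    simp only [htile, mem_iUnion, mem_inter_iff, mem_ofPred_eq, Prod.exists]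
    exact ⟨fun h => let ⟨n, b, hn⟩ := exists_mem_tile hk h; ⟨n, b, h, hn⟩,
      fun ⟨_, _, h, _⟩ => h⟩
  have hstrip : IsClosed {z : Plane | z 0 ∈ strip k} :=
    (isClosed_strip k).preimage (continuous_apply 0)
  rw [hcov]
  refine LocallyFinite.continuousOn_iUnion ?_ ?_ ?_
  · intro z
    have hc := shift_one_pos hk
    refine ⟨{y | |y 1 - z 1| < 1}, ?_, ?_⟩
    · exact (isOpen_lt (by fun_prop) continuous_const).mem_nhds (by simp)
    · have hfin : (Icc ⌊(z 1 - 1 - 2 * shift k 1) / (2 * shift k 1)⌋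
          ⌈(z 1 + 1 + 2 * shift k 1) / (2 * shift k 1)⌉ ×ˢ (univ : Set Bool)).Finite :=
        (finite_Icc _ _).prod finite_univ
      refine hfin.subset ?_
      rintro ⟨n, b⟩ ⟨y, ⟨hy, hyn⟩, hyz⟩
      rw [mem_ofPred_eq, abs_lt] at hyz
      have hb : |y 1 - n * (2 * shift k 1)| ≤ 2 * shift k 1 := by
        cases b
        · have h1 := ((mem_tile_false hk hy n).1 hyn).trans (height_le hk hy)
          have := le_of_mul_le_mul_right h1 hk
          linarith
        · have h0 := height_nonneg hk hy
          have h1 := ((mem_tile_true hk hy n).1 hyn).trans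
            (sub_le_self _ h0)
          have := abs_le.1 (le_of_mul_le_mul_right h1 hk)
          rw [abs_le]; constructor <;> linarith
      rw [abs_le] at hb
      refine ⟨⟨?_, ?_⟩, mem_univ _⟩
      · have : (⌊(z 1 - 1 - 2 * shift k 1) / (2 * shift k 1)⌋ : ℝ) ≤ n :=
          (Int.floor_le _).trans ((div_le_iff₀ (by positivity)).2 (by linarith))
        exact_mod_cast this
      · have : (n : ℝ) ≤ ⌈(z 1 + 1 + 2 * shift k 1) / (2 * shift k 1)⌉ :=
          ((le_div_iff₀ (by positivity)).2 (by linarith)).trans (Int.le_ceil _)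
        exact_mod_cast this
  · intro i
    exact hstrip.inter ((isClosed_P i.2).preimage (continuous_id.sub continuous_const))
  · rintro ⟨n, b⟩
    rw [continuousOn_iff_continuous_domRestrict]
    have : (tile (n, b)).domRestrict (cyl k) =
        fun z : tile (n, b) => pt b (z.1 - tilePos k n b) z.2.2 := by
      ext z
      exact (isPt_cyl hk z.2.1 z.2.2).unique ⟨z.2.2, rfl⟩
    rw [this]
    exact continuous_quot_mk.comp (Continuous.subtype_mk (by fun_prop) _)

/-- The cylinder parametrizations are compatible with the charts of the translation atlas. -/
theorem cyl_hasCoord_top (hk : 0 < normal k 1) (n : ℤ) {z : Plane} (hz : z 0 ∈ strip k)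
    (h : z - tilePos k n false ∈ domain k) : HasCoord k (z - tilePos k n false) (cyl k z) := by
  refine ⟨h, ?_⟩
  rcases h with h | h | h
  · exact Or.inl (isPt_cyl hk hz (openP_subset _ h))
  · rw [sub_sub, ← tilePos_true] at h ⊢
    exact Or.inr (isPt_cyl hk hz (openP_subset _ h))
  · exact Or.inl (isPt_cyl hk hz (openSide_subset _ h))

theorem cyl_hasCoord_bottom (hk : 0 < normal k 1) (n : ℤ) {z : Plane} (hz : z 0 ∈ strip k)
    (h : z - tilePos k n false ∈ domain (-k)) :
    HasCoord (-k) (z - tilePos k n false) (cyl k z) := by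
  refine ⟨h, ?_⟩
  rcases h with h | h | h
  · exact Or.inl (isPt_cyl hk hz (openP_subset _ h))
  · have e := tilePos_true' k (n - 1)
    rw [sub_add_cancel] at e
    rw [sub_sub, ← e] at h ⊢
    exact Or.inr (isPt_cyl hk hz (openP_subset _ h))
  · exact Or.inl (isPt_cyl hk hz (openSide_subset _ h))

/-- Over the open strip a chord meets the boundary of its heptagon only inside the sides `k` and
`-k`, so these two charts suffice. -/
theorem exists_chart_cyl (hk : 0 < normal k 1) {z : Plane} (hz : z 0 ∈ openStrip k) :
    ∃ j u, ∀ᶠ x in 𝓝 z, HasCoord j (x - u) (cyl k x) := by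
  have key : ∀ n : ℤ, ∀ j, z - tilePos k n false ∈ domain j → (j = k ∨ j = -k) →
      ∃ j u, ∀ᶠ x in 𝓝 z, HasCoord j (x - u) (cyl k x) := by
    intro n j hj hjk
    refine ⟨j, tilePos k n false, ?_⟩
    have h1 : ∀ᶠ x in 𝓝 z, x - tilePos k n false ∈ domain j :=
      ((isOpen_domain j).preimage (continuous_id.sub continuous_const)).mem_nhds hj
    have h2 : ∀ᶠ x : Plane in 𝓝 z, x 0 ∈ openStrip k :=
      ((isOpen_openStrip k).preimage (continuous_apply 0)).mem_nhds hz
    filter_upwards [h1, h2] with x h3 h4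
    rcases hjk with rfl | rfl
    · exact cyl_hasCoord_top hk n (openStrip_subset _ h4) h3
    · exact cyl_hasCoord_bottom hk n (openStrip_subset _ h4) h3
  obtain ⟨n, b, h⟩ := exists_mem_tile hk (openStrip_subset _ hz)
  cases b
  · have e0 : (z - tilePos k n false) 0 = z 0 := by simp [tilePos, base]
    rcases mem_P_cases hk h (by rwa [e0]) with h1 | h1 | h1
    · exact key n k (Or.inl h1) (Or.inl rfl)
    · exact key n k (Or.inr (Or.inr h1)) (Or.inl rfl)
    · exact key n (-k) (Or.inr (Or.inr h1)) (Or.inr rfl)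
  · have e0 : (-(z - tilePos k n true)) 0 = shift k 0 - z 0 := by simp [tilePos, base]
    have e1 : z - tilePos k n false - shift k = z - tilePos k n true := by
      rw [tilePos_true, sub_sub]
    have e2 : z - tilePos k (n + 1) false - shift (-k) = z - tilePos k n true := by
      rw [tilePos_true', sub_sub]
    rcases mem_P_cases hk (mem_P_true.1 h) (by rwa [e0, shift_sub_mem_openStrip]) with
      h1 | h1 | h1
    · exact key n k (Or.inr (Or.inl (by rw [e1]; exact mem_openP_true.2 h1))) (Or.inl rfl)
    · refine key n k (Or.inr (Or.inr ?_)) (Or.inl rfl)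
      have := shift_sub_mem_openSide h1
      rwa [← e1, sub_neg_eq_add, add_sub_cancel] at this
    · refine key (n + 1) (-k) (Or.inr (Or.inr ?_)) (Or.inr rfl)
      have := shift_sub_mem_openSide h1
      rwa [← e2, sub_neg_eq_add, add_sub_cancel] at this

end

noncomputable section

variable {k : Fin 7}

/-! ### Vertical twists -/

/-- The inverse modulus of the vertical cylinders. -/
def invModulus : ℝ := 2 * apothem / halfSide

/-- The abscissa of the right end of the `k`-th strip. -/
def rightEnd (k : Fin 7) : ℝ := apothem * normal k 0 + halfSide * normal k 1

/-- The vertical shear that fixes the right end of the `k`-th strip. -/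
def shear (k : Fin 7) (ε : ℤ) (z : Plane) : Plane :=
  z + vert (ε * invModulus * (z 0 - rightEnd k))

@[simp] theorem shear_zero_apply (ε : ℤ) (z : Plane) : shear k ε z 0 = z 0 := by
  simp [shear]

theorem shear_shear (ε ε' : ℤ) (z : Plane) :
    shear k ε' (shear k ε z) = shear k (ε + ε') z := by
  rw [shear, shear_zero_apply, shear, shear, add_assoc, ← vert_add]
  push_cast
  ring_nf

theorem shear_zero (z : Plane) : shear k 0 z = z := by
  rw [shear, Int.cast_zero, zero_mul, zero_mul, vert_zero, add_zero]

theorem shear_add_vert (ε : ℤ) (z : Plane) (t : ℝ) :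
    shear k ε (z + vert t) = shear k ε z + vert t := by
  rw [shear, shear, Pi.add_apply, vert_zero_apply, add_zero]; abel

theorem continuous_shear (k : Fin 7) (ε : ℤ) : Continuous (shear k ε) :=
  continuous_id.add (continuous_vert.comp (by fun_prop))

/-- At the ends of a strip, the shear is a translation by a multiple of the period. -/
theorem exists_period {x : ℝ} (h : x ∈ strip k) (h' : x ∉ openStrip k) (ε : ℤ) :
    ∃ m : ℤ, ε * invModulus * (x - rightEnd k) = m * (2 * shift k 1) := by
  have e : |x - apothem * normal k 0| = halfSide * normal k 1 := le_antisymm h (not_lt.1 h')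
  have hs := halfSide_pos
  rw [shift_one, invModulus, rightEnd]
  rcases abs_cases (x - apothem * normal k 0) with ⟨e', _⟩ | ⟨e', _⟩
  · exact ⟨0, by rw [show x - _ = 0 by linarith]; simp⟩
  · refine ⟨-ε, ?_⟩
    rw [show x - (apothem * normal k 0 + halfSide * normal k 1) = -(2 * halfSide * normal k 1) by
      linarith]
    push_cast
    field_simp

theorem cyl_shear_of_end (hk : 0 < normal k 1) {z : Plane} (h : z 0 ∈ strip k)
    (h' : z 0 ∉ openStrip k) (ε : ℤ) : cyl k (shear k ε z) = cyl k z := by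
  obtain ⟨m, hm⟩ := exists_period h h' ε
  rw [shear, hm, cyl_add_period hk h]

open Classical in
/-- The index of a strip that contains a given abscissa. -/
def stripIndex (x : ℝ) : Fin 7 := if x ∈ strip 1 then 1 else if x ∈ strip 2 then 2 else 3

theorem stripIndex_mem_upper (x : ℝ) : stripIndex x ∈ upper := by
  unfold stripIndex
  split_ifs <;> simp [upper]

theorem mem_strip_stripIndex {x : ℝ} (h : ∃ k ∈ upper, x ∈ strip k) :
    x ∈ strip (stripIndex x) := by
  unfold stripIndex
  split_ifs with h1 h2
  · exact h1
  · exact h2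
  · obtain ⟨k, hk, hx⟩ := h
    rcases mem_upper.1 hk with rfl | rfl | rfl
    · exact absurd hx h1
    · exact absurd hx h2
    · exact hx

/-- The image under the twist of the point `z` of `P b`. -/
def twistPt (ε : ℤ) (b : Bool) (z : Plane) : Surface :=
  cyl (stripIndex (sgn b * z 0))
    (shear (stripIndex (sgn b * z 0)) ε (z + base (stripIndex (sgn b * z 0)) b))

/-- The choice of strip is immaterial: an abscissa in two different strips is an end of both, and
there the shear displaces by whole periods, hence acts as the identity. -/
theorem twistPt_eq (hk : k ∈ upper) (ε : ℤ) {b : Bool} {z : Plane} (hz : z ∈ P b)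
    (h : sgn b * z 0 ∈ strip k) : twistPt ε b z = cyl k (shear k ε (z + base k b)) := by
  have hj := stripIndex_mem_upper (sgn b * z 0)
  have hzj := mem_strip_stripIndex ⟨k, hk, h⟩
  rw [twistPt]
  set j := stripIndex (sgn b * z 0)
  by_cases hjk : j = k
  · rw [hjk]
  have key : ∀ l ∈ upper, sgn b * z 0 ∈ strip l → sgn b * z 0 ∉ openStrip l →
      cyl l (shear l ε (z + base l b)) = pt b z hz := by
    intro l hl h1 h2
    have hl' := normal_one_pos hl
    rw [cyl_shear_of_end hl' (base_mem_strip.2 h1) (fun h => h2 (base_mem_openStrip.1 h))]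
    exact cyl_base hl' (base_mem_strip.2 h1) ⟨hz, rfl⟩
  rw [key j hj hzj (notMem_openStrip_of_ne hk hj (Ne.symm hjk) h),
    key k hk h (notMem_openStrip_of_ne hj hk hjk hzj)]

theorem side_mem_strip (hk : 0 < normal k 1) {z : Plane} (h : z ∈ P false)
    (hz : normal k ⬝ᵥ z = apothem) : z 0 ∈ strip k := by
  have := abs_tang_mul_normal hz
  rw [abs_of_pos hk] at this
  rw [strip, mem_ofPred_eq, ← this]
  exact mul_le_mul_of_nonneg_right (abs_tang_le hz (mem_P_false.1 h)) hk.le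

theorem bottom_side_mem_strip (hk : 0 < normal k 1) {z : Plane} (h : z ∈ P false)
    (hz : normal (-k) ⬝ᵥ z = apothem) : z 0 ∈ strip k := by
  have := abs_tang_mul_normal hz
  rw [(normal_neg k).1, (normal_neg k).2, abs_neg, abs_of_pos hk] at this
  rw [strip, mem_ofPred_eq, ← this]
  exact mul_le_mul_of_nonneg_right (abs_tang_le hz (mem_P_false.1 h)) hk.le

theorem normal_zero : normal 0 0 = 1 ∧ normal 0 1 = 0 := by simp [normal]

theorem apothem_notMem_openStrip (hk : k ∈ upper) : apothem ∉ openStrip k := by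
  intro h
  rw [mem_openStrip_iff] at h
  have h1 := h.2
  have c1 := cos_three_le
  have c2 := cos_five_lt
  have e : apothem = Real.cos (1 * (Real.pi / 7)) := by rw [one_mul]; rfl
  rw [e] at h1
  rcases mem_upper.1 hk with rfl | rfl | rfl
  · norm_num at h1
  · norm_num at h1 c1
    linarith
  · norm_num at h1 c1
    linarith

theorem twistPt_of_end (ε : ℤ) {b : Bool} {z : Plane} {p : Surface} (hp : IsPt b z p)
    (h : ∀ k ∈ upper, sgn b * z 0 ∉ openStrip k) : twistPt ε b z = p := by
  obtain ⟨k, hk, h1⟩ := exists_strip_sgn hp.1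
  have hk' := normal_one_pos hk
  rw [twistPt_eq hk ε hp.1 h1, cyl_shear_of_end hk' (base_mem_strip.2 h1)
    (fun h2 => h k hk (base_mem_openStrip.1 h2))]
  exact cyl_base hk' (base_mem_strip.2 h1) hp

theorem upper_cases (j : Fin 7) : j ∈ upper ∨ -j ∈ upper ∨ j = 0 := by
  fin_cases j <;> decide

/-- Across an upper side the two representatives have the same cylinder coordinate; across a lower
side their coordinates differ by one period; the vertical side 0 bounds a cylinder and is fixed
pointwise. -/
theorem twistPt_glued (ε : ℤ) {j : Fin 7} {z : Plane} (hz : z ∈ P false)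
    (hj : normal j ⬝ᵥ z = apothem) : twistPt ε false z = twistPt ε true (z - shift j) := by
  have hz' := sub_shift_mem_P hz hj
  rcases upper_cases j with hk | hk | rfl
  · have hk' := normal_one_pos hk
    have h1 := side_mem_strip hk' hz hj
    rw [twistPt_eq hk ε hz (by rwa [sgn_false, one_mul]), twistPt_eq hk ε hz' (by
      rwa [← base_mem_strip, base_true, sub_add_cancel]), base_true, base_false, add_zero,
      sub_add_cancel]
  · obtain ⟨k, rfl⟩ : ∃ k, j = -k := ⟨-j, (neg_neg j).symm⟩
    rw [neg_neg] at hk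
    have hk' := normal_one_pos hk
    have h1 := bottom_side_mem_strip hk' hz hj
    have e : z - shift (-k) + shift k = z + vert (2 * shift k 1) := by rw [shift_neg]; abel
    rw [twistPt_eq hk ε hz (by rwa [sgn_false, one_mul]), twistPt_eq hk ε hz' (by
      rw [← base_mem_strip, base_true, e]; simpa using h1), base_true, base_false, add_zero, e,
      shear_add_vert]
    have := cyl_add_period hk' (z := shear k ε z) (by simpa using h1) 1
    rw [Int.cast_one, one_mul] at this
    exact this.symm
  · have h0 : z 0 = apothem := by
      rw [dot_eq, normal_zero.1, normal_zero.2] at hj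
      linarith
    have hp : IsPt false z (pt false z hz) := ⟨hz, rfl⟩
    rw [twistPt_of_end ε hp fun k hk => ?_, twistPt_of_end ε (hp.glue hj) fun k hk => ?_]
    · rw [sgn_true, Pi.sub_apply, shift_zero, h0, normal_zero.1]
      rw [show -1 * (apothem - 2 * apothem * 1) = apothem by ring]
      exact apothem_notMem_openStrip hk
    · rw [sgn_false, one_mul, h0]
      exact apothem_notMem_openStrip hk

/-- The `ε`-th power of the simultaneous Dehn twist in the vertical cylinders. -/
def twist (ε : ℤ) : Surface → Surface :=
  Quot.lift (fun x => twistPt ε x.1.1 x.1.2) (by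
    rintro ⟨⟨b1, z1⟩, h1⟩ ⟨⟨b2, z2⟩, h2⟩ ⟨k, e1, e2, e3, e4⟩
    simp only at e1 e2 e3 e4
    subst e1 e2 e4
    exact twistPt_glued ε h1 e3)

theorem IsPt.twist_eq (ε : ℤ) {b : Bool} {z : Plane} {p : Surface} (h : IsPt b z p) :
    twist ε p = twistPt ε b z := by
  obtain ⟨_, rfl⟩ := h
  rfl

theorem twist_cyl (hk : k ∈ upper) (ε : ℤ) {z : Plane} (hz : z 0 ∈ strip k) :
    twist ε (cyl k z) = cyl k (shear k ε z) := by
  have hk' := normal_one_pos hk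
  obtain ⟨n, b, h⟩ := exists_cyl hk' hz
  have e : z - tilePos k n b + base k b = z + vert ((-n : ℤ) * (2 * shift k 1)) := by
    rw [tilePos, Int.cast_neg, neg_mul]
    have : vert (-((n : ℝ) * (2 * shift k 1))) = -vert (n * (2 * shift k 1)) := by
      ext i; fin_cases i <;> simp [vert]
    rw [this]; abel
  rw [h.twist_eq, twistPt_eq hk ε h.1 (by rw [← base_mem_strip, e]; simpa using hz), e,
    shear_add_vert, cyl_add_period hk' (by simpa using hz)]

theorem exists_eq_cyl (p : Surface) : ∃ k ∈ upper, ∃ z : Plane, z 0 ∈ strip k ∧ p = cyl k z := by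
  obtain ⟨b, z, h⟩ := exists_isPt p
  obtain ⟨k, hk, h1⟩ := exists_strip_sgn h.1
  exact ⟨k, hk, _, base_mem_strip.2 h1, (cyl_base (normal_one_pos hk) (base_mem_strip.2 h1) h).symm⟩

theorem twist_twist (ε ε' : ℤ) (p : Surface) : twist ε' (twist ε p) = twist (ε + ε') p := by
  obtain ⟨k, hk, z, hz, rfl⟩ := exists_eq_cyl p
  rw [twist_cyl hk ε hz, twist_cyl hk ε' (by simpa using hz), twist_cyl hk _ hz, shear_shear]

theorem twist_zero (p : Surface) : twist 0 p = p := by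
  obtain ⟨k, hk, z, hz, rfl⟩ := exists_eq_cyl p
  rw [twist_cyl hk 0 hz, shear_zero]

theorem continuous_twist (ε : ℤ) : Continuous (twist ε) := by
  refine continuous_quot_lift _ ?_
  set piece : Bool × upper → Set Pieces := fun i =>
    {x | x.1.1 = i.1 ∧ sgn i.1 * x.1.2 0 ∈ strip i.2} with hpiece
  have c1 : Continuous fun x : Pieces => x.1.1 := by fun_prop
  have c2 : Continuous fun x : Pieces => x.1.2 := by fun_prop
  refine (locallyFinite_of_finite piece).continuous ?_ ?_ ?_
  · ext x
    simp only [mem_iUnion, mem_univ, iff_true]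
    obtain ⟨k, hk, h⟩ := exists_strip_sgn x.2
    exact ⟨(x.1.1, ⟨k, hk⟩), rfl, h⟩
  · rintro ⟨b, k⟩
    have h1 : IsClosed {x : Pieces | x.1.1 = b} := isClosed_eq c1 continuous_const
    have h2 : IsClosed {x : Pieces | sgn b * x.1.2 0 ∈ strip k} :=
      (isClosed_strip _).preimage (continuous_const.mul ((continuous_apply 0).comp c2))
    exact h1.inter h2
  · rintro ⟨b, k⟩
    have hk := normal_one_pos k.2
    have c3 : Continuous fun x : Pieces => shear k ε (x.1.2 + base k b) :=
      (continuous_shear _ _).comp (c2.add continuous_const)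
    refine ((continuousOn_cyl hk).comp c3.continuousOn (s := piece (b, k)) ?_).congr ?_
    · rintro x ⟨rfl, h⟩
      change shear k ε (x.1.2 + base k x.1.1) 0 ∈ strip k
      rw [shear_zero_apply]
      exact base_mem_strip.2 h
    · rintro x ⟨rfl, h⟩
      exact twistPt_eq k.2 ε x.2 h

/-- The twist as a homeomorphism. -/
def twistHomeomorph (ε : ℤ) : Surface ≃ₜ Surface where
  toFun := twist ε
  invFun := twist (-ε)
  left_inv p := by rw [twist_twist, add_neg_cancel, twist_zero]
  right_inv p := by rw [twist_twist, neg_add_cancel, twist_zero]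
  continuous_toFun := continuous_twist ε
  continuous_invFun := continuous_twist (-ε)

theorem twist_eq_self (ε : ℤ) {p : Surface} (hp : p ∈ singularities) : twist ε p = p := by
  obtain ⟨b, z, h, hv⟩ := mem_singularities_iff.1 hp
  rw [h.twist_eq]
  exact twistPt_of_end ε h fun k hk => notMem_openStrip (normal_one_pos hk) h.1 hv

/-! ### The twist is affine -/

/-- The derivative of the twist. -/
def twistMatrix (ε : ℤ) : Matrix (Fin 2) (Fin 2) ℝ := !![1, 0; ε * invModulus, 1]

theorem twistMatrix_mulVec (ε : ℤ) (z : Plane) :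
    twistMatrix ε *ᵥ z = z + vert (ε * invModulus * z 0) := by
  rw [mulVec_eq]
  ext i
  fin_cases i
  · simp [twistMatrix]
  · simp [twistMatrix]; ring

theorem shear_eq (ε : ℤ) (z x : Plane) :
    shear k ε x = shear k ε z + twistMatrix ε *ᵥ (x - z) := by
  rw [twistMatrix_mulVec, shear, shear]
  have : ε * invModulus * (x 0 - rightEnd k) =
    ε * invModulus * (z 0 - rightEnd k) + ε * invModulus * (x - z) 0 := by
    rw [Pi.sub_apply]; ring
  rw [this, vert_add]; abel

/-- In the interior of a cylinder the twist is affine. -/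
theorem twist_chart_interior (hk : k ∈ upper) (ε : ℤ) {z : Plane} (hz : z 0 ∈ openStrip k) :
    ∃ j w l w', HasCoord j w (cyl k z) ∧ HasCoord l w' (twist ε (cyl k z)) ∧
      ∀ᶠ x in 𝓝 w, ∀ q, HasCoord j x q →
        HasCoord l (w' + twistMatrix ε *ᵥ (x - w)) (twist ε q) := by
  have hk' := normal_one_pos hk
  obtain ⟨j, u, h1⟩ := exists_chart_cyl hk' hz
  obtain ⟨l, u', h2⟩ := exists_chart_cyl hk' (z := shear k ε z) (by simpa using hz)
  refine ⟨j, z - u, l, shear k ε z - u', h1.self_of_nhds, ?_, ?_⟩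
  · rw [twist_cyl hk ε (openStrip_subset _ hz)]
    exact h2.self_of_nhds
  · have t1 : Tendsto (fun x : Plane => z + (x - (z - u))) (𝓝 (z - u)) (𝓝 z) :=
      tendsto_translation _ _
    have t2 : Tendsto (fun x : Plane => shear k ε (z + (x - (z - u)))) (𝓝 (z - u))
        (𝓝 (shear k ε z)) := ((continuous_shear k ε).tendsto z).comp t1
    have h3 : ∀ᶠ x : Plane in 𝓝 z, x 0 ∈ openStrip k :=
      ((isOpen_openStrip k).preimage (continuous_apply 0)).mem_nhds hz
    filter_upwards [t1.eventually h1, t2.eventually h2, t1.eventually h3] with x h4 h5 h6 q hq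
    have e : z + (x - (z - u)) - u = x := by abel
    rw [e] at h4
    rw [hq.unique h4, twist_cyl hk ε (openStrip_subset _ h6)]
    rw [shear_eq ε z, add_sub_cancel_left] at h5
    rw [shear_eq ε z (z + (x - (z - u))), add_sub_cancel_left]
    have e2 : shear k ε z + twistMatrix ε *ᵥ (x - (z - u)) - u' =
      shear k ε z - u' + twistMatrix ε *ᵥ (x - (z - u)) := by abel
    rwa [e2] at h5

/-- Near to the boundaries of the cylinders the twist is affine. -/
theorem twist_near_end (ε : ℤ) {b : Bool} {z : Plane}
    (h : ∀ k ∈ upper, sgn b * z 0 ∉ openStrip k) :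
    ∀ᶠ x in 𝓝 z, ∀ p, IsPt b x p → z + twistMatrix ε *ᵥ (x - z) ∈ P b →
      IsPt b (z + twistMatrix ε *ᵥ (x - z)) (twist ε p) := by
  -- The strips are closed, so points near `z` enter only strips that contain the abscissa of `z`,
  -- as an end by hypothesis.
  have h1 : ∀ᶠ x : Plane in 𝓝 z, ∀ k : Fin 7, sgn b * x 0 ∈ strip k → sgn b * z 0 ∈ strip k := by
    refine eventually_all.2 fun k => ?_
    by_cases hz : sgn b * z 0 ∈ strip k
    · simp [hz]
    · have hc : Continuous fun x : Plane => sgn b * x 0 := by fun_prop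
      filter_upwards [((isClosed_strip k).isOpen_compl.preimage hc).mem_nhds hz] with x hx hx'
      exact absurd hx' hx
  filter_upwards [h1] with x h2 p hp hP
  obtain ⟨k, hk, h3⟩ := exists_strip_sgn hp.1
  have hk' := normal_one_pos hk
  -- In either adjacent strip the shear moves the base point of `z` by a whole number of periods, so
  -- both shears induce the same affine map fixing `z`.
  obtain ⟨m, hm⟩ := exists_period (base_mem_strip.2 (h2 k h3))
    (fun h4 => h k hk (base_mem_openStrip.1 h4)) ε
  have e : shear k ε (x + base k b) =
      z + twistMatrix ε *ᵥ (x - z) + base k b + vert (m * (2 * shift k 1)) := by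
    rw [shear_eq ε (z + base k b), add_sub_add_right_eq_sub, shear, hm]; abel
  have h5 : (z + twistMatrix ε *ᵥ (x - z) + base k b) 0 ∈ strip k := by
    have : (z + twistMatrix ε *ᵥ (x - z) + base k b) 0 = (x + base k b) 0 := by
      rw [twistMatrix_mulVec]; simp
    rw [this]
    exact base_mem_strip.2 h3
  refine ⟨hP, ?_⟩
  rw [hp.twist_eq, twistPt_eq hk ε hp.1 h3, e, cyl_add_period hk' h5]
  exact cyl_base hk' h5 ⟨hP, rfl⟩

theorem twistMatrix_apply_zero (ε : ℤ) (z x : Plane) :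
    (z + twistMatrix ε *ᵥ (x - z)) 0 = x 0 := by
  rw [twistMatrix_mulVec]; simp

theorem twist_chart_openP (ε : ℤ) {b : Bool} {z : Plane} {p : Surface} (hp : IsPt b z p)
    (hz : z ∈ openP b) (h : ∀ k ∈ upper, sgn b * z 0 ∉ openStrip k) :
    ∃ j w l w', HasCoord j w p ∧ HasCoord l w' (twist ε p) ∧
      ∀ᶠ x in 𝓝 w, ∀ q, HasCoord j x q →
        HasCoord l (w' + twistMatrix ε *ᵥ (x - w)) (twist ε q) := by
  have h0 : twist ε p = p := by rw [hp.twist_eq, twistPt_of_end ε hp h]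
  have hopen := (isOpen_openP b).mem_nhds hz
  have h1 := (tendsto_chart (twistMatrix ε) z z).eventually hopen
  have h2 := twist_near_end ε h
  cases b
  · refine ⟨0, z, 0, z, hp.hasCoord_false hz 0, h0.symm ▸ hp.hasCoord_false hz 0, ?_⟩
    filter_upwards [hopen, h1, h2] with x h3 h4 h5 q hq
    have hq' : IsPt false x q := by
      obtain ⟨q', hq'⟩ : ∃ q', IsPt false x q' := ⟨_, openP_subset _ h3, rfl⟩
      rwa [hq.unique (hq'.hasCoord_false h3 0)]
    exact (h5 q hq' (openP_subset _ h4)).hasCoord_false h4 0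
  · refine ⟨0, z + shift 0, 0, z + shift 0, hp.hasCoord_true hz 0,
      h0.symm ▸ hp.hasCoord_true hz 0, ?_⟩
    have ht : Tendsto (fun x : Plane => z + (x - (z + shift 0))) (𝓝 (z + shift 0)) (𝓝 z) :=
      tendsto_translation _ _
    filter_upwards [ht.eventually hopen, ht.eventually h1, ht.eventually h2] with x h3 h4 h5 q hq
    have e : z + (x - (z + shift 0)) + shift 0 = x := by abel
    have hq' : IsPt true (z + (x - (z + shift 0))) q := by
      obtain ⟨q', hq'⟩ : ∃ q', IsPt true (z + (x - (z + shift 0))) q' :=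
        ⟨_, openP_subset _ h3, rfl⟩
      have h6 := hq'.hasCoord_true h3 0
      rw [e] at h6
      rwa [hq.unique h6]
    have h7 := (h5 q hq' (openP_subset _ h4)).hasCoord_true h4 0
    rw [add_sub_cancel_left] at h7
    rwa [add_right_comm]

theorem twist_chart_side (ε : ℤ) {z : Plane} {p : Surface} (hp : IsPt false z p)
    (hz : z ∈ openSide 0) :
    ∃ j w l w', HasCoord j w p ∧ HasCoord l w' (twist ε p) ∧
      ∀ᶠ x in 𝓝 w, ∀ q, HasCoord j x q →
        HasCoord l (w' + twistMatrix ε *ᵥ (x - w)) (twist ε q) := by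
  have n0 : ∀ x : Plane, normal 0 ⬝ᵥ x = x 0 := fun x => by
    rw [dot_eq, normal_zero.1, normal_zero.2]; ring
  have z0 : z 0 = apothem := by rw [← n0 z, hz.1]
  have hf : ∀ k ∈ upper, sgn false * z 0 ∉ openStrip k := fun k hk => by
    rw [sgn_false, one_mul, z0]
    exact apothem_notMem_openStrip hk
  have ht : ∀ k ∈ upper, sgn true * (z - shift 0) 0 ∉ openStrip k := fun k hk => by
    rw [sgn_true, Pi.sub_apply, shift_zero, z0, normal_zero.1,
      show -1 * (apothem - 2 * apothem * 1) = apothem by ring]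
    exact apothem_notMem_openStrip hk
  have h0 : twist ε p = p := by rw [hp.twist_eq, twistPt_of_end ε hp hf]
  have hc : HasCoord 0 z p := ⟨Or.inr (Or.inr hz), Or.inl hp⟩
  have hopen := (isOpen_domain 0).mem_nhds hc.1
  have hsub : Tendsto (fun x : Plane => z - shift 0 + (x - z)) (𝓝 z) (𝓝 (z - shift 0)) :=
    tendsto_translation _ _
  refine ⟨0, z, 0, z, hc, h0.symm ▸ hc, ?_⟩
  filter_upwards [(tendsto_chart (twistMatrix ε) z z).eventually hopen, twist_near_end ε hf,
    hsub.eventually (twist_near_end ε ht)] with x h1 h2 h3 q hq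
  set y := z + twistMatrix ε *ᵥ (x - z) with hy
  have hyx : y 0 = x 0 := twistMatrix_apply_zero ε z x
  refine ⟨h1, ?_⟩
  have e1 : z - shift 0 + (x - z) = x - shift 0 := by abel
  have e2 : z - shift 0 + twistMatrix ε *ᵥ (x - shift 0 - (z - shift 0)) = y - shift 0 := by
    rw [sub_sub_sub_cancel_right, hy]; abel
  rw [e1, e2] at h3
  -- The derivative preserves abscissas, so `x` and `y` are on the same side of the vertical line of
  -- gluing and the heptagon does not change.
  rcases hq.2 with h4 | h4
  · left
    refine h2 q h4 ?_
    have h5 := mem_P_false.1 h4.1 0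
    rw [n0, ← hyx] at h5
    rcases h1 with h6 | h6 | h6
    · exact openP_subset _ h6
    · have := mem_openP_false.1 (mem_openP_true.1 h6) 0
      rw [neg_sub, normal_dot_shift_sub, n0] at this
      linarith
    · exact openSide_subset _ h6
  · right
    refine h3 q h4 ?_
    have h5 := mem_P_false.1 (mem_P_true.1 h4.1) 0
    rw [neg_sub, normal_dot_shift_sub, n0, ← hyx] at h5
    rcases h1 with h6 | h6 | h6
    · have := mem_openP_false.1 h6 0
      rw [n0] at this
      linarith
    · exact openP_subset _ h6
    · exact sub_shift_mem_P (openSide_subset _ h6) h6.1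

theorem isAffine_twist (ε : ℤ) : IsAffine (twistHomeomorph ε) (twistMatrix ε) := by
  refine ⟨?_, fun p hp => ?_⟩
  · apply Subset.antisymm
    · rintro _ ⟨p, hp, rfl⟩
      change twist ε p ∈ singularities
      rwa [twist_eq_self ε hp]
    · exact fun p hp => ⟨p, hp, twist_eq_self ε hp⟩
  · have key : ∀ k ∈ upper, ∀ b z, IsPt b z p → sgn b * z 0 ∈ openStrip k →
        ∃ j w l w', HasCoord j w p ∧ HasCoord l w' (twist ε p) ∧
        ∀ᶠ x in 𝓝 w, ∀ q, HasCoord j x q →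
          HasCoord l (w' + twistMatrix ε *ᵥ (x - w)) (twist ε q) := by
      intro k hk b z h hz
      rw [← base_mem_openStrip] at hz
      rw [← cyl_base (normal_one_pos hk) (openStrip_subset _ hz) h]
      exact twist_chart_interior hk ε hz
    rcases cases_of_notMem hp with ⟨b, z, h, hz⟩ | ⟨j, z, h, hz⟩
    · by_cases hb : ∃ k ∈ upper, sgn b * z 0 ∈ openStrip k
      · obtain ⟨k, hk, h1⟩ := hb
        exact key k hk b z h h1
      · exact twist_chart_openP ε h hz fun k hk h1 => hb ⟨k, hk, h1⟩
    · rcases upper_cases j with hk | hk | rfl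
      · have hj := normal_one_pos hk
        refine key j hk false z h ?_
        rw [sgn_false, one_mul, openStrip, mem_ofPred_eq, ← abs_tang_mul_normal hz.1,
          abs_of_pos hj]
        exact mul_lt_mul_of_pos_right (mem_openSide_iff.1 hz).2 hj
      · obtain ⟨k, rfl⟩ : ∃ k, j = -k := ⟨-j, (neg_neg j).symm⟩
        rw [neg_neg] at hk
        have hj := normal_one_pos hk
        refine key k hk false z h ?_
        have := abs_tang_mul_normal hz.1
        rw [(normal_neg k).1, (normal_neg k).2, abs_neg, abs_of_pos hj] at this
        rw [sgn_false, one_mul, openStrip, mem_ofPred_eq, ← this]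
        exact mul_lt_mul_of_pos_right (mem_openSide_iff.1 hz).2 hj
      · exact twist_chart_side ε h hz

/-- The parabolic element given by the vertical twist. -/
def parabolic : Matrix.SpecialLinearGroup (Fin 2) ℝ :=
  ⟨!![1, 0; invModulus, 1], by rw [det_fin_two_of]; ring⟩

theorem parabolic_mem_veechGroup : parabolic ∈ veechGroup := by
  refine ⟨twistHomeomorph 1, ?_⟩
  have := isAffine_twist 1
  rwa [twistMatrix, Int.cast_one, one_mul] at this

theorem parabolic_inv_mulVec (z : Plane) :
    parabolic⁻¹.1 *ᵥ z = ![z 0, -invModulus * z 0 + z 1] := by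
  have h : parabolic⁻¹.1 = !![1, 0; -invModulus, 1] := by
    rw [Matrix.SpecialLinearGroup.coe_inv, parabolic, adjugate_fin_two_of, neg_zero]
  rw [h, mulVec_eq]
  simp

end

noncomputable section

/-! ### The cubic field -/

theorem apothem_eq : apothem = a / 2 := by rw [apothem, a]; ring

/-- Multiple-angle formulas turn `cos (4π / 7) = -cos (3π / 7)` into a quartic equation for `a`; the
factor `a + 2` belongs to the angle `π` and is discarded. -/
theorem a_cubic : a ^ 3 - a ^ 2 - 2 * a + 1 = 0 := by
  have h : Real.cos (4 * (Real.pi / 7)) = -Real.cos (3 * (Real.pi / 7)) := by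
    rw [← Real.cos_pi_sub]; congr 1; ring
  rw [show 4 * (Real.pi / 7) = 2 * (2 * (Real.pi / 7)) by ring, Real.cos_two_mul,
    Real.cos_two_mul, Real.cos_three_mul, ← apothem, apothem_eq] at h
  have h1 : (a + 2) * (a ^ 3 - a ^ 2 - 2 * a + 1) = 0 := by linear_combination 2 * h
  have h2 : a + 2 ≠ 0 := by
    have := apothem_pos
    rw [apothem_eq] at this
    linarith
  exact (mul_eq_zero.1 h1).resolve_left h2

theorem halfSide_sq : halfSide ^ 2 = 1 - a ^ 2 / 4 := by
  have := apothem_sq_add_halfSide_sq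
  rw [apothem_eq] at this
  linear_combination this

theorem one_lt_a : 1 < a := by
  have h : Real.cos (Real.pi / 3) < Real.cos (Real.pi / 7) :=
    Real.cos_lt_cos_of_nonneg_of_le_pi (by positivity) (by linarith [Real.pi_pos])
      (by linarith [Real.pi_pos])
  rw [Real.cos_pi_div_three] at h
  rw [a]; linarith

theorem lt_a {c : ℝ} (hc : 1 ≤ c) (h : c ^ 3 - c ^ 2 - 2 * c + 1 < 0) : c < a := by
  by_contra hn
  have := a_cubic
  have := one_lt_a
  -- The second factor is the divided difference of the cubic polynomial between `c` and `a`.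
  nlinarith [mul_nonneg (sub_nonneg.2 (not_lt.1 hn)) (by nlinarith : 0 ≤ a ^ 2 + a * c + c ^ 2 - a - c - 2)]

theorem invModulus_mul (x y y' : ℝ) (h : y' * (1 - a ^ 2 / 4) = y * (1 - a ^ 2 / 4) - a * x) :
    halfSide * y' = -invModulus * x + halfSide * y := by
  have hs := halfSide_pos
  rw [← halfSide_sq] at h
  rw [invModulus, apothem_eq]
  field_simp
  linear_combination h

/-! ### A hyperbolic element -/

/-- The vector `w` is the image of `v` under an element of the Veech group. -/
def VeechRel (v w : Plane) : Prop := ∃ A ∈ veechGroup, A.1 *ᵥ v = w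

theorem VeechRel.trans {u v w : Plane} (h : VeechRel u v) (h' : VeechRel v w) : VeechRel u w := by
  obtain ⟨A, hA, rfl⟩ := h
  obtain ⟨B, hB, rfl⟩ := h'
  exact ⟨B * A, mul_mem_veechGroup hB hA, by
    rw [Matrix.SpecialLinearGroup.coe_mul, mulVec_mulVec]⟩

theorem VeechRel.symm {u v : Plane} (h : VeechRel u v) : VeechRel v u := by
  obtain ⟨A, hA, rfl⟩ := h
  exact ⟨A⁻¹, inv_mem_veechGroup hA, by
    rw [mulVec_mulVec, ← Matrix.SpecialLinearGroup.coe_mul, inv_mul_cancel,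
      Matrix.SpecialLinearGroup.coe_one, one_mulVec]⟩

theorem VeechRel.smul {u v : Plane} (h : VeechRel u v) (c : ℝ) : VeechRel (c • u) (c • v) := by
  obtain ⟨A, hA, rfl⟩ := h
  exact ⟨A, hA, mulVec_smul _ _ _⟩

/-- With second coordinates written as multiples of `halfSide`, only `halfSide ^ 2 = 1 - a ^ 2 / 4`
enters, and the orbit can be followed with coefficients in `ℚ(a)`. -/
theorem VeechRel.rotation {x y x' y' : ℝ} (hx : x' = a / 2 * x - (1 - a ^ 2 / 4) * y)
    (hy : y' = x + a / 2 * y) :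
    VeechRel ![x, halfSide * y] ![x', halfSide * y'] := by
  refine ⟨DoubleHeptagon.rotation, rotation_mem_veechGroup, ?_⟩
  rw [rotation_mulVec, apothem_eq, hx, hy, ← halfSide_sq]
  ext i
  fin_cases i
  · simp; ring
  · simp; ring

theorem VeechRel.parabolic {x y y' : ℝ}
    (hy : y' * (1 - a ^ 2 / 4) = y * (1 - a ^ 2 / 4) - a * x) :
    VeechRel ![x, halfSide * y] ![x, halfSide * y'] := by
  refine ⟨DoubleHeptagon.parabolic⁻¹, inv_mem_veechGroup parabolic_mem_veechGroup, ?_⟩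
  rw [parabolic_inv_mulVec, invModulus_mul x y y' hy]
  rfl

/-- The conjugating word, in order of application: three rotations, then inverse twist, rotation,
inverse twist, rotation and two inverse twists. Each witness is reduced to degree two in `a`. -/
theorem veechRel_conj : VeechRel ![1, halfSide * ((-4/3) + 2 * a + (-2/3) * a ^ 2)]
    ![(4/3) + (-4/3) * a + (1/3) * a ^ 2,
    halfSide * ((20/21) + (-134/21) * a + (68/21) * a ^ 2)] :=
  (VeechRel.rotation (x' := 1 + (-2/3) * a + (1/3) * a ^ 2)
    (y' := (4/3) + (-4/3) * a + (2/3) * a ^ 2)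
    (by linear_combination ((-1/3) + (1/6) * a) * a_cubic)
    (by linear_combination ((1/3)) * a_cubic)).trans <|
  (VeechRel.rotation (x' := (-4/3) + (5/3) * a + (-1/3) * a ^ 2)
    (y' := (2/3) + (2/3) * a)
    (by linear_combination ((-1/6) * a) * a_cubic)
    (by linear_combination ((-1/3)) * a_cubic)).trans <|
  (VeechRel.rotation (x' := (-2/3) + (-4/3) * a + a ^ 2)
    (y' := (-4/3) + 2 * a)
    (by linear_combination (0) * a_cubic)
    (by linear_combination (0) * a_cubic)).trans <|
  (VeechRel.parabolic
    (y' := (4/21) + (-10/21) * a + (8/21) * a ^ 2)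
    (by linear_combination ((32/21) + (-2/21) * a) * a_cubic)).trans <|
  (VeechRel.rotation (x' := (-2/3) + a + (-1/3) * a ^ 2)
    (y' := (-6/7) + (-6/7) * a + (20/21) * a ^ 2)
    (by linear_combination ((-10/21) + (-2/21) * a) * a_cubic)
    (by linear_combination ((-4/21)) * a_cubic)).trans <|
  (VeechRel.parabolic
    (y' := (-10/7) + (26/21) * a + (-4/21) * a ^ 2)
    (by linear_combination ((-4/7) + (2/7) * a) * a_cubic)).trans <|
  (VeechRel.rotation (x' := (4/3) + (-4/3) * a + (1/3) * a ^ 2)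
    (y' := (-4/7) + (2/21) * a + (4/21) * a ^ 2)
    (by linear_combination ((-2/21) + (1/21) * a) * a_cubic)
    (by linear_combination ((2/21)) * a_cubic)).trans <|
  (VeechRel.parabolic
    (y' := (4/21) + (-22/7) * a + (12/7) * a ^ 2)
    (by linear_combination ((16/21) + (-8/21) * a) * a_cubic)).trans <|
  (VeechRel.parabolic
    (y' := (20/21) + (-134/21) * a + (68/21) * a ^ 2)
    (by linear_combination ((16/21) + (-8/21) * a) * a_cubic))

/-- The hyperbolic element itself: five rotations followed by two inverse twists. By
`smul_eigenvector` the final vector is `2 - a` times the initial one. -/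
theorem veechRel_eigenvector : VeechRel
    ![(4/3) + (-4/3) * a + (1/3) * a ^ 2,
    halfSide * ((20/21) + (-134/21) * a + (68/21) * a ^ 2)]
    ![3 + (-14/3) * a + (5/3) * a ^ 2,
    halfSide * ((36/7) + (-424/21) * a + (202/21) * a ^ 2)] :=
  (VeechRel.rotation (x' := (-1/3) + 5 * a + (-8/3) * a ^ 2)
    (y' := (-2/7) + (50/21) * a + (-26/21) * a ^ 2)
    (by linear_combination ((13/21) + (-17/21) * a) * a_cubic)
    (by linear_combination ((-34/21)) * a_cubic)).trans <|
  (VeechRel.rotation (x' := (4/3) + (-13/3) * a + 2 * a ^ 2)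
    (y' := (2/7) + (76/21) * a + (-44/21) * a ^ 2)
    (by linear_combination ((22/21) + (13/42) * a) * a_cubic)
    (by linear_combination ((13/21)) * a_cubic)).trans <|
  (VeechRel.rotation (x' := (-5/3) + (1/3) * a + (1/3) * a ^ 2)
    (y' := (50/21) + (-44/7) * a + (58/21) * a ^ 2)
    (by linear_combination ((-29/21) + (11/21) * a) * a_cubic)
    (by linear_combination ((22/21)) * a_cubic)).trans <|
  (VeechRel.rotation (x' := (-5/3) + (10/3) * a + (-4/3) * a ^ 2)
    (y' := (-64/21) + (30/7) * a + (-10/7) * a ^ 2)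
    (by linear_combination ((5/7) + (-29/42) * a) * a_cubic)
    (by linear_combination ((-29/21)) * a_cubic)).trans <|
  (VeechRel.rotation (x' := 3 + (-14/3) * a + (5/3) * a ^ 2)
    (y' := (-20/21) + (8/21) * a + (2/21) * a ^ 2)
    (by linear_combination ((-1/21) + (5/14) * a) * a_cubic)
    (by linear_combination ((5/7)) * a_cubic)).trans <|
  (VeechRel.parabolic
    (y' := (44/21) + (-208/21) * a + (34/7) * a ^ 2)
    (by linear_combination ((64/21) + (-25/21) * a) * a_cubic)).trans <|
  (VeechRel.parabolic
    (y' := (36/7) + (-424/21) * a + (202/21) * a ^ 2)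
    (by linear_combination ((64/21) + (-25/21) * a) * a_cubic))

theorem smul_eigenvector : (2 - a) • ![(4/3) + (-4/3) * a + (1/3) * a ^ 2,
    halfSide * ((20/21) + (-134/21) * a + (68/21) * a ^ 2)] =
    (![3 + (-14/3) * a + (5/3) * a ^ 2,
    halfSide * ((36/7) + (-424/21) * a + (202/21) * a ^ 2)] : Plane) := by
  ext i
  fin_cases i
  · change (2 - a) * ((4/3) + (-4/3) * a + (1/3) * a ^ 2) = 3 + (-14/3) * a + (5/3) * a ^ 2
    linear_combination ((-1/3)) * a_cubic
  · change (2 - a) * (halfSide * ((20/21) + (-134/21) * a + (68/21) * a ^ 2)) =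
      halfSide * ((36/7) + (-424/21) * a + (202/21) * a ^ 2)
    linear_combination halfSide * ((-68/21)) * a_cubic

theorem slope_eq : slope = halfSide * ((-4/3) + 2 * a + (-2/3) * a ^ 2) := by
  rw [slope, halfSide]; ring

/-- The direction of slope `slope` is contracted by an element of the Veech group. -/
theorem exists_contraction : ∃ A ∈ veechGroup, A.1 *ᵥ ![1, slope] = (2 - a) • ![1, slope] := by
  rw [slope_eq]
  have h := veechRel_eigenvector
  rw [← smul_eigenvector] at h
  -- Conjugation of the hyperbolic element; the way back uses the same word on the rescaled vector.
  exact veechRel_conj.trans (h.trans (veechRel_conj.symm.smul _))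

theorem two_sub_a_pos : 0 < 2 - a := by
  have h : Real.cos (Real.pi / 7) < Real.cos 0 :=
    Real.cos_lt_cos_of_nonneg_of_le_pi le_rfl (by linarith [Real.pi_pos]) (by positivity)
  rw [Real.cos_zero] at h
  rw [a]; linarith

theorem two_sub_a_lt_one : 2 - a < 1 := by linarith [one_lt_a]

/-- A matrix of determinant one with a real eigenvalue in `(0, 1)` is hyperbolic. -/
theorem two_lt_abs_trace {A : Matrix.SpecialLinearGroup (Fin 2) ℝ} {σ μ : ℝ}
    (h : A.1 *ᵥ ![1, σ] = μ • ![1, σ]) (h0 : 0 < μ) (h1 : μ < 1) : 2 < |A.1.trace| := by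
  have hd : A.1.det = 1 := A.2
  rw [det_fin_two] at hd
  rw [mulVec_eq] at h
  have e0 := congrFun h 0
  have e1 := congrFun h 1
  simp only [cons_val_zero, cons_val_one, Pi.smul_apply, smul_eq_mul, mul_one] at e0 e1
  rw [trace_fin_two]
  -- The characteristic equation; the trace exceeds 2 because `(1 - μ) ^ 2` is positive.
  have e : μ * (A.1 0 0 + A.1 1 1) = μ ^ 2 + 1 := by
    linear_combination hd - (A.1 1 1 - μ) * e0 + A.1 0 1 * e1
  refine lt_of_lt_of_le ?_ (le_abs_self _)
  nlinarith [sq_pos_of_pos (sub_pos.2 h1)]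

theorem not_isSaddleConnection_slope (c T : ℝ) (γ : ℝ → Surface) :
    ¬ IsSaddleConnection (c • ![1, slope]) T γ := by
  obtain ⟨A, hA, h⟩ := exists_contraction
  refine not_isSaddleConnection hA (μ := 2 - a) ?_ two_sub_a_pos.ne' ?_ T γ
  · rw [mulVec_smul, h, smul_comm]
  · rw [abs_of_pos two_sub_a_pos]
    exact two_sub_a_lt_one

/-! ### The trace field -/

theorem a_mem_traceField : a ∈ traceField := by
  refine Subfield.subset_closure ⟨rotation, rotation_mem_veechGroup, ?_⟩
  rw [trace_fin_two]
  change a = apothem + apothem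
  rw [apothem_eq]; ring

theorem slope_staircase : ∃ t ∈ traceField, ∃ c : ℝ, c ≠ 0 ∧
    ![1, slope] = c • (fromStaircase *ᵥ ![1, t]) := by
  have ha := two_sub_a_pos
  have ha' := one_lt_a
  have h3 : 3 - a ≠ 0 := by linarith
  have h4 : a + 2 ≠ 0 := by linarith
  -- Obtained by solving `slope * (a / 2 + 1) * (1 + t) = halfSide * (t - 1)` for `t`; the scalar
  -- below makes the first coordinate equal to 1.
  have ht : a / (3 - a) ∈ traceField := by
    have h3' : (3 : ℝ) ∈ traceField := by exact_mod_cast natCast_mem traceField 3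
    exact div_mem a_mem_traceField (sub_mem h3' a_mem_traceField)
  refine ⟨_, ht, 2 * (3 - a) / (3 * (a + 2)), by positivity, ?_⟩
  have e : fromStaircase = !![a / 2 + 1, a / 2 + 1; -halfSide, halfSide] := by
    rw [← apothem_eq]; rfl
  rw [e, mulVec_eq, slope_eq]
  ext i
  fin_cases i
  · simp
    field_simp
    ring
  · simp
    field_simp
    linear_combination (-2) * halfSide * a_cubic

/-! ### The separatrix -/

/-- The point of the surface that is given by a point of `P b`. -/
def toSurface (b : Bool) (z : Plane) : Surface := by
  classical exact if h : z ∈ P b then pt b z h else center b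

theorem isPt_toSurface {b : Bool} {z : Plane} (h : z ∈ P b) : IsPt b z (toSurface b z) :=
  ⟨h, by rw [toSurface, dif_pos h]⟩

theorem continuousOn_toSurface (b : Bool) : ContinuousOn (toSurface b) (P b) := by
  rw [continuousOn_iff_continuous_domRestrict]
  have : (P b).domRestrict (toSurface b) = fun z : P b => pt b z z.2 := by
    ext z
    exact (isPt_toSurface z.2).unique ⟨z.2, rfl⟩
  rw [this]
  exact continuous_quot_mk.comp (Continuous.subtype_mk (by fun_prop) _)

/-- A straight segment that crosses two sides of the heptagons,
from a vertex of `P false` to a point in the interior of `P false`. -/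
theorem exists_separatrix {u w v : Plane} {j k : Fin 7} {t₁ t₂ T : ℝ} (hjk : j ≠ k)
    (huw : u - shift j = w - shift k) (hv : v ≠ 0) (h0 : 0 < t₁) (h12 : t₁ < t₂) (h2 : t₂ < T)
    (hu : u ∈ P false) (huv : IsVertex false u) (huj : normal j ⬝ᵥ u < apothem)
    (h₁ : u + t₁ • v ∈ openSide j) (h₂ : w + t₂ • v ∈ openSide k)
    (hT : w + T • v ∈ openP false) :
    ∃ γ, IsSeparatrix v T γ ∧ IsPt false (w + T • v) (γ T) := by
  -- Each constraint is affine in time: inside a heptagon it is strict as soon as it holds at both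
  -- ends of the piece and is strict at one of them.
  have lin : ∀ (i : Fin 7) (z : Plane) (t : ℝ),
      normal i ⬝ᵥ (z + t • v) = normal i ⬝ᵥ z + t * (normal i ⬝ᵥ v) := fun i z t => by
    rw [dotProduct_add, dotProduct_smul, smul_eq_mul]
  -- the first part
  have a1 : ∀ t, 0 < t → t < t₁ → u + t • v ∈ openP false := by
    intro t ht ht'
    refine mem_openP_false.2 fun i => ?_
    have e1 := mem_P_false.1 hu i
    have e2 := mem_P_false.1 (openSide_subset _ h₁) i
    rw [lin] at e2 ⊢
    by_cases hi : i = j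
    · subst hi; nlinarith
    · have e3 := h₁.2 i hi
      rw [lin] at e3; nlinarith
  -- the second part
  have a2 : ∀ t, t₁ < t → t < t₂ → u - shift j + t • v ∈ openP true := by
    intro t ht ht'
    refine mem_openP_true.2 (mem_openP_false.2 fun i => ?_)
    have b1 := shift_sub_mem_openSide h₁
    have b2 := shift_sub_mem_openSide h₂
    have c1 : shift j - (u + t₁ • v) = -(u - shift j + t₁ • v) := by abel
    have c2 : shift k - (w + t₂ • v) = -(u - shift j + t₂ • v) := by rw [huw]; abel
    rw [c1] at b1
    rw [c2] at b2
    have e1 := mem_P_false.1 (openSide_subset _ b1) i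
    have e2 := mem_P_false.1 (openSide_subset _ b2) i
    rw [dotProduct_neg, lin] at e1 e2 ⊢
    by_cases hi : i = j
    · have e3 := b2.2 i (hi ▸ hjk)
      rw [dotProduct_neg, lin] at e3; nlinarith
    · have e3 := b1.2 i hi
      rw [dotProduct_neg, lin] at e3; nlinarith
  -- the third part
  have a3 : ∀ t, t₂ < t → t ≤ T → w + t • v ∈ openP false := by
    intro t ht ht'
    refine mem_openP_false.2 fun i => ?_
    have e1 := mem_openP_false.1 hT i
    have e2 := mem_P_false.1 (openSide_subset _ h₂) i
    rw [lin] at e1 e2 ⊢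
    nlinarith
  have p1 : ∀ t ∈ Icc 0 t₁, u + t • v ∈ P false := by
    rintro t ⟨ht, ht'⟩
    rcases eq_or_lt_of_le ht with rfl | ht
    · simpa using hu
    rcases eq_or_lt_of_le ht' with rfl | ht'
    · exact openSide_subset _ h₁
    · exact openP_subset _ (a1 t ht ht')
  have p2 : ∀ t ∈ Icc t₁ t₂, u - shift j + t • v ∈ P true := by
    rintro t ⟨ht, ht'⟩
    rcases eq_or_lt_of_le ht with rfl | ht
    · rw [sub_add_eq_add_sub]
      exact sub_shift_mem_P (openSide_subset _ h₁) h₁.1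
    rcases eq_or_lt_of_le ht' with rfl | ht'
    · rw [huw, sub_add_eq_add_sub]
      exact sub_shift_mem_P (openSide_subset _ h₂) h₂.1
    · exact openP_subset _ (a2 t ht ht')
  have p3 : ∀ t ∈ Icc t₂ T, w + t • v ∈ P false := by
    rintro t ⟨ht, ht'⟩
    rcases eq_or_lt_of_le ht with rfl | ht
    · exact openSide_subset _ h₂
    · exact openP_subset _ (a3 t ht ht')
  -- `u` and `w` are the starting point as seen from the first and the last heptagon; by `huw` both
  -- give the same position relative to the middle one. The pieces agree at `t₁` and `t₂` thanks to
  -- the gluing.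
  obtain ⟨γ, hγ⟩ : ∃ γ : ℝ → Surface, γ = fun t => if t ≤ t₁ then toSurface false (u + t • v)
    else if t ≤ t₂ then toSurface true (u - shift j + t • v)
    else toSurface false (w + t • v) := ⟨_, rfl⟩
  have q1 : ∀ t ∈ Icc 0 t₁, γ t = toSurface false (u + t • v) := fun t ht => by
    rw [hγ]; exact if_pos ht.2
  have q2 : ∀ t ∈ Icc t₁ t₂, γ t = toSurface true (u - shift j + t • v) := by
    rintro t ⟨ht, ht'⟩
    rcases eq_or_lt_of_le ht with rfl | hlt
    · rw [q1 t₁ ⟨h0.le, le_rfl⟩]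
      have := (isPt_toSurface (p1 t₁ ⟨h0.le, le_rfl⟩)).glue h₁.1
      rw [← sub_add_eq_add_sub] at this
      exact this.unique (isPt_toSurface (p2 t₁ ⟨ht, ht'⟩))
    · rw [hγ]
      simp only [if_neg (not_le.2 hlt), if_pos ht']
  have q3 : ∀ t ∈ Icc t₂ T, γ t = toSurface false (w + t • v) := by
    rintro t ⟨ht, ht'⟩
    rcases eq_or_lt_of_le ht with rfl | hlt
    · rw [q2 t₂ ⟨h12.le, le_rfl⟩]
      have := (isPt_toSurface (p3 t₂ ⟨ht, ht'⟩)).glue h₂.1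
      rw [← sub_add_eq_add_sub, ← huw] at this
      exact (isPt_toSurface (p2 t₂ ⟨h12.le, le_rfl⟩)).unique this
    · rw [hγ]
      simp only [if_neg (not_le.2 hlt), if_neg (not_le.2 (h12.trans hlt))]
  have r1 : ∀ t ∈ Icc 0 t₁, IsPt false (u + t • v) (γ t) := fun t ht =>
    q1 t ht ▸ isPt_toSurface (p1 t ht)
  have r2 : ∀ t ∈ Icc t₁ t₂, IsPt true (u - shift j + t • v) (γ t) := fun t ht =>
    q2 t ht ▸ isPt_toSurface (p2 t ht)
  have r3 : ∀ t ∈ Icc t₂ T, IsPt false (w + t • v) (γ t) := fun t ht =>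
    q3 t ht ▸ isPt_toSurface (p3 t ht)
  have cont : ∀ (b : Bool) (z : Plane) (s : Set ℝ), (∀ t ∈ s, z + t • v ∈ P b) →
      ContinuousOn (fun t : ℝ => toSurface b (z + t • v)) s := fun b z s h =>
    (continuousOn_toSurface b).comp (by fun_prop) h
  have c1 := (cont _ _ _ p1).congr q1
  have c2 := (cont _ _ _ p2).congr q2
  have c3 := (cont _ _ _ p3).congr q3
  have c12 := c1.union_of_isClosed c2 isClosed_Icc isClosed_Icc
  rw [Icc_union_Icc_eq_Icc h0.le h12.le] at c12
  have c123 := c12.union_of_isClosed c3 isClosed_Icc isClosed_Icc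
  rw [Icc_union_Icc_eq_Icc (h0.trans h12).le h2.le] at c123
  -- The charts of the two crossed sides overlap while the segment is in the middle heptagon, and
  -- together they cover the interior of the time interval.
  have chart1 : ∀ t ∈ Ioo 0 t₂, HasCoord j (u + t • v) (γ t) := by
    rintro t ⟨ht, ht'⟩
    rcases lt_trichotomy t t₁ with h | rfl | h
    · exact (r1 t ⟨ht.le, h.le⟩).hasCoord_false (a1 t ht h) j
    · exact ⟨Or.inr (Or.inr h₁), Or.inl (r1 t ⟨ht.le, le_rfl⟩)⟩
    · have := (r2 t ⟨h.le, ht'.le⟩).hasCoord_true (a2 t h ht') j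
      rwa [add_right_comm, sub_add_cancel] at this
  have chart2 : ∀ t ∈ Ioo t₁ T, HasCoord k (w + t • v) (γ t) := by
    rintro t ⟨ht, ht'⟩
    rcases lt_trichotomy t t₂ with h | rfl | h
    · have := (r2 t ⟨ht.le, h.le⟩).hasCoord_true (a2 t ht h) k
      rwa [huw, add_right_comm, sub_add_cancel] at this
    · exact ⟨Or.inr (Or.inr h₂), Or.inl (r3 t ⟨le_rfl, ht'.le⟩)⟩
    · exact (r3 t ⟨h.le, ht'.le⟩).hasCoord_false (a3 t h ht'.le) k
  have e : ∀ (z : Plane) (s t : ℝ), z + t • v + (s - t) • v = z + s • v := fun z s t => by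
    rw [add_assoc, ← add_smul, add_sub_cancel]
  refine ⟨γ, ⟨hv, h0.trans (h12.trans h2), c123, ?_, ?_⟩, r3 T ⟨h2.le, le_rfl⟩⟩
  · have := r1 0 ⟨le_rfl, h0.le⟩
    rw [zero_smul, add_zero] at this
    exact mem_singularities_iff.2 ⟨false, u, this, huv⟩
  · rintro t ⟨ht, ht'⟩
    rcases lt_or_ge t t₂ with h | h
    · refine ⟨j, u + t • v, ?_⟩
      filter_upwards [Ioo_mem_nhds ht h] with s hs
      rw [e]
      exact chart1 s hs
    · refine ⟨k, w + t • v, ?_⟩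
      filter_upwards [Ioo_mem_nhds (h12.trans_le h) ht'] with s hs
      rw [e]
      exact chart2 s hs

/-! ### Coordinates relative to the crossed sides -/

theorem normal_three : normal 3 0 = -a / 2 ∧ normal 3 1 = halfSide := by
  have e : 2 * Real.pi * ((3 : Fin 7) : ℕ) / 7 = Real.pi - Real.pi / 7 := by norm_num; ring
  rw [normal_zero_apply, normal_one_apply, e, Real.cos_pi_sub, Real.sin_pi_sub, ← apothem,
    ← halfSide, apothem_eq]
  exact ⟨by ring, rfl⟩

theorem normal_one' : normal 1 0 = a ^ 2 / 2 - 1 ∧ normal 1 1 = halfSide * a := by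
  have e : 2 * Real.pi * ((1 : Fin 7) : ℕ) / 7 = 2 * (Real.pi / 7) := by norm_num; ring
  rw [normal_zero_apply, normal_one_apply, e, Real.cos_two_mul, Real.sin_two_mul, ← apothem,
    ← halfSide, apothem_eq]
  constructor <;> ring

theorem normal_four : normal 4 0 = -a / 2 ∧ normal 4 1 = -halfSide := by
  have := normal_neg 3
  rwa [normal_three.1, normal_three.2] at this

theorem normal_six : normal 6 0 = a ^ 2 / 2 - 1 ∧ normal 6 1 = -(halfSide * a) := by
  have := normal_neg 1
  rwa [normal_one'.1, normal_one'.2] at this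

theorem normal_four_dot (x y : ℝ) :
    normal 4 ⬝ᵥ ![x, halfSide * y] = -a / 2 * x - (1 - a ^ 2 / 4) * y := by
  rw [dot_eq, normal_four.1, normal_four.2, ← halfSide_sq]
  simp only [cons_val_zero, cons_val_one]; ring

theorem tang_four_dot (x y : ℝ) :
    tang 4 ⬝ᵥ ![x, halfSide * y] = halfSide * (x - a / 2 * y) := by
  rw [tang_dot, normal_four.1, normal_four.2]
  simp only [cons_val_zero, cons_val_one]; ring

theorem normal_six_dot (x y : ℝ) :
    normal 6 ⬝ᵥ ![x, halfSide * y] = (a ^ 2 / 2 - 1) * x - (1 - a ^ 2 / 4) * a * y := by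
  rw [dot_eq, normal_six.1, normal_six.2, ← halfSide_sq]
  simp only [cons_val_zero, cons_val_one]; ring

theorem tang_six_dot (x y : ℝ) :
    tang 6 ⬝ᵥ ![x, halfSide * y] = halfSide * (a * x + (a ^ 2 / 2 - 1) * y) := by
  rw [tang_dot, normal_six.1, normal_six.2]
  simp only [cons_val_zero, cons_val_one]; ring

theorem mem_openSide_of_abs_lt {k : Fin 7} {z : Plane} {r : ℝ} (h : normal k ⬝ᵥ z = a / 2)
    (hr : tang k ⬝ᵥ z = halfSide * r) (h1 : -1 < r) (h2 : r < 1) : z ∈ openSide k := by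
  have hs := halfSide_pos
  refine mem_openSide_iff.2 ⟨by rw [h, apothem_eq], ?_⟩
  rw [hr, abs_mul, abs_of_pos hs]
  nlinarith [abs_lt.2 ⟨h1, h2⟩]

/-- The segment starts at the vertex common to the sides 4 and 5, leaves through side 6, crosses a
copy of `P true`, and enters the last copy of `P false` through its side 4. -/
theorem exists_separatrix_center_false : ∃ T γ, IsSeparatrix ![1, slope] T γ ∧ 0 < T ∧
    γ T = center false := by
  -- These bounds are narrow enough for all the inequalities between polynomials in `a` below.
  have b1 : 1.8 < a := lt_a (by norm_num) (by norm_num)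
  have b2 : a < 1.805 := by
    by_contra h
    nlinarith [a_cubic, mul_nonneg (sub_nonneg.2 (not_lt.1 h)) (sq_nonneg a)]
  have hc := a_cubic
  set v : Plane := ![1, slope] with hv
  have hv' : v = ![1, halfSide * ((-4/3) + 2 * a + (-2/3) * a ^ 2)] := by rw [hv, slope_eq]
  have add_smul_v : ∀ x y t : ℝ, ![x, halfSide * y] + t • v =
      ![x + t, halfSide * (y + t * ((-4/3) + 2 * a + (-2/3) * a ^ 2))] := by
    intro x y t
    rw [hv']
    ext i
    fin_cases i
    · simp
    · simp; ring
  -- The unfolded displacement from the vertex to the center is `shift 6 - shift 4 - u`. Its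
  -- abscissa is `T`, because `v` has first coordinate 1, and its slope is where `slope` comes from.
  set T : ℝ := 3 / 2 * (a ^ 2 - 1) with hT
  set u : Plane := ![1 - a ^ 2 / 2, halfSide * (-a)] with hu
  set w : Plane := -(T • v) with hw
  have hw' : w = ![-T, halfSide * (-T * ((-4/3) + 2 * a + (-2/3) * a ^ 2))] := by
    rw [hw, hv']
    ext i
    fin_cases i
    · simp
    · simp; ring
  have n4 : normal 4 ⬝ᵥ u = apothem := by
    rw [hu, normal_four_dot, apothem_eq]; ring
  have t4 : tang 4 ⬝ᵥ u = halfSide := by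
    rw [hu, tang_four_dot]; ring
  have uP : u ∈ P false := mem_P_of_side n4 (by rw [t4, abs_of_pos halfSide_pos])
  have uv : IsVertex false u := by
    refine ⟨4 + 1, 4, add_one_ne 4, ?_, ?_⟩
    · rw [sgn_false, one_mul, normal_add_one, n4, t4, ← apothem_sub]; ring
    · rw [sgn_false, one_mul, n4]
  have huw : u - shift 6 = w - shift 4 := by
    rw [hw', hu]
    ext i
    fin_cases i
    · simp [shift, normal_six.1, normal_four.1, apothem_eq]
      linear_combination (-1 / 2) * hc
    · simp [shift, normal_six.2, normal_four.2, apothem_eq]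
      linear_combination halfSide * (2 - a) * hc
  have uj : normal 6 ⬝ᵥ u < apothem := by
    rw [hu, normal_six_dot, apothem_eq]
    nlinarith
  -- The crossing times solve the linear equations of the sides 6 and 4 in `ℚ(a)`; the numbers `r`
  -- below are the crossing positions in units of half a side.
  set t₁ : ℝ := (-111/82) + (-21/82) * a + (75/82) * a ^ 2 with ht₁
  set t₂ : ℝ := (-21/29) + (3/58) * a + (27/29) * a ^ 2 with ht₂
  have h₁ : u + t₁ • v ∈ openSide 6 := by
    rw [hu, add_smul_v]
    refine mem_openSide_of_abs_lt (r := (-21/41) + (6/41) * a + (2/41) * a ^ 2) ?_ ?_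
      (by nlinarith) (by nlinarith)
    · rw [normal_six_dot]
      linear_combination ((29/82) + (-55/41) * a + (73/164) * a ^ 2 + (57/164) * a ^ 3
        + (-25/164) * a ^ 4) * hc
    · rw [tang_six_dot]
      linear_combination halfSide * ((-53/41) + (23/82) * a + (57/82) * a ^ 2
        + (-25/82) * a ^ 3) * hc
  have h₂ : w + t₂ • v ∈ openSide 4 := by
    rw [hw', add_smul_v]
    refine mem_openSide_of_abs_lt (r := (27/29) + (-4/29) * a + (-14/29) * a ^ 2) ?_ ?_
      (by nlinarith) (by nlinarith)
    · rw [normal_four_dot]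
      linear_combination ((30/29) + (-35/116) * a + (-23/116) * a ^ 2 + (11/116) * a ^ 3) * hc
    · rw [tang_four_dot]
      linear_combination halfSide * ((-9/58) + (23/58) * a + (-11/58) * a ^ 2) * hc
  have e : w + T • v = 0 := by rw [hw, neg_add_cancel]
  have hT' : w + T • v ∈ openP false := by
    rw [e]
    intro k
    rw [dotProduct_zero, mul_zero]
    exact apothem_pos
  have hv0 : v ≠ 0 := fun h => by
    have := congrFun h 0
    simp [hv] at this
  obtain ⟨γ, h1, h2⟩ := exists_separatrix (t₁ := t₁) (t₂ := t₂) (T := T) (by decide) huw hv0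
    (by nlinarith) (by nlinarith) (by nlinarith) uP uv uj h₁ h₂ hT'
  rw [e] at h2
  exact ⟨T, γ, h1, h1.2.1, h2.unique ⟨zero_mem _, rfl⟩⟩

theorem exists_separatrix_center (b : Bool) : ∃ (c T : ℝ) (γ : ℝ → Surface), c ≠ 0 ∧
    IsSeparatrix (c • ![1, slope]) T γ ∧ PassesThrough T γ (center b) := by
  obtain ⟨T, γ, h, hT, hc⟩ := exists_separatrix_center_false
  cases b
  · exact ⟨1, T, γ, one_ne_zero, by rwa [one_smul], T, ⟨hT, le_rfl⟩, hc⟩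
  -- The half turn exchanges the centers and reverses the velocity, whence the scalar `-1`.
  · have e : (-1 : Matrix (Fin 2) (Fin 2) ℝ) *ᵥ ![1, slope] = (-1 : ℝ) • ![1, slope] := by
      rw [neg_mulVec, one_mulVec, neg_one_smul]
    have h' := h.map isAffine_halfTurn (by
      rw [e]; exact smul_ne_zero (by norm_num) h.1)
    rw [e] at h'
    refine ⟨-1, T, _, by norm_num, h', T, ⟨hT, le_rfl⟩, ?_⟩
    rw [Function.comp_apply, hc, halfTurn_center]
    simp

theorem not_extendsToSaddleConnection_slope (c T : ℝ) (γ : ℝ → Surface) :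
    ¬ ExtendsToSaddleConnection (c • ![1, slope]) T γ := by
  rintro ⟨T', γ', -, h, -⟩
  exact not_isSaddleConnection_slope c T' γ' h

end

end DoubleHeptagon

open DoubleHeptagon in
/-- The central points of the double heptagon are not connection points, as shown by an explicit
separatrix; its direction is fixed by a hyperbolic element of the Veech group and has, in the
coordinates of the staircase model, a slope in the trace field. -/
theorem corollary3 :
    (∀ b : Bool, center b ∉ singularities ∧ ¬ IsConnectionPoint (center b)) ∧
    (∀ b : Bool, ∃ (c : ℝ) (T : ℝ) (γ : ℝ → Surface), c ≠ 0 ∧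
      IsSeparatrix (c • ![1, slope]) T γ ∧ PassesThrough T γ (center b) ∧
      ¬ ExtendsToSaddleConnection (c • ![1, slope]) T γ) ∧
    (∃ A ∈ veechGroup, 2 < |A.1.trace| ∧ ∃ μ : ℝ, A.1 *ᵥ ![1, slope] = μ • ![1, slope]) ∧
    (∃ t ∈ traceField, ∃ c : ℝ, c ≠ 0 ∧ ![1, slope] = c • (fromStaircase *ᵥ ![1, t])) := by
  refine ⟨fun b => ⟨center_notMem b, fun h => ?_⟩, fun b => ?_, ?_, slope_staircase⟩
  · obtain ⟨c, T, γ, -, h1, h2⟩ := exists_separatrix_center b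
    exact not_extendsToSaddleConnection_slope c T γ (h.2 _ _ _ h1 h2)
  · obtain ⟨c, T, γ, hc, h1, h2⟩ := exists_separatrix_center b
    exact ⟨c, T, γ, hc, h1, h2, not_extendsToSaddleConnection_slope c T γ⟩
  · obtain ⟨A, hA, h⟩ := exists_contraction
    exact ⟨A, hA, two_lt_abs_trace h two_sub_a_pos two_sub_a_lt_one, _, h⟩
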